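/- Let $S$ be a finite set of $n$ letters, $F_S$ the free group on $S$, and $B_S$ the bouquet of directed circles labelled by $S$. Words are over $S\cup S^{-1}$; traversing an edge labelled $s$ against its direction reads $s^{-1}$. A checkpoint automaton $\Sigma$ over $S$ consists of a finite set $\mathcal V$ of checkpoints with a start vertex $v_0\in\mathcal V$; for each $u\in\mathcal V$, a finite directed $S$-labelled rooted tree $T_u$ with root $u$ and at least one edge, immersed in $B_S$ (no two distinct edge-ends at a vertex of $T_u$ read the same letter when leaving that vertex); and for each $u$ a labelling of the leaves of $T_u$ (its vertices without children) by elements of $\mathcal V\setminus\{v_0\}$. $\Sigma$ is the quotient of $\bigsqcup_u T_u$ in which each leaf is glued to the root given by its label, and it is required that no path directed away from the roots that enters a checkpoint from a leaf reading a letter $a\in S\cup S^{-1}$ leaves it reading $a^{-1}$. The accepted language $\mathcal L_\Sigma$ is the set of words labelling paths in $\Sigma$ that begin at $v_0$ and are directed away from the root inside each $T_u$; all these words are reduced. A language $\mathcal L$ of reduced words has growth rate at least $\kappa$ if there is $c>0$ such that, for all but finitely many $L>0$, $\mathcal L$ contains more than $c\,\kappa^L$ reduced words of length $L$. A $\mathrm{CAT}(0)$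 square complex is a (nonempty) simply connected cube complex of dimension at most $2$, not necessarily locally finite, all of whose vertex links are flag simplicial complexes (i.e. simplicial graphs without triangles). A global fixed point of an action is a point of the complex, not necessarily a vertex, fixed by the whole group. Theorem. For every finite set $S$ of $n$ letters there exist $k$ and checkpoint automata $\Sigma^1,\dots,\Sigma^k$ over $S$, each of whose accepted languages $\mathcal L_{\Sigma^j}$ has growth rate at least $\frac n6$, such that the following holds. For every $\mathrm{CAT}(0)$ square complex $\widetilde X$ and every homomorphism $F_S\to\mathrm{Aut}(\widetilde X)$ whose action on $\widetilde X$ has no global fixed point, there is $j\in\{1,\dots,k\}$ such that every nonempty word $w\in\mathcal L_{\Sigma^j}$ acts nontrivially on $\widetilde X$. -/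

import Mathlib

open Filter

universe u v

/-! ### Languages over `S ∪ S⁻¹` and their growth

A letter of `S ∪ S⁻¹` is a pair `(s, ε) : S × Bool`, where `(s, true)` is `s` and `(s, false)` is
`s⁻¹`. This is the convention of `FreeGroup`, so `FreeGroup.mk w` is the element of the free group
spelled by the word `w`, and `FreeGroup.IsReduced w` says that `w` is a reduced word. -/

/-- `lang` has growth rate at least `k`: for some `c > 0`, for all but finitely many `L`, the
language contains more than `c * k ^ L` reduced words of length `L`. -/
def HasGrowthRateAtLeast {S : Type u} (lang : Language (S × Bool)) (k : ℝ) : Prop :=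
  ∃ c : ℝ, 0 < c ∧ ∀ᶠ L : ℕ in atTop,
    c * k ^ L < (({w | w ∈ lang ∧ FreeGroup.IsReduced w ∧ w.length = L} :
      Set (List (S × Bool))).ncard : ℝ)

/-! ### Checkpoint automata -/

/-- A checkpoint automaton over `S`. Every checkpoint `u` carries a finite rooted tree `T_u` with at
least one edge, whose edges are directed and labelled by `S` and which is immersed in the bouquet
of circles. Such a tree is the same thing as a finite set of reduced words that contains the empty
word and is closed under prefixes: a vertex is recorded by the word read along the path from the
root to it. Each leaf of `T_u` is labelled by a checkpoint other than the start vertex.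

The automaton is the quotient of the disjoint union of the trees that glues every leaf to the root
of the tree of its label. The last field asks that no edge of the quotient that runs into a
checkpoint is followed by an edge that leaves it with the inverse letter. -/
structure CheckpointAutomaton (S : Type u) where
  /-- The checkpoint vertices. -/
  V : Type
  finite_V : Finite V
  /-- The start vertex. -/
  start : V
  /-- The vertices of the tree `T_u`. -/
  tree : V → Set (List (S × Bool))
  finite_tree : ∀ u, (tree u).Finite
  nil_mem_tree : ∀ u, [] ∈ tree u
  prefix_mem_tree : ∀ u, ∀ w ∈ tree u, ∀ p, p <+: w → p ∈ tree u
  reduced_tree : ∀ u, ∀ w ∈ tree u, FreeGroup.IsReduced w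
  exists_edge : ∀ u, ∃ w ∈ tree u, w ≠ []
  /-- The labels of the leaves (the value at a word that is not a leaf is irrelevant). -/
  label : V → List (S × Bool) → V
  label_ne_start : ∀ u, ∀ w ∈ tree u, (∀ a, w ++ [a] ∉ tree u) → label u w ≠ start
  reduced_label : ∀ u, ∀ w ∈ tree u, (∀ a, w ++ [a] ∉ tree u) →
    ∀ w' ∈ tree (label u w), FreeGroup.IsReduced (w ++ w')

namespace CheckpointAutomaton

variable {S : Type u}

/-- The vertex `w` of `T_u` is a leaf: it has no child. -/
def IsLeaf (A : CheckpointAutomaton S) (u : A.V) (w : List (S × Bool)) : Prop :=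
  w ∈ A.tree u ∧ ∀ a, w ++ [a] ∉ A.tree u

/-- `A.Reads u w`: the word `w` labels a path in the automaton that begins at the checkpoint `u`
and whose part in each tree is directed away from the root. Such a path runs from root to leaf
through finitely many trees and ends at any vertex of a last one. -/
inductive Reads (A : CheckpointAutomaton S) : A.V → List (S × Bool) → Prop
  | last (u : A.V) (w : List (S × Bool)) : w ∈ A.tree u → Reads A u w
  | step (u : A.V) (w w' : List (S × Bool)) :
      A.IsLeaf u w → Reads A (A.label u w) w' → Reads A u (w ++ w')

/-- The accepted language. -/
def language (A : CheckpointAutomaton S) : Language (S × Bool) :=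
  {w | A.Reads A.start w}

end CheckpointAutomaton

/-! ### CAT(0) square complexes -/

/-- A cube complex of dimension at most two with vertex set `V`, with embedded cells: its
`1`-skeleton is a simple graph, and `IsSquare a b c d` says that there is a square with corners
`a, b, c, d` in this cyclic order. -/
structure SquareComplex (V : Type v) where
  graph : SimpleGraph V
  IsSquare : V → V → V → V → Prop
  adj_of_isSquare : ∀ {a b c d}, IsSquare a b c d → graph.Adj a b
  ne_of_isSquare : ∀ {a b c d}, IsSquare a b c d → a ≠ c
  rotate : ∀ {a b c d}, IsSquare a b c d → IsSquare b c d a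
  reflect : ∀ {a b c d}, IsSquare a b c d → IsSquare d c b a

namespace SquareComplex

variable {V : Type v}

/-- Homotopy of edge paths with fixed endpoints, generated by removing or inserting backtracks and
by pushing a path across a square. -/
inductive Homotopic (X : SquareComplex V) :
    ∀ {a b : V}, X.graph.Walk a b → X.graph.Walk a b → Prop
  | refl {a b : V} (p : X.graph.Walk a b) : Homotopic X p p
  | symm {a b : V} {p q : X.graph.Walk a b} : Homotopic X p q → Homotopic X q p
  | trans {a b : V} {p q r : X.graph.Walk a b} :
      Homotopic X p q → Homotopic X q r → Homotopic X p r
  | cons {a b c : V} (h : X.graph.Adj a b) {p q : X.graph.Walk b c} :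
      Homotopic X p q → Homotopic X (.cons h p) (.cons h q)
  | backtrack {a b c : V} (h : X.graph.Adj a b) (p : X.graph.Walk a c) :
      Homotopic X (.cons h (.cons h.symm p)) p
  | square {a b c d e : V} (_ : X.IsSquare a b c d)
      (hab : X.graph.Adj a b) (hbc : X.graph.Adj b c)
      (had : X.graph.Adj a d) (hdc : X.graph.Adj d c) (p : X.graph.Walk c e) :
      Homotopic X (.cons hab (.cons hbc p)) (.cons had (.cons hdc p))

/-- `X` is connected (in particular nonempty) and every closed edge path is null-homotopic. -/
def IsSimplyConnected (X : SquareComplex V) : Prop :=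
  X.graph.Connected ∧ ∀ (a : V) (p : X.graph.Walk a a), X.Homotopic p .nil

/-- The edges from `x` to `a` and from `x` to `b` are joined by an edge in the link of `x`. -/
def LinkAdj (X : SquareComplex V) (x a b : V) : Prop :=
  ∃ y, X.IsSquare x a y b

/-- A square complex is CAT(0) if it is simply connected and the link of every vertex is a flag
simplicial complex. As links are graphs here, this means that no link has a double edge (first
condition; there are no loops because squares are embedded) or a triangle (second condition). -/
def IsCAT0 (X : SquareComplex V) : Prop :=
  X.IsSimplyConnected ∧
  (∀ x a b y y', X.IsSquare x a y b → X.IsSquare x a y' b → y = y') ∧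
  (∀ x a b c, ¬ (X.LinkAdj x a b ∧ X.LinkAdj x b c ∧ X.LinkAdj x c a))

/-- The group of automorphisms: permutations of the vertices that preserve edges and squares. -/
def Aut (X : SquareComplex V) : Subgroup (Equiv.Perm V) where
  carrier := {g | (∀ a b, X.graph.Adj (g a) (g b) ↔ X.graph.Adj a b) ∧
    ∀ a b c d, X.IsSquare (g a) (g b) (g c) (g d) ↔ X.IsSquare a b c d}
  one_mem' := by simp
  mul_mem' := by
    rintro g h ⟨hg, hg'⟩ ⟨hh, hh'⟩
    simp [hg, hg', hh, hh']
  inv_mem' := by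
    rintro g ⟨hg, hg'⟩
    refine ⟨fun a b => ?_, fun a b c d => ?_⟩
    · rw [← hg]; simp
    · rw [← hg']; simp

/-- The points of the geometric realization: the vertices, the points of edges with coordinate
`t ∈ [0,1]`, and the points of squares with coordinates `(s, t) ∈ [0,1]²`. A point is recorded by
its multilinear coordinates with respect to the corners of a cube that contains it. -/
def points (X : SquareComplex V) : Set (V →₀ ℝ) :=
  {p | (∃ a, p = .single a 1) ∨
    (∃ a b, X.graph.Adj a b ∧ ∃ t ∈ Set.Icc (0 : ℝ) 1, p = .single a (1 - t) + .single b t) ∨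
    (∃ a b c d, X.IsSquare a b c d ∧ ∃ s ∈ Set.Icc (0 : ℝ) 1, ∃ t ∈ Set.Icc (0 : ℝ) 1,
      p = .single a ((1 - s) * (1 - t)) + .single b (s * (1 - t)) +
        .single c (s * t) + .single d ((1 - s) * t))}

/-- The action has a global fixed point: a point of the geometric realization (not necessarily a
vertex) that is fixed by the whole group. -/
def HasGlobalFixedPoint (X : SquareComplex V) {G : Type u} [Group G] (ρ : G →* X.Aut) : Prop :=
  ∃ p ∈ X.points, ∀ g : G, Finsupp.mapDomain (ρ g : Equiv.Perm V) p = p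

end SquareComplex

/-! It suffices to use automata that read one letter at a time and have `4n` states besides the
start. There are finitely many of them, so each action only needs one that allows at least `κ = n/6`
letters at every state and reads no nonempty word acting trivially. There are `2n = 12κ` letters,
and all estimates are counts against this total. Suppose that no such automaton exists for some
action.

Two constructions are then excluded. (1) If a proper subgroup contains the kernel and `κ`
generators, a generator outside it followed by positive words in generators inside it never enters
the subgroup. Hence fewer than `2κ` letters lie in such a subgroup (`letterCount_mem_lt`), for
instance in a proper stabilizer of a wall or of a crossing pair of walls. (2) Ping-pong
(`hasAvoidingAutomaton_of_leads`): the states are halfspaces, and a letter can be read at `C` when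
it moves a base point into a halfspace disjoint from `C` and the complementary side, seen from the
other end, lies in a state. The base point is a vertex `x`, possibly displaced slightly into an
adjacent edge or square, so that both sides of an adjacent wall can be states. Since no three walls
cross pairwise, a letter lies in the regions of at most two states, which bounds the number of
states.

Let `x` minimize the total displacement by the generators. Comparison with the neighbours of `x` and
with the opposite corners of squares at `x` limits the letters that push `x` into an adjacent
halfspace (`Across.displacement_add`, `diag_le`). The failure of ping-pong for various families then
concentrates the letters: of two crossing halfspaces at `x` at most one receives `κ` letters
(`light_of_heavy`), and for some `d` more than `4κ` letters `b` are such that `b` and `b⁻¹` both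
move `x` into `d` and into no other adjacent halfspace (`exists_axis`). Ping-pong on the two sides
of `d` now succeeds (`Stuck.false`).

The stabilizers have to be proper. An invariant vertex, or an invariant crossing pair of walls at a
vertex, yields a fixed vertex or a fixed centre of a square. If a wall is invariant, the argument is
run instead with the walls that cross it, around the vertices adjacent to it; `WallSystem` covers
both cases.

The theory of walls is derived from links and simple connectivity by van der Waerden's trick: walks
act on taut paths modulo pushing across squares (`act_homotopic`). This gives unique normal forms, a
bipartite graph and the quadrangle condition (`exists_square`). -/

/-! ### Finite letter automata -/

section LetterAutomata

variable {S : Type u}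

/-- The inverse of a letter. -/
def invLetter (b : S × Bool) : S × Bool := (b.1, !b.2)

@[simp] theorem invLetter_invLetter (b : S × Bool) : invLetter (invLetter b) = b := by
  simp [invLetter]

/-- The element of the free group given by a letter. -/
def letter (b : S × Bool) : FreeGroup S := FreeGroup.mk [b]

@[simp] theorem letter_invLetter (b : S × Bool) : letter (invLetter b) = (letter b)⁻¹ := by
  simp [letter, invLetter, FreeGroup.inv_mk, FreeGroup.invRev]

open Classical in
/-- The number of letters of `S ∪ S⁻¹` with a given property. -/
noncomputable def letterCount [Fintype S] (P : S × Bool → Prop) : ℕ :=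
  (Finset.univ.filter P).card

/-- The transition tables of a deterministic automaton with a start vertex and states `Fin N`. -/
structure LetterAutomaton (S : Type u) (N : ℕ) where
  /-- The transitions at the start vertex. -/
  init : S × Bool → Option (Fin N)
  /-- The transitions at the other states. -/
  next : Fin N → S × Bool → Option (Fin N)

namespace LetterAutomaton

variable {N : ℕ}

/-- The transitions, with `none` standing for the start vertex. -/
def transition (c : LetterAutomaton S N) : Option (Fin N) → S × Bool → Option (Fin N)
  | none => c.init
  | some q => c.next q

/-- At least `κ` letters can be read at each state, and only reduced words can be read. -/
structure IsValid [Fintype S] (c : LetterAutomaton S N) (κ : ℝ) : Prop where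
  exists_init : ∃ a, (c.init a).isSome
  le_count : ∀ q, κ ≤ letterCount fun b => (c.next q b).isSome
  reduced : ∀ v b q, c.transition v b = some q → c.next q (invLetter b) = none

theorem letterCount_pos_iff [Fintype S] {P : S × Bool → Prop} :
    0 < letterCount P ↔ ∃ b, P b := by
  classical
  simp [letterCount, Finset.card_pos, Finset.filter_nonempty_iff]

/-- The negation of the condition that `FreeGroup.IsReduced` puts on consecutive letters. -/
theorem not_rel_iff {a b : S × Bool} : ¬ (a.1 = b.1 → a.2 = b.2) ↔ b = invLetter a := by
  obtain ⟨a, x⟩ := a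
  obtain ⟨b, y⟩ := b
  cases x <;> cases y <;> simp [invLetter, eq_comm]

theorem mk_cons (b : S × Bool) (w : List (S × Bool)) :
    FreeGroup.mk (b :: w) = letter b * FreeGroup.mk w := by
  rw [letter, FreeGroup.mul_mk]; rfl

/-- The words that can be read from a state. -/
inductive Accepts (c : LetterAutomaton S N) : Option (Fin N) → List (S × Bool) → Prop
  | nil (v) : Accepts c v []
  | cons (v b q w) : c.transition v b = some q → Accepts c (some q) w → Accepts c v (b :: w)

theorem Accepts.mem_of_invariant {c : LetterAutomaton S N} {U : Fin N → Set (FreeGroup S)}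
    (hU : ∀ q b q', c.next q b = some q' → ∀ g ∈ U q, g * letter b ∈ U q')
    {q : Fin N} {w : List (S × Bool)} (h : c.Accepts (some q) w) :
    ∀ g ∈ U q, ∃ q', g * FreeGroup.mk w ∈ U q' := by
  generalize hv : some q = v at h
  induction h generalizing q with
  | nil v => exact fun g hg => ⟨q, by simpa [← FreeGroup.one_eq_mk] using hg⟩
  | cons v b q₁ w hq _ ih =>
    subst hv
    intro g hg
    obtain ⟨q', h⟩ := ih rfl _ (hU q b q₁ hq g hg)
    exact ⟨q', by rwa [mk_cons, ← mul_assoc]⟩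

variable [Fintype S]

theorem IsValid.exists_transition {c : LetterAutomaton S N} {κ : ℝ} (hc : c.IsValid κ) (hκ : 0 < κ)
    (v : Option (Fin N)) : ∃ a, (c.transition v a).isSome := by
  cases v with
  | none => exact hc.exists_init
  | some q =>
    have : (0 : ℝ) < letterCount fun b => (c.next q b).isSome := hκ.trans_le (hc.le_count q)
    exact letterCount_pos_iff.1 (by exact_mod_cast this)

/-- The tree of a state: the root, and one edge for each letter that can be read. -/
def treeAt (c : LetterAutomaton S N) (v : Option (Fin N)) : Set (List (S × Bool)) :=
  {w | w = [] ∨ ∃ b, w = [b] ∧ (c.transition v b).isSome}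

/-- The target of the edge that reads a letter. -/
def labelAt (c : LetterAutomaton S N) (v : Option (Fin N)) : List (S × Bool) → Option (Fin N)
  -- A value that is never used: the root of a valid automaton with `0 < κ` is not a leaf.
  | [] => none
  | b :: _ => c.transition v b

theorem IsValid.leaf {c : LetterAutomaton S N} {κ : ℝ} (hc : c.IsValid κ) (hκ : 0 < κ)
    {v : Option (Fin N)} {w : List (S × Bool)} (hw : w ∈ c.treeAt v)
    (hl : ∀ a, w ++ [a] ∉ c.treeAt v) : ∃ b q, w = [b] ∧ c.transition v b = some q := by
  rcases hw with rfl | ⟨b, rfl, hb⟩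
  · obtain ⟨a, ha⟩ := hc.exists_transition hκ v
    exact absurd (Or.inr ⟨a, rfl, ha⟩) (hl a)
  · obtain ⟨q, hq⟩ := Option.isSome_iff_exists.1 hb
    exact ⟨b, q, rfl, hq⟩

/-- The checkpoint automaton given by transition tables: all trees have depth one. -/
def toCheckpoint (c : LetterAutomaton S N) {κ : ℝ} (hc : c.IsValid κ) (hκ : 0 < κ) :
    CheckpointAutomaton S where
  V := Option (Fin N)
  finite_V := inferInstance
  start := none
  tree := c.treeAt
  finite_tree v := by
    refine ((Set.finite_range fun b : S × Bool => [b]).insert []).subset ?_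
    rintro w (rfl | ⟨b, rfl, -⟩)
    · exact Or.inl rfl
    · exact Or.inr ⟨b, rfl⟩
  nil_mem_tree v := Or.inl rfl
  prefix_mem_tree v w hw p hp := by
    rcases hw with rfl | ⟨b, rfl, hb⟩
    · exact Or.inl (List.prefix_nil.1 hp)
    · rcases p with _ | ⟨x, p⟩
      · exact Or.inl rfl
      · rw [List.cons_prefix_cons] at hp
        obtain ⟨rfl, hp⟩ := hp
        rw [List.prefix_nil.1 hp]
        exact Or.inr ⟨x, rfl, hb⟩
  reduced_tree v w hw := by
    rcases hw with rfl | ⟨b, rfl, -⟩ <;> simp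
  exists_edge v := by
    obtain ⟨a, ha⟩ := hc.exists_transition hκ v
    exact ⟨[a], Or.inr ⟨a, rfl, ha⟩, by simp⟩
  label := c.labelAt
  label_ne_start v w hw hl := by
    obtain ⟨b, q, rfl, hq⟩ := hc.leaf hκ hw hl
    simp [labelAt, hq]
  reduced_label v w hw hl w' hw' := by
    obtain ⟨b, q, rfl, hq⟩ := hc.leaf hκ hw hl
    simp only [labelAt, hq] at hw'
    rcases hw' with rfl | ⟨b', rfl, hb'⟩
    · simp
    · simp only [List.cons_append, List.nil_append, FreeGroup.isReduced_cons_cons,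
        FreeGroup.IsReduced.singleton, and_true]
      by_contra h
      rw [not_rel_iff] at h
      subst h
      simp [transition, hc.reduced v b q hq] at hb'

theorem accepts_of_reads {c : LetterAutomaton S N} {κ : ℝ} (hc : c.IsValid κ) (hκ : 0 < κ)
    (v : (c.toCheckpoint hc hκ).V) (w : List (S × Bool)) (h : (c.toCheckpoint hc hκ).Reads v w) :
    c.Accepts v w := by
  induction h with
  | last v w hw =>
    rcases hw with rfl | ⟨b, rfl, hb⟩
    · exact .nil v
    · obtain ⟨q, hq⟩ := Option.isSome_iff_exists.1 hb
      exact .cons v b q [] hq (.nil _)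
  | step v w w' hw _ ih =>
    obtain ⟨b, q, rfl, hq⟩ := hc.leaf hκ hw.1 hw.2
    have ih : c.Accepts (c.transition v b) w' := ih
    rw [hq] at ih
    exact .cons v b q w' hq ih

theorem reads_of_accepts {c : LetterAutomaton S N} {κ : ℝ} (hc : c.IsValid κ) (hκ : 0 < κ)
    {v : Option (Fin N)} {w : List (S × Bool)} (h : c.Accepts v w) :
    (c.toCheckpoint hc hκ).Reads v w := by
  induction h with
  | nil v => exact .last (A := c.toCheckpoint hc hκ) v [] (Or.inl rfl)
  | cons v b q w hq _ ih =>
    refine .step (A := c.toCheckpoint hc hκ) v [b] w ⟨Or.inr ⟨b, rfl, by simp [hq]⟩, ?_⟩ ?_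
    · rintro a (h | ⟨b', h, -⟩) <;> simp at h
    · change (c.toCheckpoint hc hκ).Reads (c.transition v b) w
      rwa [hq]

theorem Accepts.isReduced {c : LetterAutomaton S N} {κ : ℝ} (hc : c.IsValid κ)
    {v : Option (Fin N)} {w : List (S × Bool)} (h : c.Accepts v w) : FreeGroup.IsReduced w := by
  induction h with
  | nil v => simp
  | cons v b q w hq hw ih =>
    cases hw with
    | nil => simp
    | cons _ b' q' w hq' _ =>
      rw [FreeGroup.isReduced_cons_cons]
      refine ⟨?_, ih⟩
      by_contra h
      rw [not_rel_iff] at h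
      subst h
      simp [transition, hc.reduced v b q hq] at hq'

theorem finite_accepts (c : LetterAutomaton S N) (v : Option (Fin N)) (L : ℕ) :
    {w | c.Accepts v w ∧ w.length = L}.Finite :=
  (List.finite_length_eq _ L).subset fun _ h => h.2

/-- Induction on the length, splitting the words by their first letter, for which there are at least
`κ` choices. -/
theorem IsValid.pow_le_ncard {c : LetterAutomaton S N} {κ : ℝ} (hc : c.IsValid κ) (hκ : 0 < κ)
    (L : ℕ) : ∀ q : Fin N, κ ^ L ≤ ({w | c.Accepts (some q) w ∧ w.length = L}.ncard : ℝ) := by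
  classical
  induction L with
  | zero =>
    intro q
    have : {w | c.Accepts (some q) w ∧ w.length = 0} = {[]} := by
      ext w
      simp only [List.length_eq_zero_iff, Set.mem_ofPred_eq, Set.mem_singleton_iff]
      exact ⟨fun h => h.2, fun h => ⟨h ▸ .nil _, h⟩⟩
    rw [this]
    simp
  | succ L ih =>
    intro q
    set B : Finset (S × Bool) := Finset.univ.filter fun b => (c.next q b).isSome with hB
    have hBc : κ ≤ B.card := by
      have := hc.le_count q
      unfold letterCount at this
      convert this
    let g : S × Bool → Finset (List (S × Bool)) := fun b =>
      ((c.finite_accepts (c.next q b) L).toFinset).image (List.cons b)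
    have hg : ∀ b ∈ B, κ ^ L ≤ ((g b).card : ℝ) := by
      intro b hb
      obtain ⟨q', hq'⟩ := Option.isSome_iff_exists.1 (Finset.mem_filter.1 hb).2
      rw [Finset.card_image_of_injective _ (List.cons_injective), ← Set.ncard_eq_toFinset_card _
        (c.finite_accepts (c.next q b) L), hq']
      exact ih q'
    have hsub : ((B.biUnion g : Finset (List (S × Bool))) : Set (List (S × Bool))) ⊆
        {w | c.Accepts (some q) w ∧ w.length = L + 1} := by
      intro w hw
      obtain ⟨b, hb, hw⟩ := Finset.mem_biUnion.1 (Finset.mem_coe.1 hw)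
      obtain ⟨w', hw', rfl⟩ := Finset.mem_image.1 hw
      obtain ⟨q', hq'⟩ := Option.isSome_iff_exists.1 (Finset.mem_filter.1 hb).2
      have hw' := (Set.Finite.mem_toFinset _).1 hw'
      rw [hq'] at hw'
      exact ⟨.cons _ b q' _ hq' hw'.1, by simp [hw'.2]⟩
    have h1 := Set.ncard_le_ncard hsub (c.finite_accepts _ _)
    rw [Set.ncard_coe_finset, Finset.card_biUnion] at h1
    · calc κ ^ (L + 1) = κ * κ ^ L := by ring
        _ ≤ B.card * κ ^ L := by gcongr
        _ = ∑ b ∈ B, κ ^ L := by simp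
        _ ≤ ∑ b ∈ B, ((g b).card : ℝ) := Finset.sum_le_sum hg
        _ ≤ _ := by exact_mod_cast h1
    · intro b _ b' _ hbb'
      rw [Function.onFun, Finset.disjoint_left]
      intro w hw hw'
      obtain ⟨w1, -, rfl⟩ := Finset.mem_image.1 hw
      obtain ⟨w2, -, h⟩ := Finset.mem_image.1 hw'
      exact hbb' (List.cons.inj h).1.symm

theorem IsValid.hasGrowthRateAtLeast {c : LetterAutomaton S N} {κ : ℝ} (hc : c.IsValid κ)
    (hκ : 0 < κ) : HasGrowthRateAtLeast (c.toCheckpoint hc hκ).language κ := by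
  obtain ⟨a, ha⟩ := hc.exists_init
  obtain ⟨q, hq⟩ := Option.isSome_iff_exists.1 ha
  -- The start vertex may offer a single letter, which costs one factor `κ`; the factor `2` makes
  -- the inequality strict.
  refine ⟨(2 * κ)⁻¹, by positivity, Filter.eventually_atTop.2 ⟨1, fun L hL => ?_⟩⟩
  obtain ⟨L, rfl⟩ := Nat.exists_eq_add_of_le' hL
  have hfin : {w | w ∈ (c.toCheckpoint hc hκ).language ∧ FreeGroup.IsReduced w ∧
      w.length = L + 1}.Finite := (List.finite_length_eq _ (L + 1)).subset fun _ h => h.2.2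
  have hsub : List.cons a '' {w | c.Accepts (some q) w ∧ w.length = L} ⊆
      {w | w ∈ (c.toCheckpoint hc hκ).language ∧ FreeGroup.IsReduced w ∧ w.length = L + 1} := by
    rintro _ ⟨w, ⟨hw, rfl⟩, rfl⟩
    have h : c.Accepts none (a :: w) := .cons none a q w hq hw
    exact ⟨reads_of_accepts hc hκ h, h.isReduced hc, rfl⟩
  have h1 := Set.ncard_le_ncard hsub hfin
  rw [Set.ncard_image_of_injective _ List.cons_injective] at h1
  have h2 := hc.pow_le_ncard hκ L q
  have h3 : (0 : ℝ) < κ ^ L := by positivity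
  calc (2 * κ)⁻¹ * κ ^ (L + 1) = κ ^ L / 2 := by rw [pow_succ]; field_simp
    _ < κ ^ L := by linarith
    _ ≤ _ := h2
    _ ≤ _ := by exact_mod_cast h1

end LetterAutomaton

/-- The number of states that the automata below need. -/
def stateBound (S : Type u) [Fintype S] : ℕ := Fintype.card ((S × Bool) × Bool)

/-- Some letter automaton of bounded size and growth at least `κ` accepts no nonempty word that
spells an element of `T`. -/
def HasAvoidingAutomaton [Fintype S] (κ : ℝ) (T : Set (FreeGroup S)) : Prop :=
  ∃ c : LetterAutomaton S (stateBound S), c.IsValid κ ∧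
    ∀ w, c.Accepts none w → w ≠ [] → FreeGroup.mk w ∉ T

namespace LetterAutomaton

variable [Fintype S] {N : ℕ}

theorem hasAvoidingAutomaton_of_invariant {κ : ℝ} {T : Set (FreeGroup S)}
    (U : Fin (stateBound S) → Set (FreeGroup S)) (hT : ∀ q, ∀ g ∈ U q, g ∉ T)
    (c : LetterAutomaton S (stateBound S)) (hc : c.IsValid κ)
    (hinit : ∀ b q, c.init b = some q → letter b ∈ U q)
    (hU : ∀ q b q', c.next q b = some q' → ∀ g ∈ U q, g * letter b ∈ U q') :
    HasAvoidingAutomaton κ T := by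
  refine ⟨c, hc, fun w hw hne => ?_⟩
  cases hw with
  | nil => exact absurd rfl hne
  | cons _ b q w hq hw =>
    obtain ⟨q', h⟩ := hw.mem_of_invariant hU _ (hinit b q hq)
    rw [mk_cons]
    exact hT q' _ h

end LetterAutomaton

open LetterAutomaton

theorem stateBound_pos [Fintype S] (a : S) : 0 < stateBound S :=
  Fintype.card_pos_iff.2 ⟨((a, true), true)⟩

/-- If at least `κ` of the generators lie in a subgroup that contains `T` and some generator does
not, then the words that start with the latter and go on with the former avoid `T`. -/
theorem hasAvoidingAutomaton_of_subgroup [Fintype S] {κ : ℝ} {T : Set (FreeGroup S)}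
    (H : Subgroup (FreeGroup S)) (hT : T ⊆ H)
    (hκ : κ ≤ letterCount fun b : S × Bool => b.2 = true ∧ letter b ∈ H)
    (hex : ∃ s : S, letter (s, true) ∉ H) : HasAvoidingAutomaton κ T := by
  classical
  obtain ⟨a, ha⟩ := hex
  -- A single state suffices, with the invariant that the element read so far lies outside `H`.
  -- After the start only positive letters are read, and the first letter is positive too, so
  -- nothing cancels.
  let q₀ : Fin (stateBound S) := ⟨0, stateBound_pos a⟩
  let c : LetterAutomaton S (stateBound S) :=
    { init := fun b => if b = (a, true) then some q₀ else none
      next := fun _ b => if b.2 = true ∧ letter b ∈ H then some q₀ else none }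
  refine hasAvoidingAutomaton_of_invariant (fun _ => {g | g ∉ H}) (fun _ g hg h => hg (hT h)) c
    ⟨⟨(a, true), by simp [c]⟩, fun q => ?_, ?_⟩ ?_ ?_
  · convert hκ using 4
    simp only [c]
    split_ifs with h <;> simp [h]
  · intro v b q h
    have hb : b.2 = true := by
      cases v with
      | none =>
        simp only [transition, c, Option.ite_none_right_eq_some] at h
        simp [h.1]
      | some q' =>
        simp only [transition, c, Option.ite_none_right_eq_some] at h
        exact h.1.1
    simp [c, hb, invLetter]
  · intro b q h
    simp only [c, Option.ite_none_right_eq_some] at h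
    simpa [h.1] using ha
  · intro q b q' h g hg hgb
    simp only [c, Option.ite_none_right_eq_some] at h
    exact hg ((H.mul_mem_cancel_right h.1.2).1 hgb)

/-- Reading the letter `b` leads from `U` to `U'`: if `g ∈ U`, then `b⁻¹ g ∈ U'`. -/
structure PingPong (U : Set (FreeGroup S)) (b : S × Bool) (U' : Set (FreeGroup S)) : Prop where
  notMem : letter b ∉ U
  inv_mem : (letter b)⁻¹ ∈ U'
  smul_mem : ∀ g ∈ U, (letter b)⁻¹ * g ∈ U'

/-- The source of the state bound: if each letter belongs to at most two members of a family, the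
members that contain a letter can be indexed by letters and a bit. Spare indices are filled with
`a₀`. -/
theorem exists_enumeration {α β : Type*} (P : β → α → Prop) (a₀ : α)
    (h : ∀ b x y z, P b x → P b y → P b z → x = y ∨ x = z ∨ y = z) (A : Set α) (ha₀ : a₀ ∈ A) :
    ∃ e : β × Bool → α, (∀ i, e i ∈ A) ∧ ∀ b, ∀ x ∈ A, P b x → ∃ i, e i = x := by
  classical
  have key : ∀ b, ∃ f : Bool → α, (∀ i, f i ∈ A) ∧ ∀ x ∈ A, P b x → ∃ i, f i = x := by
    intro b
    by_cases h1 : ∃ x ∈ A, P b x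
    · obtain ⟨x, hx, hPx⟩ := h1
      by_cases h2 : ∃ y ∈ A, P b y ∧ y ≠ x
      · obtain ⟨y, hy, hPy, hyx⟩ := h2
        refine ⟨fun i => if i then x else y, by rintro (_ | _) <;> simp [hx, hy], ?_⟩
        intro z hz hPz
        rcases h b x y z hPx hPy hPz with h | h | h
        · exact absurd h.symm hyx
        · exact ⟨true, by simpa using h⟩
        · exact ⟨false, by simpa using h⟩
      · push Not at h2
        exact ⟨fun _ => x, fun _ => hx, fun z hz hPz => ⟨true, (h2 z hz hPz).symm⟩⟩
    · push Not at h1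
      exact ⟨fun _ => a₀, fun _ => ha₀, fun x hx hP => absurd hP (h1 x hx)⟩
  choose f hf hf' using key
  exact ⟨fun i => f i.1 i.2, fun i => hf _ _, fun b x hx hP =>
    let ⟨i, hi⟩ := hf' b x hx hP; ⟨(b, i), hi⟩⟩

/-- The ping-pong lemma for a family `A` of subsets of the free group. -/
theorem hasAvoidingAutomaton_of_pingPong [Fintype S] {κ : ℝ} (hκ : 0 < κ) {T : Set (FreeGroup S)}
    (A : Set (Set (FreeGroup S))) (hA : A.Nonempty) (hT : ∀ U ∈ A, ∀ g ∈ U, g⁻¹ ∉ T)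
    (h3 : ∀ b : S × Bool, ∀ U₁ ∈ A, ∀ U₂ ∈ A, ∀ U₃ ∈ A, letter b ∈ U₁ → letter b ∈ U₂ →
      letter b ∈ U₃ → U₁ = U₂ ∨ U₁ = U₃ ∨ U₂ = U₃)
    (hcount : ∀ U ∈ A, κ ≤ letterCount fun b : S × Bool => ∃ U' ∈ A, PingPong U b U') :
    HasAvoidingAutomaton κ T := by
  classical
  obtain ⟨U₀, hU₀⟩ := hA
  obtain ⟨e', he', hr'⟩ := exists_enumeration
    (fun (b : S × Bool) (U : Set (FreeGroup S)) => U ∈ A ∧ letter b ∈ U) U₀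
    (fun b x y z hx hy hz => h3 b x hx.1 y hy.1 z hz.1 hx.2 hy.2 hz.2) A hU₀
  let e : Fin (stateBound S) → Set (FreeGroup S) := e' ∘ (Fintype.equivFin _).symm
  have he : ∀ q, e q ∈ A := fun q => he' _
  have hr : ∀ b, ∀ U ∈ A, letter b ∈ U → ∃ q, e q = U := by
    intro b U hU hb
    obtain ⟨i, hi⟩ := hr' b U hU ⟨hU, hb⟩
    exact ⟨Fintype.equivFin _ i, by
      change e' ((Fintype.equivFin _).symm (Fintype.equivFin _ i)) = U
      rw [Equiv.symm_apply_apply, hi]⟩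
  -- The target of a step contains the inverse of the letter read, so it is among the enumerated
  -- members.
  have hstep : ∀ U b, (∃ U' ∈ A, PingPong U b U') ↔ ∃ q, PingPong U b (e q) := by
    intro U b
    constructor
    · rintro ⟨U', hU', h⟩
      obtain ⟨q, rfl⟩ := hr (invLetter b) U' hU' (by simpa using h.inv_mem)
      exact ⟨q, h⟩
    · rintro ⟨q, h⟩
      exact ⟨_, he q, h⟩
  have hpos : (0 : ℝ) < letterCount fun b : S × Bool => ∃ U' ∈ A, PingPong U₀ b U' :=
    hκ.trans_le (hcount U₀ hU₀)
  obtain ⟨a, U', hU', haU⟩ := letterCount_pos_iff.1 (by exact_mod_cast hpos)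
  obtain ⟨q₀, rfl⟩ := hr (invLetter a) U' hU' (by simpa using haU.inv_mem)
  let c : LetterAutomaton S (stateBound S) :=
    { init := fun b => if b = a then some q₀ else none
      next := fun q b => if h : ∃ q', PingPong (e q) b (e q') then some h.choose else none }
  have hnext : ∀ q b q', c.next q b = some q' → PingPong (e q) b (e q') := by
    intro q b q' h
    simp only [c, Option.dite_none_right_eq_some] at h
    obtain ⟨h, h'⟩ := h
    cases h'
    exact h.choose_spec
  -- The invariant concerns inverses because `(g * b)⁻¹ = b⁻¹ * g⁻¹`: appending a letter multiplies
  -- the inverse on the left, as in `PingPong`.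
  refine hasAvoidingAutomaton_of_invariant (fun q => {g | g⁻¹ ∈ e q})
    (fun q g hg => by simpa using hT _ (he q) _ hg) c ⟨⟨a, by simp [c]⟩, fun q => ?_, ?_⟩ ?_ ?_
  · convert hcount _ (he q) using 4
    rw [hstep]
    simp only [c]
    split_ifs with h <;> simp [h]
  · intro v b q h
    -- The state entered by `b` contains `b⁻¹`, while a letter that can be read at a state does not
    -- belong to it.
    have hb : (letter b)⁻¹ ∈ e q := by
      cases v with
      | none =>
        simp only [transition, c, Option.ite_none_right_eq_some] at h
        obtain ⟨rfl, h⟩ := h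
        cases h
        exact haU.inv_mem
      | some q' => exact (hnext _ _ _ h).inv_mem
    cases h' : c.next q (invLetter b) with
    | none => rfl
    | some q'' => exact absurd (by simpa using hb) (hnext _ _ _ h').notMem
  · intro b q h
    simp only [c, Option.ite_none_right_eq_some] at h
    obtain ⟨rfl, h⟩ := h
    cases h
    exact haU.inv_mem
  · intro q b q' h g hg
    simpa using (hnext _ _ _ h).smul_mem _ hg

end LetterAutomata

/-! ### Wall systems -/

section WallSystems

open Pointwise

variable {G : Type u} [Group G] {V : Type v} [MulAction G V]

/-- The maximal members of a family of sets among those that do not contain `x`. -/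
def maximalAvoiding (H : Set (Set V)) (x : V) : Set (Set V) :=
  {A | A ∈ H ∧ x ∉ A ∧ ∀ B ∈ H, x ∉ B → A ⊆ B → B = A}

/-- A family of halfspaces that behaves around the vertices in `base` like the family of all
halfspaces of a `CAT(0)` square complex. -/
structure WallSystem (G : Type u) [Group G] (V : Type v) [MulAction G V] where
  /-- The halfspaces. -/
  halfspaces : Set (Set V)
  /-- The vertices around which the local structure is known. -/
  base : Set V
  base_nonempty : base.Nonempty
  compl_mem : ∀ A ∈ halfspaces, Aᶜ ∈ halfspaces
  smul_mem : ∀ (g : G), ∀ A ∈ halfspaces, g • A ∈ halfspaces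
  nonempty : ∀ A ∈ halfspaces, A.Nonempty
  finite_sep : ∀ x y : V, {A | A ∈ halfspaces ∧ x ∉ A ∧ y ∈ A}.Finite
  exists_adj : ∀ x ∈ base, ∀ A ∈ maximalAvoiding halfspaces x, ∃ y ∈ base, y ∈ A ∧
    ∀ B ∈ halfspaces, B ≠ A → B ≠ Aᶜ → (x ∈ B ↔ y ∈ B)
  no_triangle : ∀ x ∈ base, ∀ A ∈ maximalAvoiding halfspaces x,
    ∀ B ∈ maximalAvoiding halfspaces x, ∀ C ∈ maximalAvoiding halfspaces x,
    (A ∩ B).Nonempty → (A ∩ C).Nonempty → (B ∩ C).Nonempty → A = B ∨ A = C ∨ B = C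

namespace WallSystem

variable (W : WallSystem G V)

/-- The halfspaces that are adjacent to `x` and do not contain it. -/
def link (x : V) : Set (Set V) := maximalAvoiding W.halfspaces x

variable {W} {x : V} {A B C : Set V} {g h : G}

theorem link_subset (hA : A ∈ W.link x) : A ∈ W.halfspaces := hA.1

theorem notMem_of_mem_link (hA : A ∈ W.link x) : x ∉ A := hA.2.1

theorem eq_of_mem_link (hA : A ∈ W.link x) (hB : B ∈ W.halfspaces) (hx : x ∉ B) (h : A ⊆ B) :
    B = A := hA.2.2 B hB hx h

theorem exists_mem_link (hA : A ∈ W.halfspaces) (hx : x ∉ A) : ∃ B ∈ W.link x, A ⊆ B := by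
  obtain ⟨z, hz⟩ := W.nonempty A hA
  obtain ⟨B, hAB, hB⟩ := (W.finite_sep x z).exists_le_maximal ⟨hA, hx, hz⟩
  exact ⟨B, ⟨hB.1.1, hB.1.2.1, fun C hC hxC hBC =>
    (hB.eq_of_le ⟨hC, hxC, hBC hB.1.2.2⟩ hBC).symm⟩, hAB⟩

theorem mem_smul_iff : x ∈ g • A ↔ g⁻¹ • x ∈ A := Set.mem_smul_set_iff_inv_smul_mem

theorem mem_inv_smul_iff : x ∈ g⁻¹ • A ↔ g • x ∈ A := by rw [mem_smul_iff, inv_inv]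

theorem subset_compl_of_disjoint (h : Disjoint A B) : A ⊆ Bᶜ :=
  Set.subset_compl_iff_disjoint_right.2 h

variable (W) in
/-- An infinitesimal displacement of the vertex `x` into pairwise crossing adjacent halfspaces. -/
structure IsFrame (x : V) (e : Set V → ℝ) : Prop where
  nonneg : ∀ A, 0 ≤ e A
  lt_half : ∀ A, e A < 1 / 2
  mem_link : ∀ A, e A ≠ 0 → A ∈ W.link x
  inter : ∀ A B, e A ≠ 0 → e B ≠ 0 → (A ∩ B).Nonempty

open Classical in
/-- The coordinate of the translate by `g` of the displaced vertex `x` in the direction of `A`. -/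
noncomputable def coord (x : V) (e : Set V → ℝ) (A : Set V) (g : G) : ℝ :=
  if g • x ∈ A then 1 - e (g⁻¹ • Aᶜ) else e (g⁻¹ • A)

/-- The group elements that move the displaced vertex further into `A`. -/
def region (x : V) (e : Set V → ℝ) (A : Set V) : Set G := {g | coord x e A (1 : G) < coord x e A g}

variable {e : Set V → ℝ}

theorem coord_compl : coord x e Aᶜ g = 1 - coord x e A g := by
  unfold coord
  by_cases h : g • x ∈ A <;> simp [h]

theorem coord_inv_smul : coord x e (h⁻¹ • A) (h⁻¹ * g) = coord x e A g := by
  unfold coord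
  rw [mem_inv_smul_iff, smul_smul, mul_inv_cancel_left, ← Set.smul_set_compl, smul_smul, smul_smul,
    mul_inv_rev, inv_inv, mul_inv_cancel_right]

/-- The basic ping-pong move. In the direction of `A` the element `g` is no further than `1`, hence
strictly behind `h`; translating by `h⁻¹` and passing to the complement puts `h⁻¹ * g` ahead of `1`.
-/
theorem inv_mul_mem_region (hh : h ∈ region x e A) (hg : g ∉ region x e A) :
    h⁻¹ * g ∈ region x e (h⁻¹ • A)ᶜ := by
  simp only [region, Set.mem_ofPred_eq, not_lt] at *
  have h1 : coord x e (h⁻¹ • A) (1 : G) = coord x e A h := by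
    have := coord_inv_smul (x := x) (e := e) (A := A) (h := h) (g := h)
    rwa [inv_mul_cancel] at this
  rw [coord_compl, coord_compl, coord_inv_smul, h1]
  linarith

theorem one_notMem_region : (1 : G) ∉ region x e A := by simp [region]

namespace IsFrame

variable (hx : x ∈ W.base) (he : W.IsFrame x e)
include he

theorem coord_nonneg : 0 ≤ coord x e A g := by
  unfold coord
  have := he.lt_half (g⁻¹ • Aᶜ)
  have := he.nonneg (g⁻¹ • A)
  split_ifs <;> linarith

theorem coord_le_one : coord x e A g ≤ 1 := by
  have := he.coord_nonneg (A := Aᶜ) (g := g)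
  rw [coord_compl] at this
  linarith

theorem coord_lt_one_of_region (hg : g ∈ region x e A) : coord x e A (1 : G) < 1 :=
  lt_of_lt_of_le hg he.coord_le_one

include hx

/-- A positive coordinate means that `g • x` lies in `A` or is displaced into it. Passing to the
neighbour across a wall of displacement changes no other wall, which forces `g • x ∈ B` and, if `g •
x ∈ A`, rules out a displacement into `Bᶜ`. In the other case that is ruled out because directions
of displacement meet, whereas `A` and `Bᶜ` do not. -/
theorem coord_eq_one (hA : A ∈ W.halfspaces) (hB : B ∈ W.halfspaces) (hAB : A ⊆ B) (hne : A ≠ B)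
    (hg : 0 < coord x e A g) : coord x e B g = 1 := by
  have key : ∀ C, e (g⁻¹ • C) ≠ 0 → ∃ y, g • y ∈ C ∧ g • x ∉ C ∧
      ∀ D ∈ W.halfspaces, D ≠ C → D ≠ Cᶜ → (g • x ∈ D ↔ g • y ∈ D) := by
    intro C hC
    have hl := he.mem_link _ hC
    obtain ⟨y, -, hy, hy'⟩ := W.exists_adj x hx _ hl
    refine ⟨y, mem_inv_smul_iff.1 hy, fun h => notMem_of_mem_link hl (mem_inv_smul_iff.2 h), ?_⟩
    intro D hD h1 h2
    have := hy' (g⁻¹ • D) (W.smul_mem _ _ hD) (fun h => h1 (smul_left_cancel _ h)) (fun h => by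
      rw [← Set.smul_set_compl] at h
      exact h2 (smul_left_cancel _ h))
    rwa [mem_inv_smul_iff, mem_inv_smul_iff] at this
  obtain ⟨a, ha⟩ := W.nonempty A hA
  have hABc : A ≠ Bᶜ := fun h => absurd (hAB ha) (by rw [h] at ha; exact ha)
  have hcases : e (g⁻¹ • Bᶜ) = 0 ∧ g • x ∈ B := by
    by_cases hgA : g • x ∈ A
    · refine ⟨?_, hAB hgA⟩
      by_contra hne0
      obtain ⟨y, hy, hy', hyD⟩ := key _ hne0
      have := (hyD A hA hABc (by rwa [compl_compl])).1 hgA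
      exact hy (hAB this)
    · have h1 : e (g⁻¹ • A) ≠ 0 := by
        unfold coord at hg
        rw [if_neg hgA] at hg
        exact hg.ne'
      obtain ⟨y, hy, hy', hyD⟩ := key _ h1
      have hgB : g • x ∈ B := by
        refine (hyD B hB hne.symm (fun h => hABc ?_)).2 (hAB hy)
        rw [h, compl_compl]
      refine ⟨?_, hgB⟩
      by_contra hne0
      obtain ⟨z, hz, hz'⟩ := he.inter _ _ h1 hne0
      rw [mem_inv_smul_iff] at hz hz'
      exact hz' (hAB hz)
  unfold coord
  rw [if_pos hcases.2, hcases.1, sub_zero]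

/-- For `A ≠ B` the `B`-coordinate equals `1` on the region of `A`. The condition `h1` is essential:
the region of `B` is empty when the coordinate of `B` at `1` is already `1`. -/
theorem region_mono (hA : A ∈ W.halfspaces) (hB : B ∈ W.halfspaces) (hAB : A ⊆ B)
    (h1 : coord x e B (1 : G) < 1) : (region x e A : Set G) ⊆ region x e B := by
  intro g hg
  by_cases h : A = B
  · rwa [← h]
  · have := he.coord_eq_one hx hA hB hAB h (lt_of_le_of_lt he.coord_nonneg hg)
    simpa [region, this] using h1

/-- Complementary coordinates add up to `1` and cannot both increase. In all other cases a positive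
coordinate in `A` forces the coordinate `0` in `B`. -/
theorem disjoint_region (hA : A ∈ W.halfspaces) (hB : B ∈ W.halfspaces) (hAB : Disjoint A B) :
    Disjoint (region x e A : Set G) (region x e B) := by
  rw [Set.disjoint_left]
  intro g hg hg'
  simp only [region, Set.mem_ofPred_eq] at hg hg'
  by_cases h : A = Bᶜ
  · subst h
    rw [coord_compl, coord_compl] at hg
    linarith
  · have h1 := he.coord_eq_one hx hA (W.compl_mem _ hB)
      (subset_compl_of_disjoint hAB) h (lt_of_le_of_lt he.coord_nonneg hg)
    rw [coord_compl] at h1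
    have := he.coord_nonneg (A := B) (g := (1 : G))
    linarith

end IsFrame

/-! ### Ping-pong with halfspaces. -/

section PingPong

variable {S : Type u} {V : Type v} [MulAction (FreeGroup S) V]
  {W : WallSystem (FreeGroup S) V} {x : V} {e : Set V → ℝ}

variable (S V) in
/-- The elements of the free group that act trivially. -/
def trivialElements : Set (FreeGroup S) := {g | ∀ v : V, g • v = v}

theorem smul_set_eq_of_trivial {g : FreeGroup S} (hg : g ∈ trivialElements S V) (A : Set V) :
    g • A = A := by
  ext v
  rw [mem_smul_iff]
  have : g⁻¹ • v = v := by rw [inv_smul_eq_iff, hg v]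
  rw [this]

/-- The letter `b` leads from the halfspace `C` to the halfspace `A'` by way of `A`. -/
def Leads (W : WallSystem (FreeGroup S) V) (x : V) (e : Set V → ℝ) (C : Set V) (b : S × Bool)
    (A' : Set V) : Prop :=
  ∃ A ∈ W.halfspaces, letter b ∈ region x e A ∧ Disjoint A C ∧
    coord x e A' (1 : FreeGroup S) < 1 ∧ ((letter b)⁻¹ • A)ᶜ ⊆ A'

/-- The region of `C` is disjoint from that of `A`, which contains `b`. Elements outside the region
of `A` are sent by `b⁻¹` into the region of `(b⁻¹ • A)ᶜ`, hence into that of `A'`. -/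
theorem Leads.pingPong (hx : x ∈ W.base) (he : W.IsFrame x e) {C A' : Set V} {b : S × Bool}
    (hC : C ∈ W.halfspaces) (hA' : A' ∈ W.halfspaces) (h : Leads W x e C b A') :
    PingPong (region x e C) b (region x e A') := by
  obtain ⟨A, hA, hb, hAC, h1, hsub⟩ := h
  have hd := he.disjoint_region (G := FreeGroup S) hx hA hC hAC
  have hm : ∀ g, g ∉ region x e A → (letter b)⁻¹ * g ∈ region x e A' := fun g hg =>
    he.region_mono hx (W.compl_mem _ (W.smul_mem _ _ hA)) hA' hsub h1 (inv_mul_mem_region hb hg)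
  exact ⟨Set.disjoint_left.1 hd hb, by simpa using hm 1 one_notMem_region,
    fun g hg => hm g (Set.disjoint_right.1 hd hg)⟩

/-- The ping-pong lemma for a family `A` of halfspaces. -/
theorem hasAvoidingAutomaton_of_leads [Fintype S] {κ : ℝ} (hκ : 0 < κ) (hx : x ∈ W.base)
    (he : W.IsFrame x e) (A : Set (Set V)) (hA : A ⊆ W.halfspaces) (hne : A.Nonempty)
    (h3 : ∀ A₁ ∈ A, ∀ A₂ ∈ A, ∀ A₃ ∈ A, (A₁ ∩ A₂).Nonempty → (A₁ ∩ A₃).Nonempty →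
      (A₂ ∩ A₃).Nonempty → A₁ = A₂ ∨ A₁ = A₃ ∨ A₂ = A₃)
    (hcount : ∀ C ∈ A, κ ≤ letterCount fun b => ∃ A' ∈ A, Leads W x e C b A') :
    HasAvoidingAutomaton κ (trivialElements S V) := by
  classical
  refine hasAvoidingAutomaton_of_pingPong hκ (region x e '' A) (hne.image _) ?_ ?_ ?_
  -- An element that acts trivially changes no coordinate, so it lies in no region.
  · rintro _ ⟨C, -, rfl⟩ g hg hT
    have hT' : ∀ v : V, g • v = v := fun v => by
      have := hT v
      rw [inv_smul_eq_iff] at this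
      exact this.symm
    have h1 := smul_set_eq_of_trivial hT C
    have h2 := smul_set_eq_of_trivial hT Cᶜ
    simp only [region, Set.mem_ofPred_eq, coord, hT', h1, h2] at hg
    simp at hg
  · rintro b _ ⟨A₁, h₁, rfl⟩ _ ⟨A₂, h₂, rfl⟩ _ ⟨A₃, h₃, rfl⟩ hb₁ hb₂ hb₃
    have key : ∀ B ∈ A, ∀ C ∈ A, letter b ∈ region x e B → letter b ∈ region x e C →
        (B ∩ C).Nonempty := by
      intro B hB C hC h h'
      by_contra hBC
      exact Set.disjoint_left.1 (he.disjoint_region hx (hA hB) (hA hC)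
        (Set.disjoint_iff_inter_eq_empty.2 (Set.not_nonempty_iff_eq_empty.1 hBC))) h h'
    rcases h3 A₁ h₁ A₂ h₂ A₃ h₃ (key _ h₁ _ h₂ hb₁ hb₂) (key _ h₁ _ h₃ hb₁ hb₃)
      (key _ h₂ _ h₃ hb₂ hb₃) with h | h | h
    · exact Or.inl (h ▸ rfl)
    · exact Or.inr (Or.inl (h ▸ rfl))
    · exact Or.inr (Or.inr (h ▸ rfl))
  · rintro _ ⟨C, hC, rfl⟩
    refine (hcount C hC).trans ?_
    unfold letterCount
    refine Nat.cast_le.2 (Finset.card_le_card fun b hb => ?_)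
    obtain ⟨-, A', hA', h⟩ := Finset.mem_filter.1 hb
    exact Finset.mem_filter.2 ⟨Finset.mem_univ _, _, ⟨A', hA', rfl⟩,
      h.pingPong hx he (hA hC) (hA hA')⟩

end PingPong

end WallSystem

end WallSystems

/-! ### Counting letters -/

section Counting

variable {S : Type u} [Fintype S] {P Q R : S × Bool → Prop}

theorem letterCount_mono (h : ∀ b, P b → Q b) : (letterCount P : ℝ) ≤ letterCount Q := by
  classical
  exact Nat.cast_le.2 (Finset.card_le_card (Finset.monotone_filter_right _ fun b _ => h b))

theorem letterCount_le_add (h : ∀ b, P b → Q b ∨ R b) :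
    (letterCount P : ℝ) ≤ letterCount Q + letterCount R := by
  classical
  unfold letterCount
  rw [← Nat.cast_add]
  refine Nat.cast_le.2 ((Finset.card_le_card ?_).trans (Finset.card_union_le _ _))
  intro b hb
  simpa using h b (by simpa using hb)

theorem letterCount_add_le (hP : ∀ b, P b → R b) (hQ : ∀ b, Q b → R b) (h : ∀ b, P b → ¬ Q b) :
    (letterCount P : ℝ) + letterCount Q ≤ letterCount R := by
  classical
  unfold letterCount
  rw [← Nat.cast_add, ← Finset.card_union_of_disjoint]
  · refine Nat.cast_le.2 (Finset.card_le_card fun b hb => ?_)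
    simp only [Finset.mem_union, Finset.mem_filter, Finset.mem_univ, true_and] at hb ⊢
    exact hb.elim (hP b) (hQ b)
  · rw [Finset.disjoint_filter]
    exact fun b _ => h b

theorem letterCount_invLetter (P : S × Bool → Prop) :
    letterCount (fun b => P (invLetter b)) = letterCount P := by
  classical
  unfold letterCount
  refine Finset.card_bij (fun b _ => invLetter b) (by simp) ?_ ?_
  · intro b _ b' _ h
    rw [← invLetter_invLetter b, h, invLetter_invLetter]
  · intro b hb
    exact ⟨invLetter b, by simpa using hb, by simp⟩

theorem letterCount_congr_inv (h : ∀ b, P b ↔ Q (invLetter b)) : letterCount P = letterCount Q := by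
  rw [← letterCount_invLetter Q]
  congr 1
  ext b
  exact h b

theorem letterCount_true : letterCount (fun _ : S × Bool => True) = 2 * Fintype.card S := by
  classical
  simp [letterCount, mul_comm]

open Classical in
theorem letterCount_eq_sum (P : S × Bool → Prop) : letterCount P =
    ∑ s : S, ((if P (s, true) then 1 else 0) + if P (s, false) then 1 else 0) := by
  unfold letterCount
  rw [Finset.card_filter, Fintype.sum_prod_type]
  exact Finset.sum_congr rfl fun s _ => Fintype.sum_bool _

/-- If no automaton avoids `T`, then less than `2κ` letters lie in a proper subgroup containing
`T`. -/
theorem letterCount_mem_lt {κ : ℝ} {T : Set (FreeGroup S)} (h : ¬ HasAvoidingAutomaton κ T)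
    (H : Subgroup (FreeGroup S)) (hT : T ⊆ H) (hH : ∃ g, g ∉ H) :
    (letterCount (fun b : S × Bool => letter b ∈ H) : ℝ) < 2 * κ := by
  by_contra! hle
  have h1 : (letterCount (fun b : S × Bool => letter b ∈ H) : ℝ) ≤
      letterCount (fun b : S × Bool => b.2 = true ∧ letter b ∈ H) +
      letterCount (fun b : S × Bool => b.2 = false ∧ letter b ∈ H) :=
    letterCount_le_add fun b hb => by cases hb2 : b.2 <;> simp [hb]
  -- A subgroup is closed under inversion, so half of its letters are positive; this is where the
  -- factor `2` comes from.
  have h2 : letterCount (fun b : S × Bool => b.2 = false ∧ letter b ∈ H) =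
      letterCount (fun b : S × Bool => b.2 = true ∧ letter b ∈ H) :=
    letterCount_congr_inv fun b => by
      rw [letter_invLetter, inv_mem_iff]
      simp [invLetter]
  rw [h2] at h1
  refine h (hasAvoidingAutomaton_of_subgroup H hT (by linarith) ?_)
  by_contra! hall
  obtain ⟨g, hg⟩ := hH
  have : Subgroup.closure (Set.range FreeGroup.of) ≤ H := by
    rw [Subgroup.closure_le]
    rintro _ ⟨s, rfl⟩
    exact hall s
  rw [FreeGroup.closure_range_of] at this
  exact hg (this trivial)

end Counting

namespace WallSystem

open Pointwise

/-! ### Displacement -/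

section Displacement

variable {S : Type u} {V : Type v} [MulAction (FreeGroup S) V] {W : WallSystem (FreeGroup S) V}
  {x y : V} {A B : Set V}

variable (W) in
/-- The number of walls that separate `x` from its translate by `g`. -/
noncomputable def sepCount (x : V) (g : FreeGroup S) : ℕ :=
  {B | B ∈ W.halfspaces ∧ x ∉ B ∧ g • x ∈ B}.ncard

variable (W) in
/-- The total displacement of `x` by the generators. -/
noncomputable def displacement [Fintype S] (x : V) : ℕ :=
  ∑ s : S, W.sepCount x (letter (s, true))

/-- `y` lies in `A`, and only the walls of `A` separates it from `x`. -/
structure Across (W : WallSystem (FreeGroup S) V) (A : Set V) (x y : V) : Prop where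
  mem : A ∈ W.halfspaces
  notMem : x ∉ A
  mem_right : y ∈ A
  iff : ∀ B ∈ W.halfspaces, B ≠ A → B ≠ Aᶜ → (x ∈ B ↔ y ∈ B)

open Classical in
theorem ncard_eq_add_sum {α : Type*} {D : Set α} (hD : D.Finite) (F : Finset α) :
    D.ncard = (D \ F).ncard + ∑ B ∈ F, if B ∈ D then 1 else 0 := by
  have h1 : (D ∩ (F : Set α)).ncard = ∑ B ∈ F, if B ∈ D then 1 else 0 := by
    rw [← Finset.card_filter, ← Set.ncard_coe_finset]
    congr 1
    ext B
    simp [and_comm]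
  rw [← h1, add_comm]
  exact (Set.ncard_inter_add_ncard_sdiff_eq_ncard D _ hD).symm

theorem ne_compl_self (A : Set V) (x : V) : A ≠ Aᶜ := fun h => by
  by_cases hx : x ∈ A
  · exact absurd hx (by rw [h] at hx; exact hx)
  · exact hx (by rw [h]; exact hx)

theorem Across.smul_iff (h : W.Across A x y) {g : FreeGroup S} (hB : B ∈ W.halfspaces)
    (h1 : B ≠ g • A) (h2 : B ≠ (g • A)ᶜ) : g • x ∈ B ↔ g • y ∈ B := by
  have := h.iff (g⁻¹ • B) (W.smul_mem _ _ hB)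
    (fun h => h1 (by rw [← h, smul_inv_smul]))
    (fun h => h2 (by rw [← Set.smul_set_compl, ← h, smul_inv_smul]))
  rwa [mem_inv_smul_iff, mem_inv_smul_iff] at this

-- Replacing `x` by `y` affects only whether the walls of `A` and of `g • A` separate the point from
-- its translate. The second is tested on `g⁻¹ • x` and `A`. If `g` preserves or flips the wall of
-- `A`, nothing changes, and the side conditions discard these cases.
open Classical in
theorem Across.sepCount_add (h : W.Across A x y) (g : FreeGroup S) :
    W.sepCount y g + ((if g • x ∈ A ∧ g • A ≠ Aᶜ then 1 else 0) +
      if g⁻¹ • x ∈ A ∧ g⁻¹ • A ≠ Aᶜ then 1 else 0) =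
    W.sepCount x g + ((if g • x ∉ A ∧ g • A ≠ A then 1 else 0) +
      if g⁻¹ • x ∉ A ∧ g⁻¹ • A ≠ A then 1 else 0) := by
  have hA := h.mem
  have hAc := W.compl_mem _ hA
  have hgA := W.smul_mem g _ hA
  have hgAc := W.compl_mem _ hgA
  have hinv : ∀ B : Set V, g⁻¹ • A = B ↔ g • B = A := fun B => by
    rw [inv_smul_eq_iff, eq_comm]
  have hself := ne_compl_self A x
  have hsm : ∀ v : V, ∀ B : Set V, g⁻¹ • v ∈ B ↔ v ∈ g • B := fun v B => mem_smul_iff.symm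
  have hgx : g • x ∉ g • A := by rw [Set.smul_mem_smul_set_iff]; exact h.notMem
  have hgy : g • y ∈ g • A := by rw [Set.smul_mem_smul_set_iff]; exact h.mem_right
  have hfx := W.finite_sep x (g • x)
  have hfy := W.finite_sep y (g • y)
  have hx := h.notMem
  have hy := h.mem_right
  unfold sepCount
  simp only [ne_eq, hinv, hsm, Set.smul_set_compl]
  have hdiff : ∀ F : Finset (Set V), A ∈ F → Aᶜ ∈ F → g • A ∈ F → (g • A)ᶜ ∈ F →
      {B | B ∈ W.halfspaces ∧ x ∉ B ∧ g • x ∈ B} \ (F : Set (Set V)) =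
      {B | B ∈ W.halfspaces ∧ y ∉ B ∧ g • y ∈ B} \ (F : Set (Set V)) := by
    intro F h1 h2 h3 h4
    ext B
    simp only [Set.mem_sdiff, Set.mem_ofPred_eq, Finset.mem_coe]
    refine and_congr_left fun hB => and_congr_right fun hBH => ?_
    rw [h.iff B hBH (fun h => hB (h ▸ h1)) (fun h => hB (h ▸ h2)),
      h.smul_iff hBH (fun h => hB (h ▸ h3)) (fun h => hB (h ▸ h4))]
  by_cases h1 : g • A = A
  · have hd := hdiff {A, Aᶜ} (by simp) (by simp) (by simp [h1]) (by simp [h1])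
    rw [ncard_eq_add_sum hfx {A, Aᶜ}, ncard_eq_add_sum hfy {A, Aᶜ}, hd]
    rw [h1] at hgx hgy
    rw [Finset.sum_pair hself, Finset.sum_pair hself]
    simp [h1, hx, hy, hgx, hgy]
  by_cases h2 : g • A = Aᶜ
  · have hd := hdiff {A, Aᶜ} (by simp) (by simp) (by simp [h2]) (by simp [h2])
    rw [ncard_eq_add_sum hfx {A, Aᶜ}, ncard_eq_add_sum hfy {A, Aᶜ}, hd]
    rw [h2] at hgx hgy
    rw [Finset.sum_pair hself, Finset.sum_pair hself]
    simp at hgx hgy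
    simp [h2, hx, hy, hgx, hgy, hA, hAc]
  · have h3 : Aᶜ ≠ g • A := fun h => h2 h.symm
    have h4 : A ≠ (g • A)ᶜ := fun h => h2 (by rw [h, compl_compl]; exact h ▸ rfl)
    have h5 : Aᶜ ≠ (g • A)ᶜ := fun h => h1 (compl_injective h).symm
    have hd := hdiff {A, Aᶜ, g • A, (g • A)ᶜ} (by simp) (by simp) (by simp) (by simp)
    rw [ncard_eq_add_sum hfx {A, Aᶜ, g • A, (g • A)ᶜ},
      ncard_eq_add_sum hfy {A, Aᶜ, g • A, (g • A)ᶜ}, hd]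
    have hself' := ne_compl_self (g • A) x
    have e1 : y ∈ g • A ↔ x ∈ g • A := (h.iff _ hgA (Ne.intro h1) h2).symm
    have e2 : g • y ∈ A ↔ g • x ∈ A := (h.smul_iff hA (fun h => h1 h.symm) h4).symm
    have h6 : (g • A)ᶜ ≠ A := h4.symm
    have h7 : A ≠ g • A := fun h => h1 h.symm
    rw [Finset.sum_insert (by simp [hself, h7, h4]), Finset.sum_insert (by simp [h3, h5]),
      Finset.sum_pair hself', Finset.sum_insert (by simp [hself, h7, h4]),
      Finset.sum_insert (by simp [h3, h5]), Finset.sum_pair hself']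
    by_cases c1 : g • x ∈ A <;> by_cases c2 : x ∈ g • A <;>
      simp [hA, hAc, hgA, hgAc, hx, hy, hgx, hgy, e1, e2, c1, c2, h1, h2, h6]

variable [Fintype S]

/-- Summed over the generators, the terms of `g` and `g⁻¹` become a count over all letters. -/
theorem Across.displacement_add (h : W.Across A x y) :
    W.displacement y + letterCount (fun b : S × Bool => letter b • x ∈ A ∧ letter b • A ≠ Aᶜ) =
    W.displacement x + letterCount (fun b : S × Bool => letter b • x ∉ A ∧ letter b • A ≠ A) := by
  classical
  unfold displacement
  rw [letterCount_eq_sum, letterCount_eq_sum, ← Finset.sum_add_distrib, ← Finset.sum_add_distrib]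
  refine Finset.sum_congr rfl fun s _ => ?_
  have hs : letter (s, false) = (letter (s, true))⁻¹ := letter_invLetter (s, true)
  rw [hs]
  convert h.sepCount_add (letter (s, true)) using 4

end Displacement

/-! ### Displaced vertices and covering families of halfspaces. -/

section Frames

variable {G : Type u} [Group G] {V : Type v} [MulAction G V]
  {W : WallSystem G V} {x : V} {e : Set V → ℝ} {A B C d i : Set V} {g : G}

theorem coord_one_of_notMem (hx : x ∉ A) : coord x e A (1 : G) = e A := by
  simp [coord, hx]

theorem coord_compl_one (hx : x ∉ A) : coord x e Aᶜ (1 : G) = 1 - e A := by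
  rw [coord_compl, coord_one_of_notMem hx]

theorem mem_or_of_mem_region (hx : x ∉ A) (hg : g ∈ region x e A) :
    g • x ∈ A ∨ e A < e (g⁻¹ • A) := by
  by_cases h : g • x ∈ A
  · exact Or.inl h
  · simp only [region, Set.mem_ofPred_eq, coord_one_of_notMem hx] at hg
    unfold coord at hg
    rw [if_neg h] at hg
    exact Or.inr hg

theorem mem_region_compl (hx : x ∉ A) (hgx : g • x ∉ A) (hg : e (g⁻¹ • A) < e A) :
    g ∈ region x e Aᶜ := by
  simp only [region, Set.mem_ofPred_eq, coord_compl, coord_one_of_notMem hx]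
  unfold coord
  rw [if_neg hgx]
  linarith

theorem mem_or_compl_mem_link (h : coord x e B (1 : G) < 1) : x ∉ B ∨ e Bᶜ ≠ 0 := by
  by_cases hx : x ∈ B
  · right
    intro h0
    unfold coord at h
    simp [hx, h0] at h
  · exact Or.inl hx

namespace IsFrame

variable (he : W.IsFrame x e)
include he

theorem coord_one_lt_one (hx : x ∉ A) : coord x e A (1 : G) < 1 := by
  rw [coord_one_of_notMem hx]
  linarith [he.lt_half A]

theorem mem_region_of_mem (hx : x ∉ A) (hg : g • x ∈ A) : g ∈ region x e A := by
  simp only [region, Set.mem_ofPred_eq, coord_one_of_notMem hx]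
  unfold coord
  rw [if_pos hg]
  linarith [he.lt_half A, he.lt_half (g⁻¹ • Aᶜ)]

theorem mem_region_of_lt (hx : x ∉ A) (hg : e A < e (g⁻¹ • A)) : g ∈ region x e A := by
  by_cases h : g • x ∈ A
  · exact he.mem_region_of_mem hx h
  · simp only [region, Set.mem_ofPred_eq, coord_one_of_notMem hx]
    unfold coord
    rwa [if_neg h]

end IsFrame

variable (W) in
/-- Every halfspace that the displaced vertex is not strictly inside of lies in a member of `A`. -/
def Covers (x : V) (e : Set V → ℝ) (A : Set (Set V)) : Prop :=
  ∀ B ∈ W.halfspaces, coord x e B (1 : G) < 1 → ∃ A' ∈ A, coord x e A' (1 : G) < 1 ∧ B ⊆ A'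

theorem isFrame_zero : W.IsFrame x 0 := ⟨by simp, by simp, by simp, by simp⟩

theorem covers_link : W.Covers x 0 (W.link x) := by
  intro B hB h
  rcases mem_or_compl_mem_link h with h | h
  · obtain ⟨A, hA, hBA⟩ := exists_mem_link hB h
    exact ⟨A, hA, isFrame_zero (W := W).coord_one_lt_one (notMem_of_mem_link hA), hBA⟩
  · simp at h

open Classical in
/-- The displacement into the halfspaces `d` and `i`, further into `d` than into `i`. -/
noncomputable def offset (d i : Set V) : Set V → ℝ := fun B =>
  -- Only `0 < 1/5 < 1/3 < 1/2` matters. For `i = d` the displacement is into `d` alone.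
  if B = d then 1 / 3 else if B = i then 1 / 5 else 0

theorem offset_left : offset d i d = 1 / 3 := by simp [offset]

theorem offset_right (h : i ≠ d) : offset d i i = 1 / 5 := by simp [offset, h]

theorem offset_of_ne (h : A ≠ d) (h' : A ≠ i) : offset d i A = 0 := by simp [offset, h, h']

theorem offset_lt_left (h : A ≠ d) : offset d i A < 1 / 3 := by
  unfold offset
  rw [if_neg h]
  split_ifs <;> norm_num

theorem eq_or_eq_of_offset_ne_zero (h : offset d i A ≠ 0) : A = d ∨ A = i := by
  by_contra! h'
  exact h (offset_of_ne h'.1 h'.2)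

theorem isFrame_offset (hd : d ∈ W.link x) (hi : i ∈ W.link x) (hdi : (d ∩ i).Nonempty) :
    W.IsFrame x (offset d i) where
  nonneg A := by unfold offset; split_ifs <;> norm_num
  lt_half A := by unfold offset; split_ifs <;> norm_num
  mem_link A h := by rcases eq_or_eq_of_offset_ne_zero h with rfl | rfl <;> assumption
  inter A B h h' := by
    have hd' : (d ∩ d).Nonempty := by rw [Set.inter_self]; exact hdi.left
    have hi' : (i ∩ i).Nonempty := by rw [Set.inter_self]; exact hdi.right
    rcases eq_or_eq_of_offset_ne_zero h with rfl | rfl <;>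
      rcases eq_or_eq_of_offset_ne_zero h' with rfl | rfl <;>
      first | assumption | (rw [Set.inter_comm]; assumption)

variable (W) in
/-- The halfspaces adjacent to `x` that cross `d`. -/
def crossing (x : V) (d : Set V) : Set (Set V) := {A | A ∈ W.link x ∧ A ≠ d ∧ (A ∩ d).Nonempty}

theorem disjoint_of_not_inter (h : ¬ (A ∩ B).Nonempty) : Disjoint A B :=
  Set.disjoint_iff_inter_eq_empty.2 (Set.not_nonempty_iff_eq_empty.1 h)

theorem disjoint_of_mem_crossing (hx : x ∈ W.base) (hd : d ∈ W.link x) (hA : A ∈ W.crossing x d)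
    (hB : B ∈ W.crossing x d) (h : A ≠ B) : Disjoint A B := by
  refine disjoint_of_not_inter fun hAB => ?_
  rcases W.no_triangle x hx A hA.1 B hB.1 d hd hAB hA.2.2 hB.2.2 with h' | h' | h'
  exacts [h h', hA.2.1 h', hB.2.1 h']

/-- A halfspace adjacent to `x` that does not meet `d` lies in `dᶜ`, and the vertex displaced into
`d` is not fully inside `dᶜ`. So `dᶜ` stands in for all of these. -/
theorem covers_offset_self (hd : d ∈ W.link x) :
    W.Covers x (offset d d) ({d, dᶜ} ∪ W.crossing x d) := by
  have hne := W.nonempty _ (link_subset hd)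
  have he := isFrame_offset hd hd (by rwa [Set.inter_self])
  have hxd := notMem_of_mem_link hd
  have hdc : coord x (offset d d) dᶜ (1 : G) < 1 := by
    rw [coord_compl_one hxd, offset_left]; norm_num
  intro B hB h
  rcases mem_or_compl_mem_link h with h | h
  · obtain ⟨A, hA, hBA⟩ := exists_mem_link hB h
    have h1 := he.coord_one_lt_one (notMem_of_mem_link hA)
    by_cases hAd : A = d
    · exact ⟨A, by simp [hAd], h1, hBA⟩
    by_cases hi : (A ∩ d).Nonempty
    · exact ⟨A, Or.inr ⟨hA, hAd, hi⟩, h1, hBA⟩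
    · exact ⟨dᶜ, by simp, hdc, hBA.trans (subset_compl_of_disjoint (disjoint_of_not_inter hi))⟩
  · refine ⟨dᶜ, by simp, hdc, ?_⟩
    rcases eq_or_eq_of_offset_ne_zero h with h | h <;> rw [← h, compl_compl]

/-- As no three walls cross pairwise, a halfspace at `x` other than `i` that crosses `d` is disjoint
from `i`, so `iᶜ` stands in for it. -/
theorem covers_offset (hx : x ∈ W.base) (hd : d ∈ W.link x) (hi : i ∈ W.crossing x d) :
    W.Covers x (offset d i) {d, dᶜ, i, iᶜ} := by
  have he := isFrame_offset hd hi.1 (by rw [Set.inter_comm]; exact hi.2.2)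
  have hxd := notMem_of_mem_link hd
  have hxi := notMem_of_mem_link hi.1
  have hdc : coord x (offset d i) dᶜ (1 : G) < 1 := by
    rw [coord_compl_one hxd, offset_left]; norm_num
  have hic : coord x (offset d i) iᶜ (1 : G) < 1 := by
    rw [coord_compl_one hxi, offset_right hi.2.1]; norm_num
  intro B hB h
  rcases mem_or_compl_mem_link h with h | h
  · obtain ⟨A, hA, hBA⟩ := exists_mem_link hB h
    have h1 := he.coord_one_lt_one (notMem_of_mem_link hA)
    by_cases hAd : A = d
    · exact ⟨A, by simp [hAd], h1, hBA⟩
    by_cases hAi : A = i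
    · exact ⟨A, by simp [hAi], h1, hBA⟩
    by_cases h2 : (A ∩ d).Nonempty
    · exact ⟨iᶜ, by simp, hic, hBA.trans (subset_compl_of_disjoint
        (disjoint_of_mem_crossing hx hd ⟨hA, hAd, h2⟩ hi hAi))⟩
    · exact ⟨dᶜ, by simp, hdc, hBA.trans (subset_compl_of_disjoint (disjoint_of_not_inter h2))⟩
  · rcases eq_or_eq_of_offset_ne_zero h with h | h
    · exact ⟨dᶜ, by simp, hdc, by rw [← h, compl_compl]⟩
    · exact ⟨iᶜ, by simp, hic, by rw [← h, compl_compl]⟩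

theorem coord_compl_inv_smul_lt (he : W.IsFrame x e)
    (hg : g ∈ region x e A) : coord x e (g⁻¹ • A)ᶜ (1 : G) < 1 :=
  he.coord_lt_one_of_region (inv_mul_mem_region hg one_notMem_region)

theorem mem_crossing_symm (hA : A ∈ W.link x) (hB : B ∈ W.crossing x A) : A ∈ W.crossing x B :=
  ⟨hA, hB.2.1.symm, by rw [Set.inter_comm]; exact hB.2.2⟩

end Frames

/-! ### Counting letters at a vertex of minimal displacement. -/

section Stuck

variable {S : Type u} [Fintype S] {V : Type v} [MulAction (FreeGroup S) V]
  {W : WallSystem (FreeGroup S) V} {x : V} {κ : ℝ} {A B C d i : Set V}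

/-- Two halfspaces bound the same wall. -/
def SameWall (A B : Set V) : Prop := A = B ∨ A = Bᶜ

/-- A vertex of minimal displacement, if no automaton of growth `κ` is found. -/
structure Stuck (W : WallSystem (FreeGroup S) V) (x : V) (κ : ℝ) : Prop where
  pos : 0 < κ
  total : (letterCount (fun _ : S × Bool => True) : ℝ) = 12 * κ
  mem_base : x ∈ W.base
  not_avoiding : ¬ HasAvoidingAutomaton κ (trivialElements S V)
  edge : ∀ A ∈ W.link x,
    (letterCount (fun b : S × Bool => letter b • x ∈ A ∧ letter b • A ≠ Aᶜ) : ℝ) ≤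
      letterCount (fun b : S × Bool => letter b • x ∉ A ∧ letter b • A ≠ A)
  diag : ∀ A ∈ W.link x, ∀ B ∈ W.crossing x A,
    (letterCount (fun b : S × Bool => letter b • x ∈ A ∧ ¬ SameWall (letter b • A) A ∧
      ¬ SameWall (letter b • B) A) : ℝ) +
    letterCount (fun b : S × Bool => letter b • x ∈ B ∧ ¬ SameWall (letter b • B) B ∧
      ¬ SameWall (letter b • A) B) ≤
    letterCount (fun b : S × Bool => letter b • x ∉ A ∧ ¬ SameWall (letter b • A) A ∧
      ¬ SameWall (letter b • B) A) +
    letterCount (fun b : S × Bool => letter b • x ∉ B ∧ ¬ SameWall (letter b • B) B ∧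
      ¬ SameWall (letter b • A) B)
  fix_lt : (letterCount (fun b : S × Bool => ∀ A ∈ W.halfspaces, letter b • x ∈ A ↔ x ∈ A) : ℝ)
    < 2 * κ
  wall_lt : ∀ A ∈ W.link x,
    (letterCount (fun b : S × Bool => SameWall (letter b • A) A) : ℝ) < 2 * κ
  pair_lt : ∀ A ∈ W.link x, ∀ B ∈ W.crossing x A,
    (letterCount (fun b : S × Bool => SameWall (letter b • A) B ∧ SameWall (letter b • B) A) : ℝ)
    < 2 * κ

namespace Stuck

variable (hs : Stuck W x κ)
include hs

theorem false_of_leads {e : Set V → ℝ} (he : W.IsFrame x e) (F : Set (Set V))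
    (hF : F ⊆ W.halfspaces) (hne : F.Nonempty)
    (h3 : ∀ A₁ ∈ F, ∀ A₂ ∈ F, ∀ A₃ ∈ F, (A₁ ∩ A₂).Nonempty → (A₁ ∩ A₃).Nonempty →
      (A₂ ∩ A₃).Nonempty → A₁ = A₂ ∨ A₁ = A₃ ∨ A₂ = A₃)
    (hcount : ∀ C ∈ F, κ ≤ letterCount fun b => ∃ A' ∈ F, Leads W x e C b A') : False :=
  hs.not_avoiding (hasAvoidingAutomaton_of_leads hs.pos hs.mem_base he F hF hne h3 hcount)

/-- A covering family supplies the target of every step, so only the letters that move the displaced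
vertex away from `C` need to be counted. -/
theorem false_of_covers {e : Set V → ℝ} (he : W.IsFrame x e) (F : Set (Set V))
    (hF : F ⊆ W.halfspaces) (hne : F.Nonempty)
    (h3 : ∀ A₁ ∈ F, ∀ A₂ ∈ F, ∀ A₃ ∈ F, (A₁ ∩ A₂).Nonempty → (A₁ ∩ A₃).Nonempty →
      (A₂ ∩ A₃).Nonempty → A₁ = A₂ ∨ A₁ = A₃ ∨ A₂ = A₃)
    (hcov : W.Covers x e F)
    (hcount : ∀ C ∈ F, κ ≤ letterCount fun b : S × Bool =>
      ∃ A ∈ W.halfspaces, letter b ∈ region x e A ∧ Disjoint A C) : False := by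
  refine hs.false_of_leads he F hF hne h3 fun C hC =>
    (hcount C hC).trans (letterCount_mono fun b => ?_)
  rintro ⟨A, hA, hb, hAC⟩
  obtain ⟨A', hA', h1, hsub⟩ := hcov _ (W.compl_mem _ (W.smul_mem _ _ hA))
    (coord_compl_inv_smul_lt he hb)
  exact ⟨A', hA', A, hA, hb, hAC, h1, hsub⟩

/-- Fewer than `2κ` letters preserve or flip the wall of `A`. Of the more than `10κ` others, `edge`
shows that at least half keep `x` out of `A`. Adding the flips back, twice the number of letters
into `A` is at most `12κ` plus the number of flips. -/
theorem weights (hA : A ∈ W.link x) :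
    5 * κ < letterCount (fun b : S × Bool => letter b • x ∉ A ∧ letter b • A ≠ A) ∧
    (letterCount (fun b : S × Bool => letter b • x ∈ A) : ℝ) < 7 * κ := by
  have h0 : (letterCount (fun _ : S × Bool => True) : ℝ) ≤
      letterCount (fun b : S × Bool => letter b • x ∈ A) +
      letterCount (fun b : S × Bool => letter b • x ∉ A) :=
    letterCount_le_add fun b _ => em _
  have h0' : (letterCount (fun b : S × Bool => letter b • x ∈ A) : ℝ) +
      letterCount (fun b : S × Bool => letter b • x ∉ A) ≤
      letterCount (fun _ : S × Bool => True) :=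
    letterCount_add_le (fun _ _ => trivial) (fun _ _ => trivial) fun b h h' => h' h
  have h1 : (letterCount (fun b : S × Bool => letter b • x ∉ A) : ℝ) ≤
      letterCount (fun b : S × Bool => letter b • x ∉ A ∧ letter b • A ≠ A) +
      letterCount (fun b : S × Bool => letter b • A = A) :=
    letterCount_le_add fun b h => by
      by_cases h' : letter b • A = A
      · exact Or.inr h'
      · exact Or.inl ⟨h, h'⟩
  have h1' : (letterCount (fun b : S × Bool => letter b • x ∉ A ∧ letter b • A ≠ A) : ℝ) +
      letterCount (fun b : S × Bool => letter b • A = A) ≤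
      letterCount (fun b : S × Bool => letter b • x ∉ A) :=
    letterCount_add_le (fun b h => h.1) (fun b h h' => by
      rw [← h, Set.smul_mem_smul_set_iff] at h'
      exact notMem_of_mem_link hA h') fun b h h' => h.2 h'
  have h2 : (letterCount (fun b : S × Bool => letter b • x ∈ A) : ℝ) ≤
      letterCount (fun b : S × Bool => letter b • x ∈ A ∧ letter b • A ≠ Aᶜ) +
      letterCount (fun b : S × Bool => letter b • A = Aᶜ) :=
    letterCount_le_add fun b h => by
      by_cases h' : letter b • A = Aᶜ
      · exact Or.inr h'
      · exact Or.inl ⟨h, h'⟩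
  have h3 : (letterCount (fun b : S × Bool => letter b • A = A) : ℝ) +
      letterCount (fun b : S × Bool => letter b • A = Aᶜ) ≤
      letterCount (fun b : S × Bool => SameWall (letter b • A) A) :=
    letterCount_add_le (fun b h => Or.inl h) (fun b h => Or.inr h) fun b h h' =>
      ne_compl_self A x (h.symm.trans h')
  have h4 := hs.edge A hA
  have h5 := hs.wall_lt A hA
  have h6 := hs.total
  constructor <;> linarith

/-- Inversion matches the letters taking the wall of `A` to that of `B` with those taking `B` to
`A`. Two sets of equal size among `12κ` letters that share fewer than `2κ` have fewer than `7κ`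
elements each. -/
theorem sameWall_count_lt (hA : A ∈ W.link x) (hB : B ∈ W.crossing x A) :
    (letterCount (fun b : S × Bool => SameWall (letter b • A) B) : ℝ) < 7 * κ := by
  have h1 : letterCount (fun b : S × Bool => SameWall (letter b • B) A) =
      letterCount (fun b : S × Bool => SameWall (letter b • A) B) :=
    letterCount_congr_inv fun b => by
      simp only [SameWall, letter_invLetter, inv_smul_eq_iff]
      constructor
      · rintro (h | h)
        · exact Or.inl h.symm
        · right; rw [Set.smul_set_compl, h, compl_compl]
      · rintro (h | h)
        · exact Or.inl h.symm
        · right; rw [h, Set.smul_set_compl, compl_compl]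
  have h2 : (letterCount (fun b : S × Bool => SameWall (letter b • A) B) : ℝ) ≤
      letterCount (fun b : S × Bool => SameWall (letter b • A) B ∧ SameWall (letter b • B) A) +
      letterCount (fun b : S × Bool => ¬ SameWall (letter b • B) A) :=
    letterCount_le_add fun b h => by
      by_cases h' : SameWall (letter b • B) A
      · exact Or.inl ⟨h, h'⟩
      · exact Or.inr h'
  have h3 : (letterCount (fun b : S × Bool => SameWall (letter b • B) A) : ℝ) +
      letterCount (fun b : S × Bool => ¬ SameWall (letter b • B) A) ≤
      letterCount (fun _ : S × Bool => True) :=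
    letterCount_add_le (fun _ _ => trivial) (fun _ _ => trivial) fun b h h' => h' h
  have h4 := hs.pair_lt A hA B hB
  rw [h1, hs.total] at h3
  linarith

/-- No square at `x` has enough letters pointing in each of its four directions. -/
theorem false_of_square (hd : d ∈ W.link x) (hi : i ∈ W.crossing x d)
    (h1 : κ ≤ letterCount (fun b : S × Bool => letter b • x ∈ d))
    (h2 : κ ≤ letterCount (fun b : S × Bool => letter b • x ∈ i ∨ letter b • d = i))
    (h3 : κ ≤ letterCount (fun b : S × Bool => letter b • x ∉ i ∧ letter b • i ≠ i ∧
      letter b • d ≠ i)) : False := by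
  have he := isFrame_offset hd hi.1 (by rw [Set.inter_comm]; exact hi.2.2)
  have hd' := link_subset hd
  have hi' := link_subset hi.1
  have hxd := notMem_of_mem_link hd
  have hxi := notMem_of_mem_link hi.1
  refine hs.false_of_covers he {d, dᶜ, i, iᶜ} ?_ ⟨d, by simp⟩ ?_
    (covers_offset hs.mem_base hd hi) ?_
  · rintro A (rfl | rfl | rfl | rfl)
    exacts [hd', W.compl_mem _ hd', hi', W.compl_mem _ hi']
  · rintro A (rfl | rfl | rfl | rfl) B (rfl | rfl | rfl | rfl) C (rfl | rfl | rfl | rfl) <;> simp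
  · rintro C (rfl | rfl | rfl | rfl)
    · refine (by linarith [(hs.weights hd).1, hs.pos] : κ ≤ _).trans
        (letterCount_mono (P := fun b => letter b • x ∉ C ∧ letter b • C ≠ C) fun b h => ?_)
      refine ⟨Cᶜ, W.compl_mem _ hd', mem_region_compl hxd h.1 ?_, disjoint_compl_left⟩
      rw [offset_left]
      exact offset_lt_left fun h' => h.2 (inv_smul_eq_iff.1 h').symm
    · exact h1.trans (letterCount_mono fun b h =>
        ⟨d, hd', he.mem_region_of_mem hxd h, disjoint_compl_right⟩)
    · refine h3.trans (letterCount_mono fun b h => ?_)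
      refine ⟨Cᶜ, W.compl_mem _ hi', mem_region_compl hxi h.1 ?_, disjoint_compl_left⟩
      rw [offset_right hi.2.1, offset_of_ne]
      · norm_num
      · exact fun h' => h.2.2 (inv_smul_eq_iff.1 h').symm
      · exact fun h' => h.2.1 (inv_smul_eq_iff.1 h').symm
    · refine h2.trans (letterCount_mono fun b h => ⟨i, hi', ?_, disjoint_compl_right⟩)
      rcases h with h | h
      · exact he.mem_region_of_mem hxi h
      -- If `b • d = i`, the larger displacement into `d` becomes a displacement into `i`, which is
      -- an advance even when `b • x` stays outside `i`. For the same reason `h3` has to exclude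
      -- these letters.
      · refine he.mem_region_of_lt hxi ?_
        rw [inv_smul_eq_iff.2 h.symm, offset_left, offset_right hi.2.1]
        norm_num

/-- Two crossing halfspaces at `x` do not both have many letters. -/
theorem light_of_heavy (hA : A ∈ W.link x) (hB : B ∈ W.crossing x A)
    (h : κ ≤ letterCount (fun b : S × Bool => letter b • x ∈ A)) :
    (letterCount (fun b : S × Bool => letter b • x ∈ B) : ℝ) < κ := by
  by_contra! h'
  have hA' := mem_crossing_symm hA hB
  have key : ∀ A B : Set V, A ∈ W.link x → B ∈ W.crossing x A →
      κ ≤ letterCount (fun b : S × Bool => letter b • x ∈ A) →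
      κ ≤ letterCount (fun b : S × Bool => letter b • x ∈ B) →
      (letterCount (fun b : S × Bool => letter b • x ∉ B ∧ ¬ SameWall (letter b • B) B ∧
        ¬ SameWall (letter b • A) B) : ℝ) < κ := by
    intro A B hA hB h h'
    by_contra! h1
    exact hs.false_of_square hA hB h (h'.trans (letterCount_mono fun b => Or.inl))
      (h1.trans (letterCount_mono fun b hb =>
        ⟨hb.1, fun h => hb.2.1 (Or.inl h), fun h => hb.2.2 (Or.inl h)⟩))
  have k1 := key A B hA hB h h'
  have k2 := key B A hB.1 hA' h' h
  have k3 := hs.diag A hA B hB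
  have k4 := hs.sameWall_count_lt hA hB
  have k5 := hs.sameWall_count_lt hB.1 hA'
  have k6 := hs.wall_lt A hA
  have k7 := hs.wall_lt B hB.1
  have tot : ∀ A B : Set V, (letterCount (fun _ : S × Bool => True) : ℝ) ≤
      letterCount (fun b : S × Bool => letter b • x ∈ A ∧ ¬ SameWall (letter b • A) A ∧
        ¬ SameWall (letter b • B) A) +
      letterCount (fun b : S × Bool => letter b • x ∉ A ∧ ¬ SameWall (letter b • A) A ∧
        ¬ SameWall (letter b • B) A) +
      (letterCount (fun b : S × Bool => SameWall (letter b • A) A) +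
      letterCount (fun b : S × Bool => SameWall (letter b • B) A)) := by
    intro A B
    have l1 : (letterCount (fun _ : S × Bool => True) : ℝ) ≤
      letterCount (fun b : S × Bool => ¬ SameWall (letter b • A) A ∧
        ¬ SameWall (letter b • B) A) +
      letterCount (fun b : S × Bool => SameWall (letter b • A) A ∨ SameWall (letter b • B) A) :=
      letterCount_le_add fun b _ => by
        by_cases h₁ : SameWall (letter b • A) A <;> by_cases h₂ : SameWall (letter b • B) A <;>
          simp [h₁, h₂]
    have l2 : (letterCount (fun b : S × Bool => ¬ SameWall (letter b • A) A ∧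
        ¬ SameWall (letter b • B) A) : ℝ) ≤
      letterCount (fun b : S × Bool => letter b • x ∈ A ∧ ¬ SameWall (letter b • A) A ∧
        ¬ SameWall (letter b • B) A) +
      letterCount (fun b : S × Bool => letter b • x ∉ A ∧ ¬ SameWall (letter b • A) A ∧
        ¬ SameWall (letter b • B) A) := letterCount_le_add fun b hb => by tauto
    have l3 : (letterCount (fun b : S × Bool => SameWall (letter b • A) A ∨
        SameWall (letter b • B) A) : ℝ) ≤
      letterCount (fun b : S × Bool => SameWall (letter b • A) A) +
      letterCount (fun b : S × Bool => SameWall (letter b • B) A) :=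
      letterCount_le_add fun b hb => hb
    linarith
  -- By `k1`, `k2` and `k3` the four counts of letters away from both coincidences of walls sum to
  -- less than `4κ`. The rest is below `2 * 2κ + 2 * 7κ`, so `24κ` would be less than `22κ`.
  have t1 := tot A B
  have t2 := tot B A
  rw [hs.total] at t1 t2
  linarith

/-- Around a halfspace with many letters, some crossing halfspace has almost all of the letters
that point into crossing halfspaces. -/
theorem exists_concentrated (hd : d ∈ W.link x)
    (h : κ ≤ letterCount (fun b : S × Bool => letter b • x ∈ d)) :
    ∃ A ∈ W.crossing x d, (letterCount (fun b : S × Bool => ∃ A' ∈ W.crossing x d, A' ≠ A ∧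
      letter b ∈ region x (offset d d) A') : ℝ) < κ := by
  -- Otherwise ping-pong works on `d`, `dᶜ` and the halfspaces crossing `d`: a state `C` that
  -- crosses `d` is left through another crossing halfspace, which is disjoint from `C`.
  by_contra! hcon
  have hne := W.nonempty _ (link_subset hd)
  have he := isFrame_offset hd hd (by rwa [Set.inter_self])
  have hd' := link_subset hd
  have hxd := notMem_of_mem_link hd
  refine hs.false_of_covers he ({d, dᶜ} ∪ W.crossing x d) ?_ ⟨d, by simp⟩ ?_
    (covers_offset_self hd) ?_
  · rintro A ((rfl | rfl) | hA)
    exacts [hd', W.compl_mem _ hd', link_subset hA.1]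
  · have h2 : ∀ A ∈ W.crossing x d, ∀ B ∈ W.crossing x d, (A ∩ B).Nonempty → A = B := by
      intro A hA B hB hAB
      by_contra hne
      exact hAB.ne_empty (Set.disjoint_iff_inter_eq_empty.1
        (disjoint_of_mem_crossing hs.mem_base hd hA hB hne))
    rintro A ((rfl | rfl) | hA) B ((rfl | rfl) | hB) C ((rfl | rfl) | hC) <;>
      first
      | simp
      | (intro _ _ _; simp_all; done)
      | (intro h₁ h₂ h₃; exact Or.inl (h2 _ ‹_› _ ‹_› h₁))
      | (intro h₁ h₂ h₃; exact Or.inr (Or.inl (h2 _ ‹_› _ ‹_› h₂)))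
      | (intro h₁ h₂ h₃; exact Or.inr (Or.inr (h2 _ ‹_› _ ‹_› h₃)))
  · rintro C ((rfl | rfl) | hC)
    · refine (by linarith [(hs.weights hd).1, hs.pos] : κ ≤ _).trans
        (letterCount_mono (P := fun b => letter b • x ∉ C ∧ letter b • C ≠ C) fun b h => ?_)
      refine ⟨Cᶜ, W.compl_mem _ hd', mem_region_compl hxd h.1 ?_, disjoint_compl_left⟩
      rw [offset_left]
      exact offset_lt_left fun h' => h.2 (inv_smul_eq_iff.1 h').symm
    · exact h.trans (letterCount_mono fun b h =>
        ⟨d, hd', he.mem_region_of_mem hxd h, disjoint_compl_right⟩)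
    · refine (hcon C hC).trans (letterCount_mono fun b => ?_)
      rintro ⟨A', hA', hne, hb⟩
      exact ⟨A', link_subset hA'.1, hb, disjoint_of_mem_crossing hs.mem_base hd hA' hC hne⟩

end Stuck

end Stuck

/-! ### An axis through the minimal vertex, and the contradiction. -/

namespace Stuck

variable {S : Type u} {V : Type v} [MulAction (FreeGroup S) V]
  {W : WallSystem (FreeGroup S) V} {x : V} {A B C d i : Set V} {b : S × Bool}

/-- The letter `b` moves `x` into halfspaces that avoid `C`. -/
def Escapes (W : WallSystem (FreeGroup S) V) (x : V) (C : Set V) (b : S × Bool) : Prop :=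
  ∃ A ∈ W.link x, letter b • x ∈ A ∧ Disjoint A C

/-- The letter `b` moves `x` into a single adjacent halfspace `A`, and `A` crosses `C`. -/
def IsSingle (W : WallSystem (FreeGroup S) V) (x : V) (C : Set V) (b : S × Bool) (A : Set V) :
    Prop :=
  A ∈ W.crossing x C ∧ letter b • x ∈ A ∧ ∀ A' ∈ W.link x, letter b • x ∈ A' → A' = A

theorem exists_mem_link_of_moves
    (h : ¬ ∀ A ∈ W.halfspaces, letter b • x ∈ A ↔ x ∈ A) : ∃ A ∈ W.link x, letter b • x ∈ A := by
  push Not at h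
  obtain ⟨A, hA, ⟨h1, h2⟩ | ⟨h1, h2⟩⟩ := h
  · obtain ⟨B, hB, hAB⟩ := exists_mem_link hA h2
    exact ⟨B, hB, hAB h1⟩
  · obtain ⟨B, hB, hAB⟩ := exists_mem_link (W.compl_mem _ hA) (x := x) (by simpa)
    exact ⟨B, hB, hAB h1⟩

theorem fixes_invLetter (h : ∀ A ∈ W.halfspaces, letter (invLetter b) • x ∈ A ↔ x ∈ A) :
    ∀ A ∈ W.halfspaces, letter b • x ∈ A ↔ x ∈ A := by
  intro A hA
  have := h _ (W.smul_mem (letter b)⁻¹ A hA)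
  rw [letter_invLetter, Set.smul_mem_smul_set_iff, mem_inv_smul_iff] at this
  exact this.symm

variable [Fintype S] {κ : ℝ} (hs : Stuck W x κ)
include hs

/-- If the first three cases fail, `x` moves only into adjacent halfspaces that cross `C`. These are
pairwise disjoint, so just one of them contains `b • x`. -/
theorem isSingle_or (hC : C ∈ W.link x) (b : S × Bool) :
    (∀ A ∈ W.halfspaces, letter b • x ∈ A ↔ x ∈ A) ∨ Escapes W x C b ∨ letter b • x ∈ C ∨
      ∃ A, IsSingle W x C b A := by
  by_contra! h
  obtain ⟨h1, h2, h3, h4⟩ := h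
  obtain ⟨A, hA, hbA⟩ := exists_mem_link_of_moves (by push Not; exact h1)
  have key : ∀ A ∈ W.link x, letter b • x ∈ A → A ∈ W.crossing x C := by
    refine fun A hA hbA => ⟨hA, fun h => h3 (h ▸ hbA), ?_⟩
    by_contra h
    exact h2 ⟨A, hA, hbA, disjoint_of_not_inter h⟩
  refine h4 A ⟨key A hA hbA, hbA, fun A' hA' hbA' => ?_⟩
  by_contra hne
  exact Set.disjoint_left.1 (disjoint_of_mem_crossing hs.mem_base hC (key A' hA' hbA')
    (key A hA hbA) hne) hbA' hbA

/-- Otherwise ping-pong on all halfspaces adjacent to the undisplaced vertex `x` succeeds. -/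
theorem exists_few_escapes : ∃ C ∈ W.link x,
    (letterCount (fun b : S × Bool => Escapes W x C b) : ℝ) < κ := by
  by_contra! h
  have hne : (W.link x).Nonempty := by
    by_contra hne
    have := letterCount_mono (S := S) (P := fun _ => True)
      (Q := fun b => ∀ A ∈ W.halfspaces, letter b • x ∈ A ↔ x ∈ A) fun b _ => by
        by_contra hb
        obtain ⟨A, hA, -⟩ := exists_mem_link_of_moves hb
        exact hne ⟨A, hA⟩
    linarith [hs.total, hs.fix_lt, hs.pos]
  refine hs.false_of_covers isFrame_zero (W.link x) (fun A => link_subset) hne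
    (fun A hA B hB C hC => W.no_triangle x hs.mem_base A hA B hB C hC) covers_link
    fun C hC => (h C hC).trans (letterCount_mono fun b => ?_)
  rintro ⟨A, hA, hb, hAC⟩
  exact ⟨A, link_subset hA, isFrame_zero (W := W).mem_region_of_mem (notMem_of_mem_link hA) hb, hAC⟩

/-- If `κ` letters led into `C`, the cases of `isSingle_or` would number less than `2κ` (fixing),
`κ` (escaping), `7κ` (into `C`) and `2κ` (single). The last bound is `κ` away from the concentrated
halfspace `A₁` plus `κ` into `A₁`, which is light. The sum stays below `12κ`. -/
theorem few_of_few_escapes (hC : C ∈ W.link x)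
    (h : (letterCount (fun b : S × Bool => Escapes W x C b) : ℝ) < κ) :
    (letterCount (fun b : S × Bool => letter b • x ∈ C) : ℝ) < κ := by
  by_contra! hw
  obtain ⟨A₁, hA₁, hconc⟩ := hs.exists_concentrated hC hw
  have he := isFrame_offset hC hC (by rw [Set.inter_self]; exact W.nonempty _ (link_subset hC))
  have hl := hs.light_of_heavy hC hA₁ hw
  have h1 : (letterCount (fun _ : S × Bool => True) : ℝ) ≤
      letterCount (fun b : S × Bool => ∀ A ∈ W.halfspaces, letter b • x ∈ A ↔ x ∈ A) +
      letterCount (fun b => Escapes W x C b ∨ letter b • x ∈ C ∨ ∃ A, IsSingle W x C b A) :=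
    letterCount_le_add fun b _ => hs.isSingle_or hC b
  have h2 : (letterCount (fun b => Escapes W x C b ∨ letter b • x ∈ C ∨
      ∃ A, IsSingle W x C b A) : ℝ) ≤ letterCount (fun b => Escapes W x C b) +
      letterCount (fun b => letter b • x ∈ C ∨ ∃ A, IsSingle W x C b A) :=
    letterCount_le_add fun b h => h
  have h3 : (letterCount (fun b => letter b • x ∈ C ∨ ∃ A, IsSingle W x C b A) : ℝ) ≤
      letterCount (fun b => letter b • x ∈ C) + letterCount (fun b => ∃ A, IsSingle W x C b A) :=
    letterCount_le_add fun b h => h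
  have h4 : (letterCount (fun b => ∃ A, IsSingle W x C b A) : ℝ) ≤
      letterCount (fun b : S × Bool => ∃ A' ∈ W.crossing x C, A' ≠ A₁ ∧
        letter b ∈ region x (offset C C) A') +
      letterCount (fun b : S × Bool => letter b • x ∈ A₁) := by
    refine letterCount_le_add fun b => ?_
    rintro ⟨A, hA, hb, -⟩
    by_cases h : A = A₁
    · exact Or.inr (h ▸ hb)
    · exact Or.inl ⟨A, hA, h, he.mem_region_of_mem (notMem_of_mem_link hA.1) hb⟩
  linarith [hs.total, hs.fix_lt, (hs.weights hC).2]

/-- Many letters move `x` back and forth across a single halfspace `d`. -/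
theorem exists_axis : ∃ C, ∃ d ∈ W.link x, 4 * κ < letterCount (fun b : S × Bool =>
    IsSingle W x C b d ∧ IsSingle W x C (invLetter b) d) := by
  obtain ⟨C, hC, hesc⟩ := hs.exists_few_escapes
  have hfew := hs.few_of_few_escapes hC hesc
  set AA : S × Bool → Prop := fun b =>
    (∃ A, IsSingle W x C b A) ∧ ∃ A, IsSingle W x C (invLetter b) A with hAA
  have hAAinv : ∀ b, AA b → AA (invLetter b) := fun b h => ⟨h.2, by
    rw [invLetter_invLetter]; exact h.1⟩
  set Bad : S × Bool → Prop := fun b => Escapes W x C b ∨ letter b • x ∈ C with hBad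
  have hbad : (letterCount Bad : ℝ) < 2 * κ := by
    have : (letterCount Bad : ℝ) ≤ letterCount (fun b => Escapes W x C b) +
      letterCount (fun b => letter b • x ∈ C) := letterCount_le_add fun b h => h
    linarith
  -- From `12κ` letters remove fewer than `2κ` that fix `x`, and those for which `b` or `b⁻¹` is
  -- bad, fewer than `2κ` each.
  have hAAcount : 6 * κ < letterCount AA := by
    have h1 : (letterCount (fun _ : S × Bool => True) : ℝ) ≤ letterCount AA +
        letterCount (fun b => ¬ AA b) := letterCount_le_add fun b _ => em _
    have h2 : (letterCount (fun b => ¬ AA b) : ℝ) ≤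
        letterCount (fun b : S × Bool => ∀ A ∈ W.halfspaces, letter b • x ∈ A ↔ x ∈ A) +
        letterCount (fun b => Bad b ∨ Bad (invLetter b)) := by
      refine letterCount_le_add fun b h => ?_
      by_contra! hcon
      obtain ⟨c1, c2, c3⟩ := hcon
      have c1' : ¬ ∀ A ∈ W.halfspaces, letter b • x ∈ A ↔ x ∈ A := by push Not; exact c1
      refine h ⟨?_, ?_⟩
      · rcases hs.isSingle_or hC b with h | h | h | h
        exacts [absurd h c1', absurd (Or.inl h) c2, absurd (Or.inr h) c2, h]
      · rcases hs.isSingle_or hC (invLetter b) with h | h | h | h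
        exacts [absurd (fixes_invLetter h) c1', absurd (Or.inl h) c3, absurd (Or.inr h) c3, h]
    have h3 : (letterCount (fun b => Bad b ∨ Bad (invLetter b)) : ℝ) ≤
        letterCount Bad + letterCount (fun b => Bad (invLetter b)) :=
      letterCount_le_add fun b h => h
    rw [letterCount_invLetter] at h3
    linarith [hs.total, hs.fix_lt]
  -- Otherwise ping-pong works on the halfspaces crossing `C`. The target of a step contains `b⁻¹ •
  -- x`, so it is the one adjacent halfspace into which `b⁻¹` moves `x`, and that one crosses `C`.
  have hstate : ∃ d ∈ W.crossing x C,
      (letterCount (fun b => AA b ∧ letter b • x ∉ d) : ℝ) < κ := by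
    by_contra! hcon
    have hne : (W.crossing x C).Nonempty := by
      by_contra hne
      have : (letterCount AA : ℝ) ≤ letterCount (fun _ : S × Bool => False) :=
        letterCount_mono fun b h => hne (h.1.imp fun A hA => hA.1)
      have h0 : letterCount (fun _ : S × Bool => False) = 0 := by simp [letterCount]
      rw [h0, Nat.cast_zero] at this
      linarith [hs.pos]
    refine hs.false_of_leads isFrame_zero (W.crossing x C) (fun A hA => link_subset hA.1) hne
      (fun A hA B hB D hD => W.no_triangle x hs.mem_base A hA.1 B hB.1 D hD.1)
      fun A hA => (hcon A hA).trans (letterCount_mono fun b => ?_)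
    rintro ⟨⟨⟨A', hA', hbA', -⟩, ⟨A'', hA'', -, huniq⟩⟩, hbA⟩
    have hreg := isFrame_zero (W := W).mem_region_of_mem (notMem_of_mem_link hA'.1) hbA'
    obtain ⟨D, hD, hD1, hsub⟩ := covers_link _
      (W.compl_mem _ (W.smul_mem (letter b)⁻¹ _ (link_subset hA'.1)))
      (coord_compl_inv_smul_lt (isFrame_zero (W := W)) hreg)
    have hbD : letter (invLetter b) • x ∈ D := hsub (by
      rw [letter_invLetter, Set.mem_compl_iff, Set.smul_mem_smul_set_iff]
      exact notMem_of_mem_link hA'.1)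
    refine ⟨D, huniq D hD hbD ▸ hA'', A', link_subset hA'.1, hreg, ?_, hD1, hsub⟩
    exact disjoint_of_mem_crossing hs.mem_base hC hA' hA fun h => hbA (h ▸ hbA')
  obtain ⟨d, hd, hlt⟩ := hstate
  refine ⟨C, d, hd.1, ?_⟩
  have h1 : (letterCount AA : ℝ) ≤ letterCount (fun b : S × Bool =>
      IsSingle W x C b d ∧ IsSingle W x C (invLetter b) d) +
      letterCount (fun b => (AA b ∧ letter b • x ∉ d) ∨
        (AA (invLetter b) ∧ letter (invLetter b) • x ∉ d)) := by
    refine letterCount_le_add fun b h => ?_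
    by_cases h1 : letter b • x ∈ d
    · by_cases h2 : letter (invLetter b) • x ∈ d
      · obtain ⟨⟨A, hA⟩, ⟨B, hB⟩⟩ := h
        rw [← hA.2.2 d hd.1 h1] at hA
        rw [← hB.2.2 d hd.1 h2] at hB
        exact Or.inl ⟨hA, hB⟩
      · exact Or.inr (Or.inr ⟨hAAinv b h, h2⟩)
    · exact Or.inr (Or.inl ⟨h, h1⟩)
  have h2 : (letterCount (fun b => (AA b ∧ letter b • x ∉ d) ∨
        (AA (invLetter b) ∧ letter (invLetter b) • x ∉ d)) : ℝ) ≤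
      letterCount (fun b => AA b ∧ letter b • x ∉ d) +
      letterCount (fun b => AA (invLetter b) ∧ letter (invLetter b) • x ∉ d) :=
    letterCount_le_add fun b h => h
  rw [letterCount_invLetter fun b => AA b ∧ letter b • x ∉ d] at h2
  linarith

/-- Ping-pong on `d` and `dᶜ`, with `x` displaced into `d`. The difficulty is that targets must not
cross `d`. From `dᶜ` the axis letters are read, whose inverses move `x` into no adjacent halfspace
but `d`. From `d` more than `5κ` letters are available, and fewer than `3κ` of them have a target
crossing `d`. -/
theorem false : False := by
  obtain ⟨C, d, hd, hBB⟩ := hs.exists_axis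
  have hpos := hs.pos
  have hw : κ ≤ letterCount (fun b : S × Bool => letter b • x ∈ d) := by
    have : (letterCount (fun b : S × Bool =>
        IsSingle W x C b d ∧ IsSingle W x C (invLetter b) d) : ℝ) ≤
        letterCount (fun b : S × Bool => letter b • x ∈ d) := letterCount_mono fun b h => h.1.2.1
    linarith
  have hxd := notMem_of_mem_link hd
  have hd' := link_subset hd
  have he := isFrame_offset hd hd (by rw [Set.inter_self]; exact W.nonempty _ hd')
  obtain ⟨i, hi, hconc⟩ := hs.exists_concentrated hd hw
  have hxi := notMem_of_mem_link hi.1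
  have hlight := hs.light_of_heavy hd hi hw
  -- Otherwise `false_of_square` leaves fewer than `κ` letters for its last condition, and the `12κ`
  -- letters would number less than `κ + 2κ + 7κ + κ`.
  have hL : (letterCount (fun b : S × Bool => letter b • d = i) : ℝ) < κ := by
    by_contra! hL
    have hthird : (letterCount (fun b : S × Bool => letter b • x ∉ i ∧ letter b • i ≠ i ∧
        letter b • d ≠ i) : ℝ) < κ := by
      by_contra! h3
      exact hs.false_of_square hd hi hw (hL.trans (letterCount_mono fun b => Or.inr)) h3
    have h1 : (letterCount (fun _ : S × Bool => True) : ℝ) ≤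
        letterCount (fun b : S × Bool => letter b • x ∈ i) +
        letterCount (fun b : S × Bool => letter b • x ∉ i) := letterCount_le_add fun b _ => em _
    have h2 : (letterCount (fun b : S × Bool => letter b • x ∉ i) : ℝ) ≤
        letterCount (fun b : S × Bool => letter b • i = i) +
        letterCount (fun b : S × Bool => letter b • x ∉ i ∧ letter b • i ≠ i) :=
      letterCount_le_add fun b h => by
        by_cases h' : letter b • i = i
        exacts [Or.inl h', Or.inr ⟨h, h'⟩]
    have h3 : (letterCount (fun b : S × Bool => letter b • x ∉ i ∧ letter b • i ≠ i) : ℝ) ≤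
        letterCount (fun b : S × Bool => letter b • d = i) +
        letterCount (fun b : S × Bool => letter b • x ∉ i ∧ letter b • i ≠ i ∧
          letter b • d ≠ i) :=
      letterCount_le_add fun b h => by
        by_cases h' : letter b • d = i
        exacts [Or.inl h', Or.inr ⟨h.1, h.2, h'⟩]
    have h4 : (letterCount (fun b : S × Bool => letter b • i = i) : ℝ) ≤
        letterCount (fun b : S × Bool => SameWall (letter b • i) i) :=
      letterCount_mono fun b h => Or.inl h
    have h5 : (letterCount (fun b : S × Bool => letter b • d = i) : ℝ) ≤
        letterCount (fun b : S × Bool => SameWall (letter b • d) i) :=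
      letterCount_mono fun b h => Or.inl h
    linarith [hs.total, hs.wall_lt i hi.1, hs.sameWall_count_lt hd hi]
  set Cross : S × Bool → Prop := fun b => ∃ A ∈ W.crossing x d,
    letter b ∈ region x (offset d d) A with hCross
  -- Fewer than `κ` letters enter a crossing halfspace other than `i`, fewer than `κ` move `x` into
  -- `i`, and fewer than `κ` enter the region of `i` by `b • d = i`.
  have hcross : (letterCount Cross : ℝ) < 3 * κ := by
    have h1 : (letterCount Cross : ℝ) ≤ letterCount (fun b : S × Bool =>
        ∃ A' ∈ W.crossing x d, A' ≠ i ∧ letter b ∈ region x (offset d d) A') +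
        letterCount (fun b : S × Bool => letter b • x ∈ i ∨ letter b • d = i) := by
      refine letterCount_le_add fun b => ?_
      rintro ⟨A, hA, hb⟩
      by_cases h : A = i
      · subst h
        refine Or.inr ((mem_or_of_mem_region hxi hb).imp_right fun h => ?_)
        have h0 := he.nonneg A
        rcases eq_or_eq_of_offset_ne_zero (h0.trans_lt h).ne' with h | h <;>
          exact (inv_smul_eq_iff.1 h).symm
      · exact Or.inl ⟨A, hA, h, hb⟩
    have h2 : (letterCount (fun b : S × Bool => letter b • x ∈ i ∨ letter b • d = i) : ℝ) ≤
        letterCount (fun b : S × Bool => letter b • x ∈ i) +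
        letterCount (fun b : S × Bool => letter b • d = i) := letterCount_le_add fun b h => h
    linarith
  refine hs.false_of_leads he {d, dᶜ} ?_ ⟨d, by simp⟩ ?_ ?_
  · rintro A (rfl | rfl)
    exacts [hd', W.compl_mem _ hd']
  · rintro A (rfl | rfl) B (rfl | rfl) C (rfl | rfl) <;> simp
  rintro D (hD | hD) <;> subst D
  · have h1 : (letterCount (fun b : S × Bool => letter b • x ∉ d ∧ letter b • d ≠ d) : ℝ) ≤
        letterCount (fun b : S × Bool => (letter b • x ∉ d ∧ letter b • d ≠ d) ∧
          ¬ Cross (invLetter b)) + letterCount (fun b => Cross (invLetter b)) :=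
      letterCount_le_add fun b h => by
        by_cases h' : Cross (invLetter b)
        exacts [Or.inr h', Or.inl ⟨h, h'⟩]
    rw [letterCount_invLetter] at h1
    refine (by linarith [(hs.weights hd).1] : κ ≤ (letterCount (fun b : S × Bool =>
      (letter b • x ∉ d ∧ letter b • d ≠ d) ∧ ¬ Cross (invLetter b)) : ℝ)).trans
      (letterCount_mono fun b h => ?_)
    have hreg : letter b ∈ region x (offset d d) dᶜ := mem_region_compl hxd h.1.1 (by
      rw [offset_left]
      exact offset_lt_left fun h' => h.1.2 (inv_smul_eq_iff.1 h').symm)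
    have hB := W.compl_mem _ (W.smul_mem (letter b)⁻¹ _ (W.compl_mem _ hd'))
    obtain ⟨A', hA', h1, hsub⟩ := covers_offset_self hd _ hB (coord_compl_inv_smul_lt he hreg)
    -- `b⁻¹` lies in the region of the target, so a target crossing `d` would make `b⁻¹` one of the
    -- `Cross` letters.
    refine ⟨A', hA'.resolve_right fun hA' => h.2 ⟨A', hA', ?_⟩, dᶜ, W.compl_mem _ hd', hreg,
      disjoint_compl_left, h1, hsub⟩
    have := inv_mul_mem_region hreg one_notMem_region
    rw [mul_one] at this
    rw [letter_invLetter]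
    exact he.region_mono hs.mem_base hB (link_subset hA'.1) hsub h1 this
  · refine (by linarith : κ ≤ (letterCount (fun b : S × Bool =>
      IsSingle W x C b d ∧ IsSingle W x C (invLetter b) d) : ℝ)).trans
      (letterCount_mono fun b h => ?_)
    have hreg := he.mem_region_of_mem hxd h.1.2.1
    obtain ⟨A', hA', h1, hsub⟩ := covers_offset_self hd _
      (W.compl_mem _ (W.smul_mem (letter b)⁻¹ _ hd')) (coord_compl_inv_smul_lt he hreg)
    -- The target contains `b⁻¹ • x`. If it crossed `d` it would be adjacent to `x`, hence equal to
    -- `d`.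
    refine ⟨A', hA'.resolve_right fun hA' => hA'.2.1 (h.2.2.2 A' hA'.1 (hsub ?_)), d, hd', hreg,
      disjoint_compl_right, h1, hsub⟩
    rw [letter_invLetter, Set.mem_compl_iff, Set.smul_mem_smul_set_iff]
    exact hxd

end Stuck

/-! ### Minimal displacement along edges and diagonals. -/

section Minimum

variable {S : Type u} {V : Type v} [MulAction (FreeGroup S) V]
  {W : WallSystem (FreeGroup S) V} {x y : V} {A B : Set V} {g : FreeGroup S}

theorem exists_across (hx : x ∈ W.base) (hA : A ∈ W.link x) : ∃ y ∈ W.base, W.Across A x y := by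
  obtain ⟨y, hy, hyA, h⟩ := W.exists_adj x hx A hA
  exact ⟨y, hy, link_subset hA, notMem_of_mem_link hA, hyA, h⟩

theorem ne_compl_of_inter (h : (B ∩ A).Nonempty) : B ≠ Aᶜ := by
  rintro rfl
  simp at h

/-- Provides the second edge of a diagonal. Only the wall of `A` separates `x` from `y`, so a larger
halfspace avoiding `y` but not `x` would be `Aᶜ`, which cannot contain `B` because `B` meets `A`. -/
theorem Across.mem_link (h : W.Across A x y) (hB : B ∈ W.crossing x A) : B ∈ W.link y := by
  have hB' := link_subset hB.1
  refine ⟨hB', fun hy => notMem_of_mem_link hB.1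
    ((h.iff B hB' hB.2.1 (ne_compl_of_inter hB.2.2)).2 hy), fun D hD hyD hBD => ?_⟩
  refine eq_of_mem_link hB.1 hD (fun hxD => hyD ((h.iff D hD ?_ ?_).1 hxD)) hBD
  · rintro rfl
    exact hyD h.mem_right
  · rintro rfl
    obtain ⟨z, hz⟩ := hB.2.2
    exact hBD hz.1 hz.2

variable (W x) in
/-- The elements that move `x` across no wall. -/
def fixator : Subgroup (FreeGroup S) where
  carrier := {g | ∀ A ∈ W.halfspaces, g • x ∈ A ↔ x ∈ A}
  one_mem' A _ := by rw [one_smul]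
  mul_mem' {g h} hg hh A hA := by
    rw [mul_smul, ← mem_inv_smul_iff, hh _ (W.smul_mem _ _ hA), mem_inv_smul_iff, hg A hA]
  inv_mem' {g} hg A hA := by
    rw [← mem_smul_iff, ← hg _ (W.smul_mem g A hA), Set.smul_mem_smul_set_iff]

theorem mem_stabilizer_pair (h : SameWall (g • A) A) :
    g ∈ MulAction.stabilizer (FreeGroup S) ({A, Aᶜ} : Set (Set V)) := by
  rw [MulAction.mem_stabilizer_iff, Set.smul_set_insert, Set.smul_set_singleton,
    Set.smul_set_compl]
  rcases h with h | h
  · rw [h]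
  · rw [h, compl_compl, Set.pair_comm]

theorem mem_stabilizer_pairs (h : SameWall (g • A) B) (h' : SameWall (g • B) A) :
    g ∈ MulAction.stabilizer (FreeGroup S) ({A, Aᶜ, B, Bᶜ} : Set (Set V)) := by
  rw [MulAction.mem_stabilizer_iff, Set.smul_set_insert, Set.smul_set_insert, Set.smul_set_insert,
    Set.smul_set_singleton, Set.smul_set_compl, Set.smul_set_compl]
  rcases h with h | h <;> rcases h' with h' | h' <;>
    · rw [h, h']
      ext C
      simp only [Set.mem_insert_iff, Set.mem_singleton_iff, compl_compl]
      tauto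

theorem subset_stabilizer (F : Set (Set V)) :
    trivialElements S V ⊆ MulAction.stabilizer (FreeGroup S) F := by
  intro g hg
  refine MulAction.mem_stabilizer_iff.2 (Set.ext fun A => ?_)
  rw [Set.mem_smul_set]
  constructor
  · rintro ⟨B, hB, rfl⟩
    rwa [smul_set_eq_of_trivial hg]
  · exact fun hA => ⟨A, hA, smul_set_eq_of_trivial hg A⟩

variable [Fintype S] {κ : ℝ}

/-- The sum of the displacement identities for the two edges of a path to the opposite corner.
Letters matching the wall of `A` with that of `B` cancel, since inversion exchanges `b • A = B` with
`b • B = A`, and `b • A = Bᶜ` with `b • B = Aᶜ`. -/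
theorem diag_le (hx : x ∈ W.base) (hmin : ∀ y ∈ W.base, W.displacement x ≤ W.displacement y)
    (hA : A ∈ W.link x) (hB : B ∈ W.crossing x A) :
    (letterCount (fun b : S × Bool => letter b • x ∈ A ∧ ¬ SameWall (letter b • A) A ∧
      ¬ SameWall (letter b • B) A) : ℝ) +
    letterCount (fun b : S × Bool => letter b • x ∈ B ∧ ¬ SameWall (letter b • B) B ∧
      ¬ SameWall (letter b • A) B) ≤
    letterCount (fun b : S × Bool => letter b • x ∉ A ∧ ¬ SameWall (letter b • A) A ∧
      ¬ SameWall (letter b • B) A) +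
    letterCount (fun b : S × Bool => letter b • x ∉ B ∧ ¬ SameWall (letter b • B) B ∧
      ¬ SameWall (letter b • A) B) := by
  obtain ⟨y, hy, hAy⟩ := exists_across hx hA
  obtain ⟨z, hz, hBz⟩ := exists_across hy (hAy.mem_link hB)
  have f1 := hAy.displacement_add
  have f2 := hBz.displacement_add
  have f3 := hmin z hz
  have hBH := link_subset hB.1
  have hxA := notMem_of_mem_link hA
  have hxB := notMem_of_mem_link hB.1
  have hBA := hB.2.1
  have hBA' := ne_compl_of_inter hB.2.2
  have smul_ne : ∀ b : S × Bool, letter b • x ∉ letter b • A ∧ letter b • x ∉ letter b • B :=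
    fun b => by simp only [Set.smul_mem_smul_set_iff]; exact ⟨hxA, hxB⟩
  have hp : letterCount (fun b : S × Bool => letter b • B = Aᶜ) =
      letterCount (fun b : S × Bool => letter b • A = Bᶜ) :=
    letterCount_congr_inv fun b => by
      rw [letter_invLetter, inv_smul_eq_iff, Set.smul_set_compl]
      constructor
      · intro h; rw [h, compl_compl]
      · intro h; rw [h, compl_compl]
  have hq : letterCount (fun b : S × Bool => letter b • B = A) =
      letterCount (fun b : S × Bool => letter b • A = B) :=
    letterCount_congr_inv fun b => by
      rw [letter_invLetter, inv_smul_eq_iff, eq_comm]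
  have e1 := letterCount_add_le (S := S)
    (P := fun b => letter b • x ∈ A ∧ ¬ SameWall (letter b • A) A ∧ ¬ SameWall (letter b • B) A)
    (Q := fun b => letter b • B = Aᶜ) (R := fun b => letter b • x ∈ A ∧ letter b • A ≠ Aᶜ)
    (fun b h => ⟨h.1, fun h' => h.2.1 (Or.inr h')⟩)
    (fun b h => ⟨by
      by_contra h'
      exact (smul_ne b).2 (h ▸ h'), fun h' => hBA (smul_left_cancel _ (h.trans h'.symm))⟩)
    (fun b h h' => h.2.2 (Or.inr h'))
  have e2 := letterCount_le_add (S := S)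
    (P := fun b => letter b • x ∉ A ∧ letter b • A ≠ A)
    (Q := fun b => letter b • x ∉ A ∧ ¬ SameWall (letter b • A) A ∧ ¬ SameWall (letter b • B) A)
    (R := fun b => letter b • B = A) (fun b h => by
      by_cases h' : letter b • B = A
      · exact Or.inr h'
      · refine Or.inl ⟨h.1, ?_, ?_⟩
        · rintro (h'' | h'')
          exacts [h.2 h'', (smul_ne b).1 (h'' ▸ h.1)]
        · rintro (h'' | h'')
          exacts [h' h'', (smul_ne b).2 (h'' ▸ h.1)])
  have hsm : ∀ b : S × Bool, ¬ SameWall (letter b • A) B →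
      (letter b • x ∈ B ↔ letter b • y ∈ B) := fun b h =>
    hAy.smul_iff hBH (fun h' => h (Or.inl h'.symm)) (fun h' => h (Or.inr (by rw [h', compl_compl])))
  have hyb : ∀ b : S × Bool, letter b • y ∈ letter b • A := fun b => by
    rw [Set.smul_mem_smul_set_iff]; exact hAy.mem_right
  have e3 := letterCount_add_le (S := S)
    (P := fun b => letter b • x ∈ B ∧ ¬ SameWall (letter b • B) B ∧ ¬ SameWall (letter b • A) B)
    (Q := fun b => letter b • A = B) (R := fun b => letter b • y ∈ B ∧ letter b • B ≠ Bᶜ)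
    (fun b h => ⟨(hsm b h.2.2).1 h.1, fun h' => h.2.1 (Or.inr h')⟩)
    (fun b h => ⟨h ▸ hyb b, fun h' => hBA' (smul_left_cancel (letter b) (by
      rw [h', Set.smul_set_compl, h]))⟩)
    (fun b h h' => h.2.2 (Or.inl h'))
  have e4 := letterCount_le_add (S := S)
    (P := fun b => letter b • y ∉ B ∧ letter b • B ≠ B)
    (Q := fun b => letter b • x ∉ B ∧ ¬ SameWall (letter b • B) B ∧ ¬ SameWall (letter b • A) B)
    (R := fun b => letter b • A = Bᶜ) (fun b h => by
      by_cases h' : letter b • A = Bᶜ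
      · exact Or.inr h'
      · have hA' : ¬ SameWall (letter b • A) B := by
          rintro (h'' | h'')
          exacts [h.1 (h'' ▸ hyb b), h' h'']
        have hxB' : letter b • x ∉ B := fun h'' => h.1 ((hsm b hA').1 h'')
        refine Or.inl ⟨hxB', ?_, hA'⟩
        rintro (h'' | h'')
        exacts [h.2 h'', (smul_ne b).2 (h'' ▸ hxB')])
  rw [hp] at e1
  rw [hq] at e2
  have f1' := congrArg (Nat.cast (R := ℝ)) f1
  have f2' := congrArg (Nat.cast (R := ℝ)) f2
  have f3' := Nat.cast_le (α := ℝ).2 f3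
  push_cast at f1' f2'
  linarith

/-- A free group acting on a wall system without invariant vertices, walls and crossing pairs of
walls has an automaton of large growth that avoids the elements acting trivially. -/
theorem hasAvoidingAutomaton (W : WallSystem (FreeGroup S) V) (hS : 0 < Fintype.card S)
    (h1 : ∀ x ∈ W.base, ∃ g : FreeGroup S, ∃ A ∈ W.halfspaces, ¬ (g • x ∈ A ↔ x ∈ A))
    (h2 : ∀ x ∈ W.base, ∀ A ∈ W.link x,
      ∃ g, g ∉ MulAction.stabilizer (FreeGroup S) ({A, Aᶜ} : Set (Set V)))
    (h3 : ∀ x ∈ W.base, ∀ A ∈ W.link x, ∀ B ∈ W.crossing x A,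
      ∃ g, g ∉ MulAction.stabilizer (FreeGroup S) ({A, Aᶜ, B, Bᶜ} : Set (Set V))) :
    HasAvoidingAutomaton ((Fintype.card S : ℝ) / 6) (trivialElements S V) := by
  by_contra hnot
  obtain ⟨x, hx, hmin⟩ : ∃ x ∈ W.base, ∀ y ∈ W.base, W.displacement x ≤ W.displacement y :=
    ⟨Function.argminOn W.displacement W.base W.base_nonempty,
      Function.argminOn_mem _ _ W.base_nonempty, fun y hy => Function.argminOn_le _ _ hy⟩
  refine Stuck.false (W := W) (x := x) (κ := (Fintype.card S : ℝ) / 6) ⟨by positivity, ?_, hx,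
    hnot, fun A hA => ?_, fun A hA B hB => diag_le hx hmin hA hB, ?_, fun A hA => ?_,
    fun A hA B hB => ?_⟩
  · rw [letterCount_true]
    push_cast
    ring
  · obtain ⟨y, hy, hAy⟩ := exists_across hx hA
    have f1 := hAy.displacement_add
    have f3 := hmin y hy
    rw [Nat.cast_le]
    omega
  · refine letterCount_mem_lt hnot (W.fixator x) (fun g hg A _ => by rw [hg x]) ?_
    obtain ⟨g, A, hA, hg⟩ := h1 x hx
    exact ⟨g, fun h => hg (h A hA)⟩
  · exact (letterCount_mono fun b h => mem_stabilizer_pair h).trans_lt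
      (letterCount_mem_lt hnot _ (subset_stabilizer _) (h2 x hx A hA))
  · exact (letterCount_mono fun b h => mem_stabilizer_pairs h.1 h.2).trans_lt
      (letterCount_mem_lt hnot _ (subset_stabilizer _) (h3 x hx A hA B hB))

end Minimum

end WallSystem

namespace SquareComplex

/-! ### Normal forms of edge paths -/

section NormalForm

variable {V : Type v} (X : SquareComplex V)

/-- Pushing a path, given as the list of its vertices, across one square. -/
inductive Push : List V → List V → Prop
  | square {a b c d : V} (h : X.IsSquare a b c d) (p : List V) :
      Push (a :: b :: c :: p) (a :: d :: c :: p)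
  | cons (x : V) {p q : List V} : Push p q → Push (x :: p) (x :: q)

/-- Equivalence of vertex lists under pushing across squares. -/
def PushEq : List V → List V → Prop := Relation.ReflTransGen X.Push

/-- A list that goes back along the edge it came from. -/
inductive Backtracks : List V → Prop
  | here (a b : V) (p : List V) : Backtracks (a :: b :: a :: p)
  | cons (x : V) {p : List V} : Backtracks p → Backtracks (x :: p)

/-- No equivalent list backtracks. -/
def IsTaut (l : List V) : Prop := ∀ l', X.PushEq l l' → ¬ Backtracks l'

variable {X} {a b c d x y z w : V} {l m p q r t : List V}

theorem IsSquare.swap (h : X.IsSquare a b c d) : X.IsSquare a d c b :=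
  X.rotate (X.rotate (X.rotate (X.reflect h)))

theorem IsSquare.ne_right (h : X.IsSquare a b c d) : b ≠ d := X.ne_of_isSquare (X.rotate h)

theorem Push.symm (h : X.Push l m) : X.Push m l := by
  induction h with
  | square h p => exact .square h.swap p
  | cons x _ ih => exact .cons x ih

theorem Push.length_eq (h : X.Push l m) : l.length = m.length := by
  induction h with
  | square h p => rfl
  | cons x _ ih => simp [ih]

namespace PushEq

theorem refl (l : List V) : X.PushEq l l := Relation.ReflTransGen.refl

theorem trans (h : X.PushEq l m) (h' : X.PushEq m p) : X.PushEq l p :=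
  Relation.ReflTransGen.trans h h'

theorem symm (h : X.PushEq l m) : X.PushEq m l := by
  induction h with
  | refl => exact .refl _
  | tail _ h ih => exact .head h.symm ih

theorem cons (x : V) (h : X.PushEq p q) : X.PushEq (x :: p) (x :: q) :=
  Relation.ReflTransGen.lift (p := X.Push) (x :: ·) (fun _ _ => Push.cons x) _ _ h

theorem square (h : X.IsSquare a b c d) (p : List V) :
    X.PushEq (a :: b :: c :: p) (a :: d :: c :: p) := Relation.ReflTransGen.single (.square h p)

theorem length_eq (h : X.PushEq l m) : l.length = m.length := by
  induction h with
  | refl => rfl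
  | tail _ h ih =>
    rw [ih]
    exact h.length_eq

theorem head_eq (h : X.PushEq l m) : l.head? = m.head? := by
  induction h with
  | refl => rfl
  | tail _ h ih =>
    rw [ih]
    cases h <;> rfl

theorem head_eq' (h : X.PushEq (x :: p) (y :: q)) : x = y := by simpa using h.head_eq

theorem exists_cons (h : X.PushEq (x :: p) m) : ∃ q, m = x :: q := by
  have := h.head_eq
  cases m with
  | nil => simp at this
  | cons y q => exact ⟨q, by simp at this; rw [this]⟩

end PushEq

/-- The opposite corner of a square is determined by a corner and its neighbours. -/
theorem IsCAT0.corner_unique (hX : X.IsCAT0) (h : X.IsSquare x a y b) (h' : X.IsSquare x a z b) :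
    y = z := hX.2.1 _ _ _ _ _ h h'

/-- Equivalent lists differ in their first step by a square. -/
theorem IsCAT0.pushEq_cons (hX : X.IsCAT0) : ∀ (n : ℕ) {x : V} {p q : List V}, p.length = n →
    X.PushEq (x :: p) (x :: q) → X.PushEq p q ∨ ∃ y z w t, X.PushEq p (y :: w :: t) ∧
      X.PushEq q (z :: w :: t) ∧ X.IsSquare x y w z := by
  intro n
  induction n using Nat.strong_induction_on with
  | _ n ih =>
  intro x p q hp h
  generalize hm : x :: q = m at h
  induction h generalizing q with
  | refl =>
    obtain rfl : q = p := by simpa using hm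
    exact Or.inl (.refl _)
  | tail h1 h2 ih' =>
    subst hm
    cases h2 with
    | cons _ h2 =>
      rcases ih' rfl with h | ⟨y, z, w, t, h3, h4, h5⟩
      · exact Or.inl (h.trans (.single h2))
      · exact Or.inr ⟨y, z, w, t, h3, (PushEq.symm (.single h2)).trans h4, h5⟩
    | @square _ b c d h2 s =>
      rcases ih' rfl with h | ⟨y, z, w, t, h3, h4, h5⟩
      · exact Or.inr ⟨b, d, c, s, h, .refl _, h2⟩
      -- Two successive exchanges of the first edge, in squares that share an edge at `x`. If they
      -- continue alike beyond that edge, uniqueness of corners makes the squares coincide and the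
      -- exchanges cancel. Otherwise a third square closes a triangle in the link of the other end
      -- of that edge.
      · obtain rfl := h4.head_eq'
        have hlen : (c :: s).length < n := by
          have := h3.length_eq
          have := h4.length_eq
          simp at *
          omega
        rcases ih _ hlen rfl h4 with h | ⟨c', w', u, r, h6, h7, h8⟩
        · obtain rfl := h.head_eq'
          have hyd := hX.corner_unique (X.rotate (X.rotate (X.rotate h5)))
            (X.rotate (X.rotate (X.rotate h2.swap)))
          subst hyd
          exact Or.inl (h3.trans (h.symm.cons _))
        · obtain rfl := h6.head_eq'
          obtain rfl := h7.head_eq'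
          exact absurd ⟨⟨_, X.rotate h2⟩, ⟨_, X.rotate (X.rotate (X.rotate h5))⟩, ⟨_, h8.swap⟩⟩
            (hX.2.2 _ _ _ _)

theorem IsCAT0.pushEq_cases (hX : X.IsCAT0) (h : X.PushEq (x :: p) (x :: q)) :
    X.PushEq p q ∨ ∃ y z w t, X.PushEq p (y :: w :: t) ∧ X.PushEq q (z :: w :: t) ∧
      X.IsSquare x y w z := hX.pushEq_cons _ rfl h

theorem IsTaut.of_pushEq (h : X.IsTaut l) (hlm : X.PushEq l m) : X.IsTaut m :=
  fun _ h' => h _ (hlm.trans h')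

theorem IsTaut.of_cons (h : X.IsTaut (x :: p)) : X.IsTaut p :=
  fun _ hq hb => h _ (hq.cons x) (.cons x hb)

theorem isTaut_singleton (x : V) : X.IsTaut [x] := by
  intro m hm hb
  have := hm.length_eq
  cases hb with
  | here => simp at this
  | cons y hb =>
    cases hb <;> simp at this

/-- Some equivalent path begins with the edge from its first vertex to `y`. -/
def Toward (X : SquareComplex V) (l : List V) (y : V) : Prop := ∃ x q, X.PushEq l (x :: y :: q)

/-- A taut path remains taut when it is prolonged by an edge that it does not begin with. -/
theorem IsCAT0.isTaut_cons (hX : X.IsCAT0) : ∀ (n : ℕ) {x y : V} {p : List V}, p.length = n →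
    X.IsTaut (x :: p) → ¬ X.Toward (x :: p) y → X.IsTaut (y :: x :: p) := by
  intro n
  induction n using Nat.strong_induction_on with
  | _ n ih =>
  intro x y p hp ht hy l hl hb
  obtain ⟨m, rfl⟩ := hl.exists_cons
  rcases hX.pushEq_cases hl with h | ⟨x', z, w, t, h1, h2, h3⟩
  · cases hb with
    | here _ b s =>
      obtain rfl := h.head_eq'
      exact hy ⟨_, _, h⟩
    | cons _ hb => exact ht _ h hb
  · obtain ⟨-, rfl⟩ : _ ∧ x = x' := ⟨trivial, h1.head_eq'⟩
    cases hb with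
    | here _ b s =>
      obtain rfl := h2.head_eq'
      rcases hX.pushEq_cases h2 with h | ⟨y', w', u, r, h4, h5, h6⟩
      · exact X.ne_of_isSquare h3 h.head_eq'
      · obtain rfl := h4.head_eq'
        obtain rfl := h5.head_eq'
        obtain rfl := hX.corner_unique (X.rotate (X.rotate (X.rotate h3))) h6
        exact ht _ (h1.trans (h5.cons _)) (.here _ _ _)
    | cons _ hb =>
      have ht' : X.IsTaut (w :: t) := (ht.of_pushEq h1).of_cons
      have hlen : t.length < n := by
        have := h1.length_eq
        simp at this
        omega
      -- The backtrack lies in `z :: w :: t`, which is taut by induction unless `w :: t` can begin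
      -- with the edge to `z`. In that case the square would let `x :: p` begin with the edge to
      -- `y`.
      by_cases hz : X.Toward (w :: t) z
      · obtain ⟨w', q, hq⟩ := hz
        obtain rfl := hq.head_eq'
        exact hy ⟨_, _, h1.trans ((hq.cons _).trans (.square (X.rotate h3) q))⟩
      · exact ih _ hlen rfl ht' hz _ h2.symm hb

/-- The continuation of a path after an edge that some equivalent path begins with is unique. -/
theorem IsCAT0.pushEq_tail (hX : X.IsCAT0) (h : X.PushEq (x :: y :: p) (x :: y :: q)) :
    X.PushEq (y :: p) (y :: q) := by
  rcases hX.pushEq_cases h with h | ⟨y', z, w, t, h1, h2, h3⟩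
  · exact h
  · obtain rfl := h1.head_eq'
    obtain rfl := h2.head_eq'
    exact absurd rfl h3.ne_right

variable (X) in
open Classical in
/-- Prolong a taut path by an edge to `y`, or shorten it if it begins with this edge. -/
noncomputable def step (y : V) (l : List V) : List V :=
  if h : ∃ q x, X.PushEq l (x :: y :: q) then y :: h.choose else y :: l

theorem step_of_not_toward (h : ¬ X.Toward l y) : X.step y l = y :: l :=
  dif_neg fun ⟨q, x, hq⟩ => h ⟨x, q, hq⟩

theorem exists_step_eq_cons (y : V) (l : List V) : ∃ q, X.step y l = y :: q := by
  unfold step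
  split_ifs with h
  exacts [⟨_, rfl⟩, ⟨_, rfl⟩]

namespace IsCAT0

variable (hX : X.IsCAT0)
include hX

theorem step_of_toward (h : X.PushEq l (x :: y :: q)) : X.PushEq (X.step y l) (y :: q) := by
  have h' : ∃ q x, X.PushEq l (x :: y :: q) := ⟨q, x, h⟩
  unfold step
  rw [dif_pos h']
  obtain ⟨x', hx'⟩ := h'.choose_spec
  have := hx'.symm.trans h
  obtain rfl := this.head_eq'
  exact hX.pushEq_tail this

theorem step_congr (h : X.PushEq l m) (y : V) : X.PushEq (X.step y l) (X.step y m) := by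
  by_cases hl : X.Toward l y
  · obtain ⟨x, q, hq⟩ := hl
    exact (hX.step_of_toward hq).trans (hX.step_of_toward (h.symm.trans hq)).symm
  · have hm : ¬ X.Toward m y := fun ⟨x, q, hq⟩ => hl ⟨x, q, h.trans hq⟩
    rw [step_of_not_toward hl, step_of_not_toward hm]
    exact h.cons y

theorem isTaut_step (h : X.IsTaut (x :: p)) : X.IsTaut (X.step y (x :: p)) := by
  by_cases hl : X.Toward (x :: p) y
  · obtain ⟨x', q, hq⟩ := hl
    exact (h.of_pushEq hq).of_cons.of_pushEq (hX.step_of_toward hq).symm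
  · rw [step_of_not_toward hl]
    exact hX.isTaut_cons _ rfl h hl

/-- If the first step shortens the path, tautness prevents the second from shortening it again. If
the first lengthens it, the second undoes this. -/
theorem step_step (h : X.IsTaut (x :: p)) :
    X.PushEq (X.step x (X.step y (x :: p))) (x :: p) := by
  by_cases hl : X.Toward (x :: p) y
  · obtain ⟨x', q, hq⟩ := hl
    obtain rfl := hq.head_eq'
    refine (hX.step_congr (hX.step_of_toward hq) x).trans ?_
    rw [step_of_not_toward]
    · exact hq.symm
    · rintro ⟨y', r, hr⟩
      obtain rfl := hr.head_eq'
      exact h _ (hq.trans (hr.cons x)) (.here _ _ _)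
  · rw [step_of_not_toward hl]
    exact hX.step_of_toward (.refl _)

/-- If the path can begin towards `b`, one way round shortens and then lengthens it, the other
lengthens it, pushes across the square and shortens. Otherwise both ways lengthen twice, and the
results differ by the square. -/
theorem step_square_of_not_toward (hsq : X.IsSquare a b c d)
    (hd : ¬ X.Toward (c :: p) d) :
    X.PushEq (X.step a (X.step b (c :: p))) (X.step a (X.step d (c :: p))) := by
  have not_toward : ∀ {b d}, X.IsSquare a b c d → ¬ X.Toward (c :: p) d →
      ¬ X.Toward (b :: c :: p) a := by
    rintro b d hsq hd ⟨b', q, hq⟩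
    obtain rfl := hq.head_eq'
    rcases hX.pushEq_cases hq with h | ⟨c', a', u, r, h1, h2, h3⟩
    · exact X.ne_of_isSquare hsq h.head_eq'.symm
    · obtain rfl := h1.head_eq'
      obtain rfl := h2.head_eq'
      obtain rfl := hX.corner_unique (X.rotate hsq) h3
      exact hd ⟨_, _, h1⟩
  rw [step_of_not_toward hd]
  by_cases hb : X.Toward (c :: p) b
  · obtain ⟨c', q, hq⟩ := hb
    obtain rfl := hq.head_eq'
    refine (hX.step_congr (hX.step_of_toward hq) a).trans ?_
    refine PushEq.trans ?_ (hX.step_of_toward (x := d) (q := b :: q)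
      ((hq.cons d).trans (.square (X.reflect hsq) q))).symm
    rw [step_of_not_toward]
    · exact .refl _
    · rintro ⟨b', r, hr⟩
      obtain rfl := hr.head_eq'
      exact hd ⟨_, _, hq.trans ((hr.cons c).trans (.square (X.rotate (X.reflect hsq)) r))⟩
  · rw [step_of_not_toward hb, step_of_not_toward (not_toward hsq hd),
      step_of_not_toward (not_toward hsq.swap hb)]
    exact .square hsq p

/-- In the remaining case the path can begin towards both `b` and `d`. By uniqueness of corners it
then passes through `a`, and both ways round shorten it twice. -/
theorem step_square (hsq : X.IsSquare a b c d) :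
    X.PushEq (X.step a (X.step b (c :: p))) (X.step a (X.step d (c :: p))) := by
  by_cases hd : X.Toward (c :: p) d
  · by_cases hb : X.Toward (c :: p) b
    · obtain ⟨c', q, hq⟩ := hb
      obtain rfl := hq.head_eq'
      obtain ⟨c', r, hr⟩ := hd
      obtain rfl := hr.head_eq'
      refine (hX.step_congr (hX.step_of_toward hq) a).trans
        (PushEq.trans ?_ (hX.step_congr (hX.step_of_toward hr) a).symm)
      rcases hX.pushEq_cases (hq.symm.trans hr) with h | ⟨b', d', w, t, h1, h2, h3⟩
      · exact absurd h.head_eq' hsq.ne_right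
      · obtain rfl := h1.head_eq'
        obtain rfl := h2.head_eq'
        obtain rfl := hX.corner_unique (X.rotate (X.rotate hsq)).swap h3
        exact (hX.step_of_toward h1).trans (hX.step_of_toward h2).symm
    · exact (hX.step_square_of_not_toward hsq.swap hb).symm
  · exact hX.step_square_of_not_toward hsq hd

end IsCAT0

variable (X) in
/-- Prolong a taut path by the edges of a walk that ends at its first vertex. -/
noncomputable def act : ∀ {a b : V}, X.graph.Walk a b → List V → List V
  | _, _, .nil, l => l
  | a, _, .cons _ p, l => X.step a (act p l)

theorem act_append (p : X.graph.Walk a b) (q : X.graph.Walk b c) (l : List V) :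
    X.act (p.append q) l = X.act p (X.act q l) := by
  induction p with
  | nil => rfl
  | cons h p ih => simp only [SimpleGraph.Walk.cons_append, act, ih]

theorem exists_act_eq_cons (p : X.graph.Walk a b) (l : List V) :
    ∃ q, X.act p (b :: l) = a :: q := by
  cases p with
  | nil => exact ⟨l, rfl⟩
  | cons h p => exact exists_step_eq_cons _ _

namespace IsCAT0

variable (hX : X.IsCAT0)
include hX

theorem act_congr (p : X.graph.Walk a b) (h : X.PushEq l m) : X.PushEq (X.act p l) (X.act p m) := by
  induction p with
  | nil => exact h
  | cons _ p ih => exact hX.step_congr ih _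

theorem isTaut_act (p : X.graph.Walk a b) (h : X.IsTaut (b :: l)) :
    X.IsTaut (X.act p (b :: l)) := by
  induction p with
  | nil => exact h
  | cons _ p ih =>
    obtain ⟨q, hq⟩ := exists_act_eq_cons p l
    have := ih h
    simp only [act]
    rw [hq] at this ⊢
    exact hX.isTaut_step this

/-- Van der Waerden's trick: each elementary homotopy acts as the identity on classes of taut paths.
-/
theorem act_homotopic {p q : X.graph.Walk a b} (h : X.Homotopic p q) (hl : X.IsTaut (b :: l)) :
    X.PushEq (X.act p (b :: l)) (X.act q (b :: l)) := by
  induction h with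
  | refl p => exact .refl _
  | symm _ ih => exact (ih hl).symm
  | trans _ _ ih ih' => exact (ih hl).trans (ih' hl)
  | cons _ _ ih => exact hX.step_congr (ih hl) _
  | backtrack h p =>
    obtain ⟨q, hq⟩ := exists_act_eq_cons p l
    have := hX.isTaut_act p hl
    simp only [act]
    rw [hq] at this ⊢
    exact hX.step_step this
  | square hsq _ _ _ _ p =>
    obtain ⟨q, hq⟩ := exists_act_eq_cons p l
    simp only [act]
    rw [hq]
    exact hX.step_square hsq

theorem act_closed (p : X.graph.Walk a a) (hl : X.IsTaut (a :: l)) :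
    X.PushEq (X.act p (a :: l)) (a :: l) := hX.act_homotopic (hX.1.2 a p) hl

/-- Any two walks with the same endpoints have the same normal form. -/
theorem act_eq (p q : X.graph.Walk a b) :
    X.PushEq (X.act p [b]) (X.act q [b]) := by
  have h1 := hX.act_closed (q.reverse.append q) (isTaut_singleton b)
  obtain ⟨r, hr⟩ := exists_act_eq_cons q []
  have h2 := hX.isTaut_act q (isTaut_singleton b)
  rw [hr] at h2
  have h3 := hX.act_closed (p.append q.reverse) h2
  rw [act_append] at h1 h3
  rw [hr] at h1 ⊢
  exact (hX.act_congr p h1).symm.trans h3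

end IsCAT0

/-! ### Distances read off from normal forms. -/

variable (X) in
/-- The list consists of the vertices of a walk that ends at `o`. -/
inductive IsPathTo (o : V) : List V → Prop
  | nil : IsPathTo o [o]
  | cons {x y : V} {p : List V} : X.graph.Adj y x → IsPathTo o (x :: p) → IsPathTo o (y :: x :: p)

namespace IsPathTo

variable {o : V}

theorem exists_walk (h : X.IsPathTo o l) :
    ∀ x p, l = x :: p → ∃ w : X.graph.Walk x o, w.length = p.length := by
  induction h with
  | nil =>
    intro x p h
    obtain ⟨rfl, rfl⟩ : o = x ∧ [] = p := by simpa using h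
    exact ⟨.nil, rfl⟩
  | @cons x y p hyx _ ih =>
    intro x' p' h
    obtain ⟨rfl, rfl⟩ : y = x' ∧ x :: p = p' := by simpa using h
    obtain ⟨w, hw⟩ := ih x p rfl
    exact ⟨.cons hyx w, by simp [hw]⟩

theorem of_cons (h : X.IsPathTo o (y :: x :: p)) : X.graph.Adj y x ∧ X.IsPathTo o (x :: p) := by
  cases h with
  | cons h1 h2 => exact ⟨h1, h2⟩

theorem of_push (h : X.Push l m) (hl : X.IsPathTo o l) : X.IsPathTo o m := by
  induction h with
  | square h p =>
    exact .cons (X.adj_of_isSquare h.swap) (.cons (X.adj_of_isSquare (X.rotate h.swap))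
      hl.of_cons.2.of_cons.2)
  | cons x h ih =>
    have hhead := PushEq.head_eq (Relation.ReflTransGen.single h)
    cases hl with
    | nil => cases h
    | @cons y _ p hxy hp =>
      obtain ⟨q', rfl⟩ := PushEq.exists_cons (Relation.ReflTransGen.single h)
      exact .cons hxy (ih hp)

theorem of_pushEq (hl : X.IsPathTo o l) (h : X.PushEq l m) : X.IsPathTo o m := by
  induction h with
  | refl => exact hl
  | tail _ h ih => exact of_push h ih

end IsPathTo

namespace IsCAT0

variable (hX : X.IsCAT0) {o : V}
include hX

theorem isPathTo_step (hl : X.IsPathTo o (x :: p)) (hyx : X.graph.Adj y x) :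
    X.IsPathTo o (X.step y (x :: p)) ∧
      ((X.step y (x :: p)).length = (x :: p).length + 1 ∨
        (X.step y (x :: p)).length + 1 = (x :: p).length) := by
  by_cases h : X.Toward (x :: p) y
  · obtain ⟨x', q, hq⟩ := h
    have h1 := hX.step_of_toward hq
    refine ⟨(hl.of_pushEq hq).of_cons.2.of_pushEq h1.symm, Or.inr ?_⟩
    rw [h1.length_eq, hq.length_eq]
    simp
  · rw [step_of_not_toward h]
    exact ⟨.cons hyx hl, by simp⟩

theorem act_isPathTo (w : X.graph.Walk a o) :
    X.IsPathTo o (X.act w [o]) ∧ (X.act w [o]).length ≤ w.length + 1 := by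
  induction w with
  | nil => exact ⟨.nil, by simp [act]⟩
  | cons h w ih =>
    obtain ⟨q, hq⟩ := exists_act_eq_cons w []
    simp only [act, SimpleGraph.Walk.length_cons]
    rw [hq] at ih ⊢
    have := hX.isPathTo_step ih.1 h
    exact ⟨this.1, by omega⟩

/-- Normal forms are geodesics: the form does not depend on the walk, a geodesic bounds its length
from above, and it is itself a path. The list counts vertices, whence the `+ 1`. -/
theorem length_act (w : X.graph.Walk a o) : (X.act w [o]).length = X.graph.dist a o + 1 := by
  obtain ⟨w', hw'⟩ := hX.1.1.exists_walk_length_eq_dist a o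
  have h1 := (hX.act_isPathTo w').2
  rw [← (hX.act_eq w w').length_eq] at h1
  obtain ⟨q, hq⟩ := exists_act_eq_cons w []
  obtain ⟨w'', hw''⟩ := (hX.act_isPathTo w).1.exists_walk a q hq
  have := SimpleGraph.dist_le w''
  rw [hq] at h1 ⊢
  simp at h1 ⊢
  omega

/-- A step changes the length of a normal form by exactly one, so the graph is bipartite. -/
theorem dist_adj (h : X.graph.Adj x y) (o : V) :
    X.graph.dist x o = X.graph.dist y o + 1 ∨ X.graph.dist x o + 1 = X.graph.dist y o := by
  obtain ⟨w, -⟩ := hX.1.1.exists_walk_length_eq_dist y o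
  have h1 := hX.length_act w
  have h2 := hX.length_act (.cons h w)
  obtain ⟨q, hq⟩ := exists_act_eq_cons w []
  have h3 := (hX.act_isPathTo w).1
  simp only [act] at h2
  rw [hq] at h1 h2 h3
  have := (hX.isPathTo_step h3 h).2
  omega

/-- The quadrangle condition. -/
theorem exists_square (hxy : X.graph.Adj x y) (hxz : X.graph.Adj x z) (hyz : y ≠ z)
    (hy : X.graph.dist x o = X.graph.dist y o + 1) (hz : X.graph.dist x o = X.graph.dist z o + 1) :
    ∃ w, X.IsSquare x y w z ∧ X.graph.dist y o = X.graph.dist w o + 1 := by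
  have key : ∀ {y} (hxy : X.graph.Adj x y), X.graph.dist x o = X.graph.dist y o + 1 →
      ∀ w : X.graph.Walk y o, X.act (.cons hxy w) [o] = x :: X.act w [o] := by
    intro y hxy hy w
    obtain ⟨q, hq⟩ := exists_act_eq_cons w []
    simp only [act]
    refine step_of_not_toward fun ⟨y', r, hr⟩ => ?_
    have h1 := (hX.step_of_toward hr).length_eq
    have h2 := hr.length_eq
    have h3 := hX.length_act w
    have h4 := hX.length_act (.cons hxy w)
    simp only [act] at h4
    simp at h1 h2
    omega
  obtain ⟨w, -⟩ := hX.1.1.exists_walk_length_eq_dist y o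
  obtain ⟨w', -⟩ := hX.1.1.exists_walk_length_eq_dist z o
  have h := hX.act_eq (.cons hxy w) (.cons hxz w')
  rw [key hxy hy, key hxz hz] at h
  obtain ⟨q, hq⟩ := exists_act_eq_cons w []
  obtain ⟨q', hq'⟩ := exists_act_eq_cons w' []
  have hpath := (hX.act_isPathTo w).1
  have hlen := hX.length_act w
  rw [hq] at hpath hlen
  rw [hq, hq'] at h
  -- Two normal forms from `x` to `o`, one through `y` and one through `z`, are equivalent. The
  -- exchange of their first edges is the required square.
  rcases hX.pushEq_cases h with h | ⟨y', z', u, t, h1, h2, h3⟩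
  · exact absurd h.head_eq' hyz
  · obtain rfl := h1.head_eq'
    obtain rfl := h2.head_eq'
    refine ⟨u, h3, ?_⟩
    have hp := (hpath.of_pushEq h1).of_cons
    obtain ⟨v, hv⟩ := hp.2.exists_walk u t rfl
    have := SimpleGraph.dist_le v
    have := h1.length_eq
    simp at this hlen
    rcases hX.dist_adj hp.1 o with h | h
    · exact h
    · omega

end IsCAT0

end NormalForm

end SquareComplex

namespace SquareComplex

open Pointwise

/-! ### Halfspaces of a `CAT(0)` square complex -/

section Halfspaces

variable {V : Type v} (X : SquareComplex V)

/-- The vertices closer to `b` than to `a`. -/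
def halfspace (a b : V) : Set V := {z | X.graph.dist b z < X.graph.dist a z}

/-- The halfspaces of the edges. -/
def halfspaces : Set (Set V) := {A | ∃ a b, X.graph.Adj a b ∧ X.halfspace a b = A}

variable {X} {a b c d w x y z : V} {A B : Set V}

theorem mem_halfspace : z ∈ X.halfspace a b ↔ X.graph.dist b z < X.graph.dist a z := Iff.rfl

theorem left_notMem_halfspace (a b : V) : a ∉ X.halfspace a b := by simp [mem_halfspace]

theorem halfspace_mem_halfspaces (h : X.graph.Adj a b) : X.halfspace a b ∈ X.halfspaces :=
  ⟨a, b, h, rfl⟩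

theorem IsSquare.adj₁ (h : X.IsSquare a b c d) : X.graph.Adj a b := X.adj_of_isSquare h

theorem IsSquare.adj₂ (h : X.IsSquare a b c d) : X.graph.Adj b c := X.adj_of_isSquare (X.rotate h)

theorem IsSquare.adj₃ (h : X.IsSquare a b c d) : X.graph.Adj d c := X.adj_of_isSquare (X.reflect h)

theorem IsSquare.adj₄ (h : X.IsSquare a b c d) : X.graph.Adj a d := X.adj_of_isSquare h.swap

namespace IsCAT0

variable (hX : X.IsCAT0)
include hX

theorem right_mem_halfspace (h : X.graph.Adj a b) : b ∈ X.halfspace a b := by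
  rw [mem_halfspace, SimpleGraph.dist_self]
  exact hX.1.1.pos_dist_of_ne h.ne

theorem compl_halfspace (h : X.graph.Adj a b) : (X.halfspace a b)ᶜ = X.halfspace b a := by
  ext z
  rw [Set.mem_compl_iff, mem_halfspace, mem_halfspace]
  have := hX.dist_adj h z
  omega

/-- Otherwise `c` is further from `z` than both `b` and `d`. The quadrangle condition at `c` then
returns the same square, with `a` closer to `z` than `b`, contrary to the choice of `z`. -/
theorem halfspace_subset_of_square (h : X.IsSquare a b c d) :
    X.halfspace a b ⊆ X.halfspace d c := by
  intro z hz
  rw [mem_halfspace] at *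
  have h1 := hX.dist_adj h.adj₁ z
  have h2 := hX.dist_adj h.adj₂ z
  have h3 := hX.dist_adj h.adj₃ z
  have h4 := hX.dist_adj h.adj₄ z
  by_contra h5
  obtain ⟨w, hw, hw'⟩ := hX.exists_square (o := z) h.adj₂.symm h.adj₃.symm h.ne_right
    (by omega) (by omega)
  obtain rfl := hX.corner_unique hw (X.rotate (X.reflect h))
  omega

theorem halfspace_eq_of_square (h : X.IsSquare a b c d) : X.halfspace a b = X.halfspace d c :=
  (hX.halfspace_subset_of_square h).antisymm (hX.halfspace_subset_of_square (X.reflect h))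

/-- A vertex has a neighbour in the direction of any other vertex. -/
theorem exists_adj_mem_halfspace (h : x ≠ z) : ∃ y, X.graph.Adj x y ∧ z ∈ X.halfspace x y := by
  obtain ⟨p, hp⟩ := hX.1.1.exists_walk_length_eq_dist x z
  cases p with
  | nil => exact absurd rfl h
  | @cons _ y _ hxy p =>
    refine ⟨y, hxy, ?_⟩
    have := SimpleGraph.dist_le p
    rw [mem_halfspace]
    simp at hp
    omega

/-- Induction on the distance to `a`: the quadrangle condition, applied towards `b`, gives a square
on `xy` and an edge from `x` towards `a`. The side opposite to `xy` crosses the same wall closer to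
`a`. -/
theorem halfspace_eq_aux (h : X.graph.Adj a b) : ∀ (n : ℕ) {x y : V}, X.graph.dist x a = n →
    X.graph.Adj x y → x ∉ X.halfspace a b → y ∈ X.halfspace a b →
    X.halfspace x y = X.halfspace a b := by
  intro n
  induction n with
  | zero =>
    intro x y hn hxy hx hy
    obtain rfl := (hX.1.1.dist_eq_zero_iff).1 hn
    rw [mem_halfspace, SimpleGraph.dist_comm, SimpleGraph.dist_comm (u := x)] at hy
    have h1 := hX.dist_adj hxy x
    rw [SimpleGraph.dist_self] at h1
    have : y = b := (hX.1.1.dist_eq_zero_iff).1 (by omega)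
    rw [this]
  | succ n ih =>
    intro x y hn hxy hx hy
    rw [mem_halfspace, SimpleGraph.dist_comm, SimpleGraph.dist_comm (u := a)] at hx hy
    have h1 := hX.dist_adj hxy a
    have h2 := hX.dist_adj hxy b
    have h3 := hX.dist_adj h x
    rw [SimpleGraph.dist_comm, SimpleGraph.dist_comm (u := b)] at h3
    obtain ⟨w, hxw, hw⟩ := hX.exists_adj_mem_halfspace (x := x) (z := a) (by
      rintro rfl
      rw [SimpleGraph.dist_self] at hn
      omega)
    rw [mem_halfspace] at hw
    replace hw : X.graph.dist w a = n := by
      have := hX.dist_adj hxw a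
      omega
    have h4 := hX.dist_adj hxw b
    have h5 := hX.dist_adj h w
    rw [SimpleGraph.dist_comm, SimpleGraph.dist_comm (u := b)] at h5
    obtain ⟨v, hv, hv'⟩ := hX.exists_square (o := b) hxw hxy (by rintro rfl; omega)
      (by omega) (by omega)
    have h6 := hX.dist_adj hv.adj₂ a
    have h7 := hX.dist_adj hv.adj₃ a
    rw [← ih hw hv.adj₂ (by
      rw [mem_halfspace, SimpleGraph.dist_comm, SimpleGraph.dist_comm (u := a)]; omega) (by
      rw [mem_halfspace, SimpleGraph.dist_comm, SimpleGraph.dist_comm (u := a)]; omega)]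
    exact hX.halfspace_eq_of_square hv.swap

/-- An edge crosses a single wall. -/
theorem eq_halfspace (hA : A ∈ X.halfspaces) (hxy : X.graph.Adj x y) (hx : x ∉ A) (hy : y ∈ A) :
    A = X.halfspace x y := by
  obtain ⟨a, b, h, rfl⟩ := hA
  exact (hX.halfspace_eq_aux h _ rfl hxy hx hy).symm

theorem compl_mem_halfspaces (hA : A ∈ X.halfspaces) : Aᶜ ∈ X.halfspaces := by
  obtain ⟨a, b, h, rfl⟩ := hA
  rw [hX.compl_halfspace h]
  exact halfspace_mem_halfspaces h.symm

theorem mem_iff_of_adj (hA : A ∈ X.halfspaces) (hxy : X.graph.Adj x y)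
    (h1 : A ≠ X.halfspace x y) (h2 : A ≠ (X.halfspace x y)ᶜ) : x ∈ A ↔ y ∈ A := by
  constructor
  · intro hx
    by_contra hy
    refine h2 ?_
    rw [hX.compl_halfspace hxy]
    exact hX.eq_halfspace hA hxy.symm hy hx
  · intro hy
    by_contra hx
    exact h1 (hX.eq_halfspace hA hxy hx hy)

theorem nonempty_of_mem_halfspaces (hA : A ∈ X.halfspaces) : A.Nonempty := by
  obtain ⟨a, b, h, rfl⟩ := hA
  exact ⟨b, hX.right_mem_halfspace h⟩

theorem finite_separating (x y : V) : {A | A ∈ X.halfspaces ∧ x ∉ A ∧ y ∈ A}.Finite := by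
  obtain ⟨p⟩ := hX.1.1.preconnected x y
  induction p with
  | nil => exact Set.finite_empty.subset fun A hA => hA.2.1 hA.2.2
  | @cons x z y h p ih =>
    refine (ih.insert (X.halfspace x z)).subset fun A hA => ?_
    by_cases hz : z ∈ A
    · exact Or.inl (hX.eq_halfspace hA.1 h hA.2.1 hz)
    · exact Or.inr ⟨hA.1, hz, hA.2.2⟩

theorem exists_square_of_inter (ha : X.graph.Adj x a) (hb : X.graph.Adj x b) (hab : a ≠ b)
    (h : (X.halfspace x a ∩ X.halfspace x b).Nonempty) : ∃ w, X.IsSquare x a w b := by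
  obtain ⟨z, hz, hz'⟩ := h
  rw [mem_halfspace] at hz hz'
  have h1 := hX.dist_adj ha z
  have h2 := hX.dist_adj hb z
  obtain ⟨w, hw, -⟩ := hX.exists_square (o := z) ha hb hab (by omega) (by omega)
  exact ⟨w, hw⟩

/-- The maximal halfspaces that do not contain `x` are those of the edges from `x`. -/
theorem mem_maximalAvoiding_iff :
    A ∈ maximalAvoiding X.halfspaces x ↔ ∃ y, X.graph.Adj x y ∧ A = X.halfspace x y := by
  constructor
  · rintro ⟨hA, hx, hmax⟩
    obtain ⟨n, hn⟩ : ∃ n, ∃ a b, X.graph.Adj a b ∧ X.halfspace a b = A ∧ X.graph.dist a x = n := by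
      obtain ⟨a, b, h, h'⟩ := hA
      exact ⟨_, a, b, h, h', rfl⟩
    induction n using Nat.strong_induction_on with
    | _ n ih =>
    obtain ⟨a, b, hab, rfl, hn⟩ := hn
    by_cases hax : a = x
    · subst hax
      exact ⟨b, hab, rfl⟩
    obtain ⟨a', ha', hxa⟩ := hX.exists_adj_mem_halfspace hax
    have hne : a' ≠ b := by rintro rfl; exact hx hxa
    -- Step from `a` to `a'` towards `x`. If the two halfspaces meet, a square moves the dual edge
    -- closer to `x`. If not, `A` lies properly in a halfspace that still avoids `x`, against
    -- maximality.
    by_cases hint : (X.halfspace a b ∩ X.halfspace a a').Nonempty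
    · obtain ⟨w, hw⟩ := hX.exists_square_of_inter hab ha' hne.symm hint
      refine ih (X.graph.dist a' x) ?_ ⟨a', w, hw.adj₃, (hX.halfspace_eq_of_square hw).symm, rfl⟩
      rw [mem_halfspace] at hxa
      omega
    · have := hmax (X.halfspace a' a) (halfspace_mem_halfspaces ha'.symm) (by
        rw [← hX.compl_halfspace ha']
        exact fun h => h hxa) (by
        rw [← hX.compl_halfspace ha']
        exact WallSystem.subset_compl_of_disjoint (WallSystem.disjoint_of_not_inter hint))
      have h1 := hX.right_mem_halfspace ha'.symm
      rw [this] at h1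
      exact absurd h1 (left_notMem_halfspace a b)
  · rintro ⟨y, hxy, rfl⟩
    exact ⟨halfspace_mem_halfspaces hxy, left_notMem_halfspace x y, fun B hB hx hyB =>
      hX.eq_halfspace hB hxy hx (hyB (hX.right_mem_halfspace hxy))⟩

end IsCAT0

end Halfspaces

/-! ### Group actions, invariant walls and fixed points. -/

section Action

variable {V : Type v} {X : SquareComplex V} {G : Type u} [Group G] [MulAction G V]
  {a b w x y z u v : V} {A B C D P Q : Set V} {g : G}

variable (X) in
/-- The maximal halfspaces that do not contain `x`. -/
abbrev link (x : V) : Set (Set V) := maximalAvoiding X.halfspaces x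

variable (X) in
/-- The halfspaces whose walls cross the wall of `D`. -/
def crossed (D : Set V) : Set (Set V) := {A | A ∈ X.halfspaces ∧
  ((A ∩ D).Nonempty ∧ (A ∩ Dᶜ).Nonempty) ∧ (Aᶜ ∩ D).Nonempty ∧ (Aᶜ ∩ Dᶜ).Nonempty}

theorem crossed_compl (D : Set V) : X.crossed Dᶜ = X.crossed D := by
  ext A
  simp only [crossed, Set.mem_ofPred_eq, compl_compl]
  tauto

theorem crossed_eq (h : P = D ∨ P = Dᶜ) : X.crossed P = X.crossed D := by
  rcases h with rfl | rfl
  exacts [rfl, crossed_compl D]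

variable (X) in
/-- The vertices adjacent to the wall of `D`. -/
def carrier (D : Set V) : Set V := {x | ∃ P, (P = D ∨ P = Dᶜ) ∧ P ∈ X.link x}

theorem compl_mem_crossed (hX : X.IsCAT0) (h : A ∈ X.crossed D) : Aᶜ ∈ X.crossed D :=
  ⟨hX.compl_mem_halfspaces h.1, h.2.2, by rw [compl_compl]; exact h.2.1⟩

theorem ne_of_mem_crossed (h : A ∈ X.crossed D) : A ≠ D ∧ A ≠ Dᶜ := by
  constructor
  · rintro rfl
    simpa using h.2.1.2
  · rintro rfl
    simpa using h.2.1.1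

namespace IsCAT0

variable (hX : X.IsCAT0)
include hX

theorem halfspace_mem_link (h : X.graph.Adj x y) : X.halfspace x y ∈ X.link x :=
  hX.mem_maximalAvoiding_iff.2 ⟨y, h, rfl⟩

theorem exists_across_link (hA : A ∈ X.link x) : ∃ y, A = X.halfspace x y ∧
    X.graph.Adj x y ∧ y ∈ A ∧ ∀ B ∈ X.halfspaces, B ≠ A → B ≠ Aᶜ → (x ∈ B ↔ y ∈ B) := by
  obtain ⟨y, hxy, rfl⟩ := hX.mem_maximalAvoiding_iff.1 hA
  exact ⟨y, rfl, hxy, hX.right_mem_halfspace hxy, fun B hB h h' => hX.mem_iff_of_adj hB hxy h h'⟩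

theorem exists_square_of_link (hA : A ∈ X.link x) (hB : B ∈ X.link x) (hne : A ≠ B)
    (h : (A ∩ B).Nonempty) :
    ∃ a w b, X.IsSquare x a w b ∧ A = X.halfspace x a ∧ B = X.halfspace x b := by
  obtain ⟨a, ha, rfl⟩ := hX.mem_maximalAvoiding_iff.1 hA
  obtain ⟨b, hb, rfl⟩ := hX.mem_maximalAvoiding_iff.1 hB
  obtain ⟨w, hw⟩ := hX.exists_square_of_inter ha hb (fun h => hne (h ▸ rfl)) h
  exact ⟨a, w, b, hw, rfl, rfl⟩

theorem no_triangle (hA : A ∈ X.link x) (hB : B ∈ X.link x) (hC : C ∈ X.link x)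
    (hAB : (A ∩ B).Nonempty) (hAC : (A ∩ C).Nonempty) (hBC : (B ∩ C).Nonempty) : A = B ∨ A = C ∨ B = C := by
  obtain ⟨a, ha, rfl⟩ := hX.mem_maximalAvoiding_iff.1 hA
  obtain ⟨b, hb, rfl⟩ := hX.mem_maximalAvoiding_iff.1 hB
  obtain ⟨c, hc, rfl⟩ := hX.mem_maximalAvoiding_iff.1 hC
  by_contra! hne
  exact hX.2.2 x a b c ⟨hX.exists_square_of_inter ha hb (fun h => hne.1 (h ▸ rfl)) hAB,
    hX.exists_square_of_inter hb hc (fun h => hne.2.2 (h ▸ rfl)) hBC,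
    hX.exists_square_of_inter hc ha (fun h => hne.2.1 (h ▸ rfl)) (Set.inter_comm _ _ ▸ hAC)⟩

/-- The walls of a square at its corners. -/
theorem link_of_square (h : X.IsSquare x a w b) :
    ((X.halfspace x a ∈ X.link x ∧ X.halfspace x b ∈ X.link x) ∧
      ((X.halfspace x a)ᶜ ∈ X.link a ∧ X.halfspace x b ∈ X.link a)) ∧
      ((X.halfspace x a)ᶜ ∈ X.link w ∧ (X.halfspace x b)ᶜ ∈ X.link w) ∧
      (X.halfspace x a ∈ X.link b ∧ (X.halfspace x b)ᶜ ∈ X.link b) := by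
  have h1 := hX.halfspace_mem_link h.adj₁
  have h2 := hX.halfspace_mem_link h.adj₄
  have e1 := hX.halfspace_eq_of_square h
  have e2 := hX.halfspace_eq_of_square h.swap
  refine ⟨⟨⟨h1, h2⟩, ?_, ?_⟩, ⟨?_, ?_⟩, ?_, ?_⟩
  · rw [hX.compl_halfspace h.adj₁]
    exact hX.halfspace_mem_link h.adj₁.symm
  · rw [e2]
    exact hX.halfspace_mem_link h.adj₂
  · rw [e1, hX.compl_halfspace h.adj₃]
    exact hX.halfspace_mem_link h.adj₃.symm
  · rw [e2, hX.compl_halfspace h.adj₂]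
    exact hX.halfspace_mem_link h.adj₂.symm
  · rw [e1]
    exact hX.halfspace_mem_link h.adj₃
  · rw [hX.compl_halfspace h.adj₄]
    exact hX.halfspace_mem_link h.adj₄.symm

/-- A quadrant of two crossing walls contains only one vertex adjacent to both walls. -/
theorem eq_of_link (hP : P ∈ X.link u) (hQ : Q ∈ X.link u) (hP' : P ∈ X.link v) (hQ' : Q ∈ X.link v)
    (hne : P ≠ Q) (hPQ : (P ∩ Q).Nonempty) : u = v := by
  by_contra huv
  obtain ⟨u', hu', hv⟩ := hX.exists_adj_mem_halfspace huv
  -- The edge from `u` towards `v` would add a third halfspace at `u` that meets both `P` and `Q`.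
  have key : ∀ P ∈ X.link u, P ∈ X.link v →
      (P ∩ X.halfspace u u').Nonempty ∧ P ≠ X.halfspace u u' := by
    intro P hP hP'
    have hne : P ≠ X.halfspace u u' := by
      rintro rfl
      exact hP'.2.1 hv
    obtain ⟨p, -, -, hp, hiff⟩ := hX.exists_across_link hP'
    refine ⟨⟨p, hp, (hiff _ (halfspace_mem_halfspaces hu') hne.symm fun h => ?_).1 hv⟩, hne⟩
    exact left_notMem_halfspace u u' (by rw [h]; exact hP.2.1)
  have k1 := key P hP hP'
  have k2 := key Q hQ hQ'
  rcases hX.no_triangle hP hQ (hX.halfspace_mem_link hu') hPQ k1.1 k2.1 with h | h | h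
  exacts [hne h, k1.2 h, k2.2 h]

/-- The two ends of an edge are the only vertices adjacent to its wall that are not separated from
them by a wall crossing it. -/
theorem eq_of_not_separated (hu : P ∈ X.link u) (hv : P ∈ X.link v)
    (h : ∀ A ∈ X.crossed P, u ∈ A ↔ v ∈ A) : u = v := by
  by_contra huv
  obtain ⟨u', hu', hvC⟩ := hX.exists_adj_mem_halfspace huv
  have hC := halfspace_mem_halfspaces hu'
  have huC := left_notMem_halfspace (X := X) u u'
  have hne : X.halfspace u u' ≠ P := by
    rintro rfl
    exact hv.2.1 hvC
  have hne' : X.halfspace u u' ≠ Pᶜ := fun h => huC (h ▸ hu.2.1)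
  obtain ⟨p, -, -, hp, hpiff⟩ := hX.exists_across_link hu
  obtain ⟨q, -, -, hq, hqiff⟩ := hX.exists_across_link hv
  -- `u`, `v` and their neighbours `p`, `q` across `P` occupy the four quadrants, so the wall
  -- separating `u` from `v` crosses `P`.
  exact huC ((h _ ⟨hC, ⟨⟨q, (hqiff _ hC hne hne').1 hvC, hq⟩, ⟨v, hvC, hv.2.1⟩⟩,
    ⟨p, fun hpC => huC ((hpiff _ hC hne hne').2 hpC), hp⟩, ⟨u, huC, hu.2.1⟩⟩).2 hvC)

/-- Around a vertex adjacent to the wall of `D`, the maximal halfspaces crossing `D` are maximal. -/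
theorem mem_link_of_crossed (hD : D ∈ X.link x) (hA : A ∈ maximalAvoiding (X.crossed D) x) :
    A ∈ X.link x := by
  obtain ⟨hA, hx, hmax⟩ := hA
  obtain ⟨z, hz⟩ := hA.2.1.1.left
  -- Enlarge `A` among all halfspaces that avoid `x`. The result still crosses `D`, so it equals `A`
  -- by maximality.
  obtain ⟨B, hAB, hB⟩ := (hX.finite_separating x z).exists_le_maximal ⟨hA.1, hx, hz⟩
  have hBx : B ∈ X.link x := ⟨hB.1.1, hB.1.2.1, fun C hC hxC hBC =>
    (hB.eq_of_le ⟨hC, hxC, hBC hB.1.2.2⟩ hBC).symm⟩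
  have hne : B ≠ D := by
    rintro rfl
    obtain ⟨y, hy, hy'⟩ := hA.2.1.2
    exact hy' (hAB hy)
  have hBD : (B ∩ D).Nonempty := hA.2.1.1.mono (Set.inter_subset_inter_left _ hAB)
  obtain ⟨y, -, -, hy, hyiff⟩ := hX.exists_across_link hD
  have hne' : B ≠ Dᶜ := by
    rintro rfl
    simp at hBD
  rw [← hmax B ⟨hB.1.1, ⟨hBD, hA.2.1.2.mono (Set.inter_subset_inter_left _ hAB)⟩,
    ⟨y, fun h => hB.1.2.1 ((hyiff B hB.1.1 hne hne').2 h), hy⟩, ⟨x, hB.1.2.1, hD.2.1⟩⟩ hB.1.2.1 hAB]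
  exact hBx

end IsCAT0

variable (X G) in
/-- The group acts by automorphisms of the graph. -/
def ActsOn : Prop := ∀ (g : G) (a b : V), X.graph.Adj (g • a) (g • b) ↔ X.graph.Adj a b

variable (X G) in
/-- No point of the complex is fixed by the whole group. -/
def HasNoFixedPoint : Prop := ∀ p ∈ X.points, ∃ g : G, Finsupp.mapDomain (g • ·) p ≠ p

/-- An invariant finite vertex set with equal weights represents a fixed point. This is used for the
barycentres of vertices, edges and squares. -/
theorem HasNoFixedPoint.exists_smul_notMem (h : X.HasNoFixedPoint G) {F : Finset V} {c : ℝ}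
    (hp : ∑ v ∈ F, Finsupp.single v c ∈ X.points) : ∃ g : G, ∃ v ∈ F, g • v ∉ F := by
  classical
  by_contra! hF
  obtain ⟨g, hg⟩ := h _ hp
  refine hg ?_
  have himg : F.image (g • ·) = F := Finset.eq_of_subset_of_card_le
    (Finset.image_subset_iff.2 (hF g)) (Finset.card_image_of_injective _ (MulAction.injective g)).ge
  rw [Finsupp.mapDomain_finsetSum]
  conv_rhs => rw [← himg, Finset.sum_image ((MulAction.injective g).injOn)]
  exact Finset.sum_congr rfl fun v _ => Finsupp.mapDomain_single

theorem HasNoFixedPoint.exists_smul_ne (h : X.HasNoFixedPoint G) (x : V) : ∃ g : G, g • x ≠ x := by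
  obtain ⟨g, v, hv, hg⟩ := h.exists_smul_notMem (F := {x}) (c := 1) (Or.inl ⟨x, by simp⟩)
  rw [Finset.mem_singleton] at hv hg
  exact ⟨g, hv ▸ hg⟩

open Classical in
theorem HasNoFixedPoint.exists_smul_notMem_edge (h : X.HasNoFixedPoint G) (hxy : X.graph.Adj x y) :
    ∃ g : G, ∃ v ∈ ({x, y} : Finset V), g • v ∉ ({x, y} : Finset V) := by
  refine h.exists_smul_notMem (c := 1 / 2) (Or.inr (Or.inl ⟨x, y, hxy, 1 / 2, by norm_num, ?_⟩))
  rw [Finset.sum_pair hxy.ne]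
  norm_num

open Classical in
theorem HasNoFixedPoint.exists_smul_notMem_square (h : X.HasNoFixedPoint G)
    (hsq : X.IsSquare x a w b) :
    ∃ g : G, ∃ v ∈ ({x, a, w, b} : Finset V), g • v ∉ ({x, a, w, b} : Finset V) := by
  refine h.exists_smul_notMem (c := 1 / 4) (Or.inr (Or.inr ⟨x, a, w, b, hsq, 1 / 2, by norm_num,
    1 / 2, by norm_num, ?_⟩))
  rw [Finset.sum_insert, Finset.sum_insert, Finset.sum_pair hsq.adj₃.ne']
  · norm_num [add_assoc]
  · simp [hsq.adj₂.ne, hsq.ne_right]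
  · simp [hsq.adj₁.ne, hsq.adj₄.ne, X.ne_of_isSquare hsq]

namespace IsCAT0

variable (hX : X.IsCAT0)
include hX

theorem dist_smul (h : X.ActsOn G) (g : G) (a b : V) :
    X.graph.dist (g • a) (g • b) = X.graph.dist a b := by
  have hle : ∀ (g : G) (a b : V), X.graph.dist (g • a) (g • b) ≤ X.graph.dist a b := by
    intro g a b
    obtain ⟨p, hp⟩ := hX.1.1.exists_walk_length_eq_dist a b
    rw [← hp, ← SimpleGraph.Walk.length_map
      (⟨(g • ·), fun h' => (h g _ _).2 h'⟩ : X.graph →g X.graph) p]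
    exact SimpleGraph.dist_le _
  refine (hle g a b).antisymm ?_
  simpa using hle g⁻¹ (g • a) (g • b)

theorem smul_halfspace (h : X.ActsOn G) (g : G) (a b : V) :
    g • X.halfspace a b = X.halfspace (g • a) (g • b) := by
  ext z
  rw [Set.mem_smul_set_iff_inv_smul_mem, mem_halfspace, mem_halfspace,
    ← hX.dist_smul h g b, ← hX.dist_smul h g a, smul_inv_smul]

theorem smul_mem_halfspaces (h : X.ActsOn G) (g : G) (hA : A ∈ X.halfspaces) :
    g • A ∈ X.halfspaces := by
  obtain ⟨a, b, hab, rfl⟩ := hA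
  rw [hX.smul_halfspace h]
  exact halfspace_mem_halfspaces ((h g a b).2 hab)

theorem smul_mem_link (h : X.ActsOn G) (g : G) (hA : A ∈ X.link x) : g • A ∈ X.link (g • x) := by
  obtain ⟨a, ha, rfl⟩ := hX.mem_maximalAvoiding_iff.1 hA
  rw [hX.smul_halfspace h]
  exact hX.halfspace_mem_link ((h g x a).2 ha)

theorem smul_mem_crossed (h : X.ActsOn G) (g : G) (hA : A ∈ X.crossed D) :
    g • A ∈ X.crossed (g • D) := by
  refine ⟨hX.smul_mem_halfspaces h g hA.1, ?_⟩
  simp only [← Set.smul_set_compl, ← Set.smul_set_inter, Set.smul_set_nonempty]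
  exact hA.2

/-- The wall system of all halfspaces. -/
def wallSystem (h : X.ActsOn G) : WallSystem G V where
  halfspaces := X.halfspaces
  base := Set.univ
  base_nonempty := @Set.univ_nonempty _ hX.1.1.nonempty
  compl_mem _ := hX.compl_mem_halfspaces
  smul_mem g _ := hX.smul_mem_halfspaces h g
  nonempty _ := hX.nonempty_of_mem_halfspaces
  finite_sep := hX.finite_separating
  exists_adj x _ A hA := by
    obtain ⟨y, -, -, hy, hiff⟩ := hX.exists_across_link hA
    exact ⟨y, trivial, hy, hiff⟩
  no_triangle x _ A hA B hB C hC := hX.no_triangle hA hB hC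

/-- The wall system of the halfspaces that cross an invariant wall. -/
def carrierSystem (h : X.ActsOn G) (hD : ∀ g : G, g • D = D ∨ g • D = Dᶜ) (hx : D ∈ X.link x) :
    WallSystem G V where
  halfspaces := X.crossed D
  base := X.carrier D
  base_nonempty := ⟨x, D, Or.inl rfl, hx⟩
  compl_mem _ := compl_mem_crossed hX
  smul_mem g A hA := by
    rw [← crossed_eq (hD g)]
    exact hX.smul_mem_crossed h g hA
  nonempty A hA := hA.2.1.1.left
  finite_sep x y := (hX.finite_separating x y).subset fun A hA => ⟨hA.1.1, hA.2⟩
  exists_adj x := by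
    rintro ⟨P, hP, hPx⟩ A hA
    rw [← crossed_eq hP] at hA
    have hAx := hX.mem_link_of_crossed hPx hA
    -- `A` and `P` span a square at `x`, whose edge across `A` ends at a vertex again adjacent to
    -- the wall of `P`.
    obtain ⟨a, w, p, hsq, rfl, rfl⟩ := hX.exists_square_of_link hAx hPx
      (ne_of_mem_crossed hA.1).1 hA.1.2.1.1
    exact ⟨a, ⟨_, hP, (hX.link_of_square hsq).1.2.2⟩, hX.right_mem_halfspace hsq.adj₁,
      fun B hB h h' => hX.mem_iff_of_adj hB.1 hsq.adj₁ h h'⟩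
  no_triangle x := by
    rintro ⟨P, hP, hPx⟩ A hA B hB C hC
    rw [← crossed_eq hP] at hA hB hC
    exact hX.no_triangle (hX.mem_link_of_crossed hPx hA) (hX.mem_link_of_crossed hPx hB)
      (hX.mem_link_of_crossed hPx hC)

open Classical in
/-- Without a fixed point there is no invariant pair of crossing walls. -/
theorem exists_notMem_stabilizer (h : X.ActsOn G) (hfix : X.HasNoFixedPoint G) (hA : A ∈ X.link x)
    (hB : B ∈ X.link x) (hne : A ≠ B) (hAB : (A ∩ B).Nonempty) :
    ∃ g : G, g ∉ MulAction.stabilizer G ({A, Aᶜ, B, Bᶜ} : Set (Set V)) := by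
  obtain ⟨a, w, b, hsq, rfl, rfl⟩ := hX.exists_square_of_link hA hB hne hAB
  by_contra! hall
  have hlink := hX.link_of_square hsq
  set A := X.halfspace x a
  set B := X.halfspace x b
  obtain ⟨⟨⟨x1, x2⟩, a1, a2⟩, ⟨w1, w2⟩, b1, b2⟩ := hlink
  have q1 : (Aᶜ ∩ Bᶜ).Nonempty := ⟨x, x1.2.1, x2.2.1⟩
  have q2 : (Aᶜ ∩ B).Nonempty := ⟨b, b1.2.1, by simpa using b2.2.1⟩
  have q3 : (A ∩ Bᶜ).Nonempty := ⟨a, by simpa using a1.2.1, a2.2.1⟩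
  -- Each quadrant contains only one vertex adjacent to both walls, so an element preserving the
  -- pair of walls preserves the square.
  have corner : ∀ v, ∀ P ∈ ({A, Aᶜ, B, Bᶜ} : Set (Set V)), ∀ Q ∈ ({A, Aᶜ, B, Bᶜ} : Set (Set V)),
      P ∈ X.link v → Q ∈ X.link v → P ≠ Q → (P ∩ Q).Nonempty → v ∈ ({x, a, w, b} : Finset V) := by
    intro v P hP Q hQ hPv hQv hne hPQ
    have key : ∀ u ∈ ({x, a, w, b} : Finset V), P ∈ X.link u → Q ∈ X.link u →
        v ∈ ({x, a, w, b} : Finset V) := fun u hu h1 h2 =>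
      hX.eq_of_link h1 h2 hPv hQv hne hPQ ▸ hu
    rcases hP with rfl | rfl | rfl | rfl <;> rcases hQ with rfl | rfl | rfl | rfl <;>
      first
      | exact absurd rfl hne
      | (simp at hPQ)
      | exact key x (by simp) ‹_› ‹_›
      | exact key a (by simp) ‹_› ‹_›
      | exact key w (by simp) ‹_› ‹_›
      | exact key b (by simp) ‹_› ‹_›
  obtain ⟨g, v, hv, hgv⟩ := hfix.exists_smul_notMem_square hsq
  have hg := MulAction.mem_stabilizer_iff.1 (hall g)
  have key : ∀ P ∈ ({A, Aᶜ, B, Bᶜ} : Set (Set V)), ∀ Q ∈ ({A, Aᶜ, B, Bᶜ} : Set (Set V)),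
      P ∈ X.link v → Q ∈ X.link v → P ≠ Q → (P ∩ Q).Nonempty → False := by
    intro P hP Q hQ hPv hQv hne hPQ
    refine hgv (corner _ (g • P) ?_ (g • Q) ?_ (hX.smul_mem_link h g hPv)
      (hX.smul_mem_link h g hQv) (fun h => hne (smul_left_cancel g h)) ?_)
    · rw [← hg]; exact Set.smul_mem_smul_set hP
    · rw [← hg]; exact Set.smul_mem_smul_set hQ
    · rw [← Set.smul_set_inter]; exact hPQ.smul_set
  have ne_of : ∀ {P Q : Set V}, (P ∩ Qᶜ).Nonempty → P ≠ Q := by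
    rintro P Q h rfl
    simp at h
  simp only [Finset.mem_insert, Finset.mem_singleton] at hv
  rcases hv with rfl | rfl | rfl | rfl
  · exact key A (by simp) B (by simp) x1 x2 (ne_of q3) hAB
  · exact key Aᶜ (by simp) B (by simp) a1 a2 (ne_of q1) q2
  · exact key Aᶜ (by simp) Bᶜ (by simp) w1 w2 (ne_of (by rwa [compl_compl])) q1
  · exact key A (by simp) Bᶜ (by simp) b1 b2 (ne_of (by rwa [compl_compl])) q3

open Classical in
/-- Without a fixed point, the walls that cross an invariant wall separate some translate of each
adjacent vertex. -/
theorem exists_separating_crossed (h : X.ActsOn G) (hfix : X.HasNoFixedPoint G)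
    (hD : ∀ g : G, g • D = D ∨ g • D = Dᶜ) (hx : D ∈ X.link x) :
    ∃ g : G, ∃ A ∈ X.crossed D, ¬ (g • x ∈ A ↔ x ∈ A) := by
  by_contra! hall
  -- Let `xy` be the edge across `D`. If no wall crossing `D` separates `x` from its translates, all
  -- translates of `x` and `y` lie in `{x, y}` by `eq_of_not_separated`, and the midpoint is fixed.
  obtain ⟨y, hDy, hxy, -, hiff⟩ := hX.exists_across_link hx
  have hyx : ∀ A ∈ X.crossed D, x ∈ A ↔ y ∈ A := fun A hA =>
    hiff A hA.1 (ne_of_mem_crossed hA).1 (ne_of_mem_crossed hA).2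
  have hy : Dᶜ ∈ X.link y := by
    rw [hDy, hX.compl_halfspace hxy]
    exact hX.halfspace_mem_link hxy.symm
  obtain ⟨g, v, hv, hgv⟩ := hfix.exists_smul_notMem_edge hxy
  have hv' : ∀ A ∈ X.crossed D, x ∈ A ↔ g • v ∈ A := by
    intro A hA
    have hA' : g⁻¹ • A ∈ X.crossed D := by
      rw [← crossed_eq (hD g⁻¹)]
      exact hX.smul_mem_crossed h _ hA
    have h1 : x ∈ g⁻¹ • A ↔ v ∈ g⁻¹ • A := by
      simp only [Finset.mem_insert, Finset.mem_singleton] at hv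
      rcases hv with rfl | rfl
      exacts [Iff.rfl, hyx _ hA']
    rw [← hall g A hA, ← WallSystem.mem_inv_smul_iff, h1, WallSystem.mem_inv_smul_iff]
  have hlink : D ∈ X.link (g • v) ∨ Dᶜ ∈ X.link (g • v) := by
    simp only [Finset.mem_insert, Finset.mem_singleton] at hv
    rcases hv with rfl | rfl
    · have := hX.smul_mem_link h g hx
      rcases hD g with h | h <;> rw [h] at this
      exacts [Or.inl this, Or.inr this]
    · have := hX.smul_mem_link h g hy
      rw [Set.smul_set_compl] at this
      rcases hD g with h | h <;> rw [h] at this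
      · exact Or.inr this
      · rw [compl_compl] at this
        exact Or.inl this
  refine hgv ?_
  rcases hlink with hl | hl
  · simp [← hX.eq_of_not_separated hx hl hv']
  · rw [← hX.eq_of_not_separated hy hl (by
      rw [crossed_compl]
      exact fun A hA => (hyx A hA).symm.trans (hv' A hA))]
    simp

end IsCAT0

end Action

end SquareComplex

/-! ### Invariant walls and the main theorem. -/

section Main

open Pointwise

theorem SquareComplex.IsCAT0.hasAvoidingAutomaton {S : Type u} [Fintype S] {V : Type v}
    [MulAction (FreeGroup S) V] {X : SquareComplex V} (hX : X.IsCAT0)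
    (h : X.ActsOn (FreeGroup S)) (hfix : X.HasNoFixedPoint (FreeGroup S))
    (hS : 0 < Fintype.card S) :
    HasAvoidingAutomaton ((Fintype.card S : ℝ) / 6) (WallSystem.trivialElements S V) := by
  by_cases hinv : ∃ x, ∃ D ∈ X.link x, ∀ g : FreeGroup S, g • D = D ∨ g • D = Dᶜ
  · obtain ⟨x₀, D, hD, hDg⟩ := hinv
    have hinv : ∀ P, (P = D ∨ P = Dᶜ) → ∀ g : FreeGroup S, g • P = P ∨ g • P = Pᶜ := by
      rintro P (rfl | rfl) g
      · exact hDg g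
      · rw [Set.smul_set_compl]
        rcases hDg g with h | h <;> simp [h]
    refine WallSystem.hasAvoidingAutomaton (hX.carrierSystem h hDg hD) hS ?_ ?_ ?_
    · rintro x ⟨P, hP, hPx⟩
      obtain ⟨g, A, hA, hgA⟩ := hX.exists_separating_crossed h hfix (hinv P hP) hPx
      rw [SquareComplex.crossed_eq hP] at hA
      exact ⟨g, A, hA, hgA⟩
    · rintro x ⟨P, hP, hPx⟩ A (hA : A ∈ maximalAvoiding (X.crossed D) x)
      rw [← SquareComplex.crossed_eq hP] at hA
      -- If the wall of `A` were invariant as well, it would form an invariant crossing pair with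
      -- that of `P`.
      by_contra! hall
      obtain ⟨g, hg⟩ := hX.exists_notMem_stabilizer h hfix (hX.mem_link_of_crossed hPx hA) hPx
        (SquareComplex.ne_of_mem_crossed hA.1).1 hA.1.2.1.1
      have h1 := MulAction.mem_stabilizer_iff.1 (hall g)
      have h2 := MulAction.mem_stabilizer_iff.1 (WallSystem.mem_stabilizer_pair (hinv P hP g))
      refine hg (MulAction.mem_stabilizer_iff.2 ?_)
      have hunion : ({A, Aᶜ, P, Pᶜ} : Set (Set V)) = {A, Aᶜ} ∪ {P, Pᶜ} := by
        rw [Set.insert_union, Set.singleton_union]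
      rw [hunion, Set.smul_set_union, h1, h2]
    · rintro x ⟨P, hP, hPx⟩ A (hA : A ∈ maximalAvoiding (X.crossed D) x) B
        ⟨(hB : B ∈ maximalAvoiding (X.crossed D) x), hne, hBA⟩
      rw [← SquareComplex.crossed_eq hP] at hA hB
      -- The last hypothesis is vacuous here: two crossing halfspaces of this system would form a
      -- triangle with `P`.
      rcases hX.no_triangle (hX.mem_link_of_crossed hPx hB) (hX.mem_link_of_crossed hPx hA) hPx
        hBA hB.1.2.1.1 hA.1.2.1.1 with h' | h' | h'
      exacts [absurd h' hne, absurd h' (SquareComplex.ne_of_mem_crossed hB.1).1,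
        absurd h' (SquareComplex.ne_of_mem_crossed hA.1).1]
  · push Not at hinv
    refine WallSystem.hasAvoidingAutomaton (hX.wallSystem h) hS ?_ ?_ ?_
    · rintro x -
      obtain ⟨g, hg⟩ := hfix.exists_smul_ne x
      obtain ⟨y, hxy, hgx⟩ := hX.exists_adj_mem_halfspace hg.symm
      exact ⟨g, _, SquareComplex.halfspace_mem_halfspaces hxy, fun h =>
        SquareComplex.left_notMem_halfspace x y (h.1 hgx)⟩
    · intro x _ A hA
      obtain ⟨g, h1, h2⟩ := hinv x A hA
      refine ⟨g, fun hg => ?_⟩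
      have : g • A ∈ ({A, Aᶜ} : Set (Set V)) := by
        rw [← MulAction.mem_stabilizer_iff.1 hg]
        exact Set.smul_mem_smul_set (by simp)
      exact this.elim h1 h2
    · intro x _ A hA B hB
      exact hX.exists_notMem_stabilizer h hfix hA hB.1 hB.2.1.symm
        (by rw [Set.inter_comm]; exact hB.2.2)

instance LetterAutomaton.finite (S : Type u) [Finite S] (N : ℕ) : Finite (LetterAutomaton S N) :=
  Finite.of_injective (fun c => (c.init, c.next)) fun c c' h => by
    cases c
    cases c'
    simpa using h

theorem mainTheorem2 (S : Type u) [Fintype S] :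
    ∃ (k : ℕ) (A : Fin k → CheckpointAutomaton S),
      (∀ j, HasGrowthRateAtLeast (A j).language ((Fintype.card S : ℝ) / 6)) ∧
      ∀ (V : Type v) (X : SquareComplex V), X.IsCAT0 →
        ∀ ρ : FreeGroup S →* X.Aut, ¬ X.HasGlobalFixedPoint ρ →
          ∃ j, ∀ w ∈ (A j).language, w ≠ [] → ρ (FreeGroup.mk w) ≠ 1 := by
  rcases Nat.eq_zero_or_pos (Fintype.card S) with hS | hS
  -- Without letters the group is trivial and fixes every vertex.
  · refine ⟨0, Fin.elim0, fun j => j.elim0, fun V X hX ρ hρ => absurd ?_ hρ⟩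
    have := Fintype.card_eq_zero_iff.1 hS
    obtain ⟨x⟩ := hX.1.1.nonempty
    refine ⟨_, Or.inl ⟨x, rfl⟩, fun g => ?_⟩
    rw [Subsingleton.elim g 1, map_one]
    exact Finsupp.mapDomain_id
  have hκ : 0 < (Fintype.card S : ℝ) / 6 := by positivity
  -- The list consists of all valid automata of the bounded size and does not depend on the action.
  let T := {c : LetterAutomaton S (stateBound S) // c.IsValid ((Fintype.card S : ℝ) / 6)}
  obtain ⟨k, ⟨e⟩⟩ := Finite.exists_equiv_fin T
  refine ⟨k, fun j => (e.symm j).1.toCheckpoint (e.symm j).2 hκ, fun j =>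
    (e.symm j).2.hasGrowthRateAtLeast hκ, fun V X hX ρ hρ => ?_⟩
  let : MulAction (FreeGroup S) V := MulAction.compHom V (X.Aut.subtype.comp ρ)
  have hsmul : ∀ (g : FreeGroup S) (v : V), g • v = (ρ g : Equiv.Perm V) v := fun _ _ => rfl
  have hact : X.ActsOn (FreeGroup S) := fun g a b => (ρ g).2.1 a b
  have hfix : X.HasNoFixedPoint (FreeGroup S) := by
    unfold SquareComplex.HasGlobalFixedPoint at hρ
    push Not at hρ
    exact hρ
  obtain ⟨c, hc, hT⟩ := hX.hasAvoidingAutomaton hact hfix hS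
  refine ⟨e ⟨c, hc⟩, fun w hw hne hw1 => hT w ?_ hne fun v => ?_⟩
  · have := LetterAutomaton.accepts_of_reads (e.symm (e ⟨c, hc⟩)).2 hκ none w hw
    rwa [Equiv.symm_apply_apply] at this
  · rw [hsmul, hw1]
    rfl

end Main
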